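/- Let $H$ be an infinite-dimensional real separable Hilbert space with inner product $(\cdot,\cdot)$ and norm $|\cdot|$, and let $A$ be an unbounded positive self-adjoint operator on $H$ with compact resolvent, with eigenvalues $0<\lambda_1\le\lambda_2\le\cdots\to\infty$ and a complete orthonormal system of eigenvectors $Ae_n=\lambda_ne_n$. (Then, for every $\nu>0$, $-\nu A$ automatically generates an analytic semigroup of contractions with $|A^pe^{-\nu tA}x|\le c_{p,\nu}t^{-p}|x|$ for all $p,t>0$, $x\in H$.) For $s\in\mathbb R$ let $H^s=D(A^{s/2})$ be the space of series $x=\sum_nx_ne_n$ with $\|x\|_s^2:=\sum_n\lambda_n^sx_n^2<\infty$, and let $\langle\cdot,\cdot\rangle$ be the duality $\langle x,y\rangle=\sum_nx_ny_n$ of $H^{-s}$ and $H^{s}$. Let $B:H\times H\to H^{-1}$ be bilinear with $\|B(u,v)\|_{-1}\le c\,|u|\,|v|$ for some constant $c>0$. Let $\beta>0$ and $0\le\alpha<\beta$ be such that: * for all $u\in H$ and $v,w\in H^1$: $\langle B(u,v),w\rangle=-\langle B(u,w),v\rangle$ and $\langle B(u,v),v\rangle=0$; and $\langle B(u,u),A^\beta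 u\rangle=0$ for all $u\in H^{1+2\beta}$; * $\sum_n\lambda_n^{\alpha-\beta}<\infty$; * $B$ maps $H^\alpha\times H^\alpha$ into $H^{\beta-1}$ with $\|B(u,v)\|_{\beta-1}\le c\|u\|_\alpha\|v\|_\alpha$ for all $u,v\in H^\alpha$; and, if $\alpha>0$, $B$ maps $H\times H^\alpha$ into $H^{\alpha-1}$ with $\|B(u,v)\|_{\alpha-1}\le c|u|\,\|v\|_\alpha$ for all $u\in H$, $v\in H^\alpha$. Let $\nu>0$, let $(\Omega,\mathcal F,(\mathcal F_t)_{t\ge0},\mathbb P)$ be a stochastic basis such that $\mathcal F_0$ contains all $\mathbb P$-null events, and let $w(t)=\sum_nw_n(t)e_n$ be a cylindrical Wiener process on it, that is, the $w_n$ are independent standard real $(\mathcal F_t)$-Brownian motions and the increments of $w$ after any time $s$ are independent of $\mathcal F_s$. Consider $$du(t)+[\nu Au(t)+B(u(t),u(t))]\,dt=\sqrt{2A^{1-\beta}}\,dw(t),\qquad u(0)=x. \qquad (*)$$ A solution of $(*)$ on $[0,T]$ is an adapted $H^\alpha$-valued process $u$ with $u(0)=x$ and $u\in C([0,T];H^\alpha)$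 $\mathbb P$-a.s. such that, $\mathbb P$-a.s., for all $t\in[0,T]$ the identity $$u(t)+\int_0^t[\nu Au(r)+B(u(r),u(r))]\,dr=x+\sqrt{2A^{1-\beta}}\,w(t)$$ of series $\sum_n a_ne_n$ holds, i.e. it holds in each coordinate $n$. Then: 1. (Strong existence.) For every $x\in H^\alpha$ there is a process $u(\cdot;x)$ that is a solution of $(*)$ on $[0,T]$ for every $T\geq 0$ and is adapted to the filtration generated by $w$ and the $\mathbb P$-null events. 2. (Pathwise uniqueness.) For all $x\in H^\alpha$ and $T\geq 0$, any two $(\mathcal F_t)$-adapted solutions $u_1,u_2$ of $(*)$ on $[0,T]$ with the same initial datum $x$ satisfy, $\mathbb P$-a.s., $u_1(t)=u_2(t)$ for all $t\in[0,T]$. 3. (Markov property.) The laws $P(t,x,\cdot)$ of $u(t;x)$ on $H^\alpha$ form a semigroup of Markov kernels on $H^\alpha$, and, with $P_t\varphi(x):=\mathbb E[\varphi(u(t;x))]$, for all bounded Borel $\varphi:H^\alpha\to\mathbb R$, $x\in H^\alpha$ and $s,t\ge0$, $$\mathbb E[\varphi(u(s+t;x))\mid\mathcal F_s]=(P_t\varphi)(u(s;x))\qquad\mathbb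 P\text{-a.s.}$$ 4. (Feller property.) For every $t\ge0$, $P_t$ maps $C_b(H^\alpha)$ into $C_b(H^\alpha)$. -/

import Mathlib

open MeasureTheory ProbabilityTheory Filter Topology
open scoped NNReal ENNReal

noncomputable section

/-- An unbounded positive self-adjoint operator `A` with compact resolvent on an
infinite-dimensional separable real Hilbert space `H`, together with its nondecreasingly numbered
eigenvalues `0 < lam 0 ≤ lam 1 ≤ ⋯ → ∞` and a complete orthonormal system of eigenvectors
`e 0, e 1, …`. -/
structure PositiveOperator (H : Type*) [NormedAddCommGroup H] [InnerProductSpace ℝ H]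
    [CompleteSpace H] where
  /-- the operator -/
  A : H →ₗ.[ℝ] H
  selfAdjoint : IsSelfAdjoint A
  /-- the eigenbasis -/
  e : HilbertBasis ℕ ℝ H
  /-- the eigenvalues -/
  lam : ℕ → ℝ
  lam_pos : ∀ n, 0 < lam n
  lam_mono : Monotone lam
  lam_tendsto : Tendsto lam atTop atTop
  e_mem : ∀ n, e n ∈ A.domain
  apply_e : ∀ n, A ⟨e n, e_mem n⟩ = lam n • e n

namespace PositiveOperator

variable {H : Type*} [NormedAddCommGroup H] [InnerProductSpace ℝ H] [CompleteSpace H]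

/-- The formal series `∑ xₙ eₙ` (identified with their coefficients) that belong to
`H^s = D(A^{s/2})`: those with `∑ (λₙ^{s/2} xₙ)² < ∞`. Here `s` is any real number. -/
def scaleSubmodule (S : PositiveOperator H) (s : ℝ) : Submodule ℝ (ℕ → ℝ) where
  carrier := {x | Memℓp (fun n => S.lam n ^ (s / 2) * x n) 2}
  zero_mem' := by
    refine (congrArg (fun f : ℕ → ℝ => Memℓp f 2) ?_).mp (zero_memℓp : Memℓp (0 : ∀ _ : ℕ, ℝ) 2)
    funext n
    simp
  add_mem' := by
    intro x y hx hy
    have h := Memℓp.add hx hy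
    refine (congrArg (fun f : ℕ → ℝ => Memℓp f 2) ?_).mp h
    funext n
    simp [mul_add]
  smul_mem' := by
    intro c x hx
    have h := Memℓp.const_smul hx c
    refine (congrArg (fun f : ℕ → ℝ => Memℓp f 2) ?_).mp h
    funext n
    simp only [Pi.smul_apply, smul_eq_mul]
    ring

/-- The Hilbert space `H^s = D(A^{s/2})`. -/
def Scale (S : PositiveOperator H) (s : ℝ) : Type := S.scaleSubmodule s

namespace Scale

variable {S : PositiveOperator H} {s : ℝ}

instance : AddCommGroup (S.Scale s) := inferInstanceAs (AddCommGroup (S.scaleSubmodule s))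

instance : Module ℝ (S.Scale s) := inferInstanceAs (Module ℝ (S.scaleSubmodule s))

/-- The coefficients `(xₙ)` of `x = ∑ xₙ eₙ ∈ H^s`. -/
def coeff : S.Scale s →ₗ[ℝ] (ℕ → ℝ) := (S.scaleSubmodule s).subtype

/-- The map `A^{s/2} : H^s → H`, with `H` identified with `ℓ²` through the eigenbasis. -/
def toL2 : S.Scale s →ₗ[ℝ] lp (fun _ : ℕ => ℝ) 2 where
  toFun x := ⟨fun n => S.lam n ^ (s / 2) * coeff x n, x.2⟩
  map_add' x y := by
    ext n
    exact mul_add _ _ _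
  map_smul' c x := by
    ext n
    simp [mul_left_comm]

theorem toL2_injective : Function.Injective (toL2 : S.Scale s →ₗ[ℝ] lp (fun _ : ℕ => ℝ) 2) := by
  intro x y h
  apply Subtype.ext
  funext n
  have h1 : S.lam n ^ (s / 2) * coeff x n = S.lam n ^ (s / 2) * coeff y n :=
    congrFun (congrArg Subtype.val h) n
  exact mul_left_cancel₀ (Real.rpow_pos_of_pos (S.lam_pos n) _).ne' h1

/-- The norm `‖x‖_s = |A^{s/2} x|`. -/
instance : NormedAddCommGroup (S.Scale s) :=
  NormedAddCommGroup.induced (S.Scale s) (lp (fun _ : ℕ => ℝ) 2) toL2 toL2_injective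

/-- The scalar product `⟨x, y⟩_s = (A^{s/2} x, A^{s/2} y)`. -/
instance : InnerProductSpace ℝ (S.Scale s) where
  norm_smul_le c x := by
    change ‖toL2 (c • x)‖ ≤ ‖c‖ * ‖toL2 x‖
    rw [map_smul, norm_smul]
  inner x y := inner ℝ (toL2 x) (toL2 y)
  norm_sq_eq_re_inner x := norm_sq_eq_re_inner (𝕜 := ℝ) (toL2 x)
  conj_inner_symm x y := inner_conj_symm (toL2 x) (toL2 y)
  add_left x y z := by simp [inner_add_left]
  smul_left x y c := by simp [inner_smul_left]

instance : MeasurableSpace (S.Scale s) := borel _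

instance : BorelSpace (S.Scale s) := ⟨rfl⟩

/-- For `s ≥ 0`, the inclusion `H^s ⊆ H`. -/
def toH (x : S.Scale s) : H := ∑' n, coeff x n • S.e n

/-- `‖x‖_s² = ∑ λₙ^s xₙ²`. -/
theorem norm_sq_eq_tsum (x : S.Scale s) : ‖x‖ ^ 2 = ∑' n, S.lam n ^ s * coeff x n ^ 2 := by
  have h : ‖x‖ ^ 2 = ‖toL2 x‖ ^ 2 := rfl
  rw [h, ← real_inner_self_eq_norm_sq, lp.inner_eq_tsum]
  refine tsum_congr fun n => ?_
  have h2 : S.lam n ^ s = S.lam n ^ (s / 2) * S.lam n ^ (s / 2) := by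
    rw [← Real.rpow_add (S.lam_pos n), add_halves]
  change S.lam n ^ (s / 2) * coeff x n * (S.lam n ^ (s / 2) * coeff x n) = _
  rw [h2]
  ring

/-- For `s ≥ 0` the coefficients of the element `toH x` of `H` are those of `x`. -/
theorem repr_toH (hs : 0 ≤ s) (x : S.Scale s) (n : ℕ) : S.e.repr x.toH n = coeff x n := by
  have hm : Memℓp (coeff x) 2 := by
    have h := Memℓp.const_smul x.2 ((S.lam 0 ^ (s / 2))⁻¹)
    refine memℓp_gen ?_
    have h2 := h.summable (by simp)
    refine Summable.of_nonneg_of_le (fun i => by positivity) (fun i => ?_) h2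
    have h0 : 0 < S.lam 0 ^ (s / 2) := Real.rpow_pos_of_pos (S.lam_pos 0) _
    have hi : S.lam 0 ^ (s / 2) ≤ S.lam i ^ (s / 2) :=
      Real.rpow_le_rpow (S.lam_pos 0).le (S.lam_mono (Nat.zero_le i)) (by positivity)
    refine Real.rpow_le_rpow (norm_nonneg _) ?_ (by simp)
    change ‖coeff x i‖ ≤ ‖(S.lam 0 ^ (s / 2))⁻¹ * (S.lam i ^ (s / 2) * coeff x i)‖
    rw [norm_mul, norm_mul, norm_inv, Real.norm_of_nonneg h0.le,
      Real.norm_of_nonneg (h0.le.trans hi), ← mul_assoc]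
    refine le_mul_of_one_le_left (norm_nonneg _) ?_
    rw [inv_mul_eq_div, one_le_div h0]
    exact hi
  have h3 := (S.e.hasSum_repr_symm ⟨coeff x, hm⟩).tsum_eq
  have h4 : x.toH = S.e.repr.symm ⟨coeff x, hm⟩ := h3
  rw [h4, LinearIsometryEquiv.apply_symm_apply]

end Scale

open Scale

/-- The duality `⟨f, g⟩ = ∑ fₙ gₙ` of formal series `f ∈ H^{-s}`, `g ∈ H^s`. -/
def pairing (f g : ℕ → ℝ) : ℝ := ∑' n, f n * g n

/-- `A^r`, acting on the coefficients of formal series. -/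
def powA (S : PositiveOperator H) (r : ℝ) (x : ℕ → ℝ) : ℕ → ℝ := fun n => S.lam n ^ r * x n

/-- The basic bound `‖B(u,v)‖_{-1} ≤ c |u| |v|` on `B : H × H → H^{-1}`. -/
def BasicBound (S : PositiveOperator H) (B : H →ₗ[ℝ] H →ₗ[ℝ] S.Scale (-1)) : Prop :=
  ∃ c > 0, ∀ u v : H, ‖B u v‖ ≤ c * ‖u‖ * ‖v‖

/-- Condition (C2), with the given exponent `β > 0` in (iii): antisymmetry and the two
conservation laws. The pairings are those of `H^{-1}` with `H^1`; note that `A^β u ∈ H^1` for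
`u ∈ H^{1+2β}`. -/
structure CondC2 (S : PositiveOperator H) (B : H →ₗ[ℝ] H →ₗ[ℝ] S.Scale (-1)) (β : ℝ) :
    Prop where
  antisymm : ∀ (u : H) (v w : S.Scale 1),
    pairing (coeff (B u v.toH)) (coeff w) = -pairing (coeff (B u w.toH)) (coeff v)
  energy : ∀ (u : H) (v : S.Scale 1), pairing (coeff (B u v.toH)) (coeff v) = 0
  pos : 0 < β
  conserved : ∀ u : S.Scale (1 + 2 * β),
    pairing (coeff (B u.toH u.toH)) (S.powA β (coeff u)) = 0

/-- Condition (C3): `0 ≤ α < β` and the embedding `H^β ⊆ H^α` is Hilbert–Schmidt. -/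
structure CondC3 (S : PositiveOperator H) (α β : ℝ) : Prop where
  nonneg : 0 ≤ α
  lt : α < β
  summable : Summable fun n => S.lam n ^ (α - β)

/-- Condition (C4): `B` maps `H^α × H^α` to `H^{β-1}` with `‖B(u,v)‖_{β-1} ≤ c ‖u‖_α ‖v‖_α`
and, if `α > 0`, maps `H × H^α` to `H^{α-1}` with `‖B(u,v)‖_{α-1} ≤ c |u| ‖v‖_α`. -/
structure CondC4 (S : PositiveOperator H) (B : H →ₗ[ℝ] H →ₗ[ℝ] S.Scale (-1)) (α β : ℝ) :
    Prop where
  bound : ∃ c > 0, ∀ u v : S.Scale α, ∃ f : S.Scale (β - 1),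
    coeff f = coeff (B u.toH v.toH) ∧ ‖f‖ ≤ c * ‖u‖ * ‖v‖
  bound' : 0 < α → ∃ c > 0, ∀ (u : H) (v : S.Scale α), ∃ f : S.Scale (α - 1),
    coeff f = coeff (B u v.toH) ∧ ‖f‖ ≤ c * ‖u‖ * ‖v‖

end PositiveOperator

variable {Ω : Type*} [mΩ : MeasurableSpace Ω]

/-- `w(t) = ∑ wₙ(t) eₙ` is a cylindrical Wiener process relative to the filtration `𝓕`: its
coordinates `wₙ` are independent standard real Brownian motions, adapted to `𝓕`, and the
increments of `w` after time `s` are independent of `𝓕 s`. -/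
structure IsCylindricalWiener (P : Measure Ω) (𝓕 : Filtration ℝ≥0 mΩ) (w : ℕ → ℝ≥0 → Ω → ℝ) :
    Prop where
  brownian : ∀ n, IsBrownianReal (w n) P
  indep : iIndepFun (fun (n : ℕ) (ω : Ω) (t : ℝ≥0) => w n t ω) P
  adapted : ∀ n t, Measurable[𝓕 t] (w n t)
  indep_increments : ∀ s t, s ≤ t →
    Indep (MeasurableSpace.comap (fun (ω : Ω) (n : ℕ) => w n t ω - w n s ω) inferInstance)
      (𝓕 s) P

/-- The σ-algebra generated by `w` up to time `t` and by the `P`-null events. -/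
@[reducible]
def augmentedNatural (P : Measure Ω) (w : ℕ → ℝ≥0 → Ω → ℝ) (t : ℝ≥0) : MeasurableSpace Ω :=
  (⨆ (n : ℕ) (s : ℝ≥0) (_ : s ≤ t), MeasurableSpace.comap (w n s) inferInstance) ⊔
    MeasurableSpace.generateFrom {N | MeasurableSet N ∧ P N = 0}

open PositiveOperator Scale in
/-- The process `u` is a solution on `[0,T]`, with paths in `C([0,T]; H^α)` almost surely, of
`du + [νAu + B(u,u)] dt = √(2A^{1-β}) dw`, `u(0) = x`, adapted to the σ-algebras `𝓖`. The noise
being additive, the equation is the identity of formal series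
`u(t) + ∫₀ᵗ [νAu(r) + B(u(r),u(r))] dr = x + √(2A^{1-β}) w(t)`,
required for all `t ∈ [0,T]` almost surely. -/
structure IsSolutionOn {H : Type*} [NormedAddCommGroup H] [InnerProductSpace ℝ H]
    [CompleteSpace H] (S : PositiveOperator H) (B : H →ₗ[ℝ] H →ₗ[ℝ] S.Scale (-1))
    (ν α β : ℝ) (P : Measure Ω) (𝓖 : ℝ≥0 → MeasurableSpace Ω) (w : ℕ → ℝ≥0 → Ω → ℝ)
    (x : S.Scale α) (T : ℝ≥0) (u : ℝ≥0 → Ω → S.Scale α) : Prop where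
  adapted : ∀ t ≤ T, Measurable[𝓖 t] (u t)
  initial : ∀ᵐ ω ∂P, u 0 ω = x
  continuousOn : ∀ᵐ ω ∂P, ContinuousOn (fun t => u t ω) (Set.Icc 0 T)
  equation : ∀ᵐ ω ∂P, ∀ t ≤ T, ∀ n,
    coeff (u t ω) n
        + ∫ r in (0 : ℝ)..t, (ν * (S.lam n * coeff (u r.toNNReal ω) n)
            + coeff (B (u r.toNNReal ω).toH (u r.toNNReal ω).toH) n)
      = coeff x n + √(2 * S.lam n ^ (1 - β)) * w n t ω

end

/-! The noise is additive, so the randomness can be removed path by path. In coordinate n the linear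
equation is solved by an Ornstein–Uhlenbeck path, an explicit continuous functional `ou` of the
Brownian path; the series z of these paths is the stochastic convolution. If z is a continuous
H^α-valued path, the equation for v = u - z is a deterministic parabolic equation with forcing B(v +
z, v + z), and everything reduces to a solution map (x, z) ↦ u.

Deterministic part. The linear flow takes forcing in L²(0,T; H^{α-1}) to C([0,T]; H^α)
(`exists_linear_solution`), and B maps H^α × H^α boundedly into H^{α-1}, so a Lipschitz truncation
of B gives a contraction. The truncation is removed by an a priori bound (`exists_apriori_bound`).
Since ⟨B(u,v),v⟩ = 0, the energy balance of v contains only ⟨B(u,z),v⟩, which is controlled by |u|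
|z| ‖v‖_1; the last factor is absorbed by the dissipation and Gronwall bounds |u|. With |u| bounded,
‖B(u,u)‖_{α-1} ≤ c |u| ‖u‖_α is linear in ‖u‖_α, and Gronwall applies again. The same Lipschitz
estimates give uniqueness and continuity of the solution map (`exists_solution_map`).

Noise. To obtain z in C([0,∞); H^α) from ∑ λₙ^{α-β} < ∞ alone, the modes are grouped in dyadic
blocks λₙ ~ Λ = 2^k λ₀. Over one relaxation time 1/Λ the Ornstein–Uhlenbeck block is controlled by
the oscillation of the Brownian block, whose squared ℓ² norm is at most Λ⁻¹ (card + O(k)) up to a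
random constant, by Gaussian exponential moments and chaining. The logarithmic loss occurs once per
block, not once per mode. The H^α weight turns this into Λ^{α-β} (card + O(k)), which is summable
(`sum_noiseCoeff_le`, `summable_blockBound`).

Probability. The strong solution is the solution map applied to x and z(w), and every solution must
equal it almost surely. It depends on the noise up to time t only, hence is adapted. Restarting at
time s replaces w by its increments after s, which are independent of 𝓕 s and distributed like w
(`indep_shift`, `map_prod_shift`); this yields the semigroup and Markov properties. The Feller
property is continuity in x combined with dominated convergence. -/

namespace PositiveOperator

variable {H : Type*} [NormedAddCommGroup H] [InnerProductSpace ℝ H] [CompleteSpace H]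

/-! ### Coordinates, completeness and truncations in the scale H^s. -/

namespace Scale

variable {S : PositiveOperator H} {s : ℝ}

theorem coeff_injective : Function.Injective (coeff : S.Scale s →ₗ[ℝ] (ℕ → ℝ)) :=
  Subtype.val_injective

theorem ext_coeff {x y : S.Scale s} (h : ∀ n, coeff x n = coeff y n) : x = y :=
  coeff_injective (funext h)

theorem lam_rpow_sq (S : PositiveOperator H) (s : ℝ) (n : ℕ) (a : ℝ) :
    ‖S.lam n ^ (s / 2) * a‖ ^ 2 = S.lam n ^ s * a ^ 2 := by
  have h2 : S.lam n ^ s = S.lam n ^ (s / 2) * S.lam n ^ (s / 2) := by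
    rw [← Real.rpow_add (S.lam_pos n), add_halves]
  rw [Real.norm_eq_abs, sq_abs, h2]
  ring

theorem summable_sq (x : S.Scale s) : Summable fun n => S.lam n ^ s * coeff x n ^ 2 := by
  have h := (x.2 : Memℓp (fun n => S.lam n ^ (s / 2) * coeff x n) 2).summable (by simp)
  refine h.congr fun n => ?_
  rw [← lam_rpow_sq, ENNReal.toReal_ofNat, Real.rpow_ofNat]
  rfl

theorem lam_rpow_mul_sq_nonneg (S : PositiveOperator H) (s : ℝ) (n : ℕ) (a : ℝ) :
    0 ≤ S.lam n ^ s * a ^ 2 :=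
  mul_nonneg (Real.rpow_nonneg (S.lam_pos n).le _) (sq_nonneg _)

theorem sum_le_norm_sq (x : S.Scale s) (F : Finset ℕ) :
    ∑ n ∈ F, S.lam n ^ s * coeff x n ^ 2 ≤ ‖x‖ ^ 2 := by
  rw [norm_sq_eq_tsum]
  exact (summable_sq x).sum_le_tsum F fun n _ => lam_rpow_mul_sq_nonneg S s n _

theorem norm_sq_le_of_sum_le (x : S.Scale s) {C : ℝ}
    (h : ∀ N, ∑ n ∈ Finset.range N, S.lam n ^ s * coeff x n ^ 2 ≤ C) : ‖x‖ ^ 2 ≤ C := by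
  rw [norm_sq_eq_tsum]
  exact Real.tsum_le_of_sum_range_le (fun n => lam_rpow_mul_sq_nonneg S s n _) h

theorem exists_of_sum_le (a : ℕ → ℝ) {C : ℝ}
    (h : ∀ N, ∑ n ∈ Finset.range N, S.lam n ^ s * a n ^ 2 ≤ C) :
    ∃ x : S.Scale s, coeff x = a ∧ ‖x‖ ^ 2 ≤ C := by
  have hs : Summable fun n => S.lam n ^ s * a n ^ 2 :=
    summable_of_sum_range_le (fun n => lam_rpow_mul_sq_nonneg S s n _) h
  have hm : Memℓp (fun n => S.lam n ^ (s / 2) * a n) 2 := by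
    refine memℓp_gen (hs.congr fun n => ?_)
    rw [← lam_rpow_sq]
    norm_num
  exact ⟨⟨a, hm⟩, rfl, norm_sq_le_of_sum_le _ h⟩

theorem abs_coeff_le (x : S.Scale s) (n : ℕ) : |coeff x n| ≤ S.lam n ^ (-(s / 2)) * ‖x‖ := by
  have h := sum_le_norm_sq x {n}
  rw [Finset.sum_singleton, ← lam_rpow_sq] at h
  have h2 := abs_le_of_sq_le_sq h (norm_nonneg _)
  rw [abs_norm, Real.norm_eq_abs] at h2
  have hp : 0 < S.lam n ^ (s / 2) := Real.rpow_pos_of_pos (S.lam_pos n) _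
  rw [Real.rpow_neg (S.lam_pos n).le, inv_mul_eq_div, le_div_iff₀ hp]
  rw [abs_mul, abs_of_pos hp] at h2
  linarith

/-- The `n`-th coordinate as a continuous functional. -/
noncomputable def coeffL (n : ℕ) : S.Scale s →L[ℝ] ℝ :=
  LinearMap.mkContinuous (LinearMap.proj n ∘ₗ coeff) (S.lam n ^ (-(s / 2))) fun x =>
    abs_coeff_le x n

theorem continuous_coeff (n : ℕ) : Continuous fun x : S.Scale s => coeff x n :=
  (coeffL n).continuous

/-- The isometry `A^{s/2}` of `H^s` onto `ℓ²`. -/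
noncomputable def toL2Equiv : S.Scale s ≃ₗᵢ[ℝ] lp (fun _ : ℕ => ℝ) 2 where
  toLinearEquiv := LinearEquiv.ofBijective toL2 ⟨toL2_injective, fun y => by
    have hm : Memℓp (fun n => S.lam n ^ (s / 2) * (S.lam n ^ (-(s / 2)) * y n)) 2 := by
      refine (congrArg (fun f : ℕ → ℝ => Memℓp f 2) ?_).mp y.2
      funext n
      rw [← mul_assoc, ← Real.rpow_add (S.lam_pos n), add_neg_cancel, Real.rpow_zero, one_mul]
    refine ⟨⟨_, hm⟩, ?_⟩
    ext n
    change S.lam n ^ (s / 2) * (S.lam n ^ (-(s / 2)) * y n) = y n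
    rw [← mul_assoc, ← Real.rpow_add (S.lam_pos n), add_neg_cancel, Real.rpow_zero, one_mul]⟩
  norm_map' _ := rfl

instance : CompleteSpace (S.Scale s) :=
  (completeSpace_congr (e := (toL2Equiv (S := S) (s := s)).toEquiv)
    (toL2Equiv (S := S) (s := s)).isometry.isUniformEmbedding).mpr
    inferInstance

/-- The countable eigenbasis has dense span in H, and H is isometric to each H^s through the
coordinates. The measurability arguments on H^α and on its path space rest on this. -/
instance : SecondCountableTopology (S.Scale s) := by
  have h1 : TopologicalSpace.IsSeparable (Set.univ : Set H) := by
    have h2 := ((Set.countable_range S.e).isSeparable.span (R := ℝ)).closure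
    rw [← Submodule.topologicalClosure_coe, S.e.dense_span] at h2
    exact h2
  have h3 : TopologicalSpace.SeparableSpace H := TopologicalSpace.isSeparable_univ_iff.mp h1
  let g : H ≃ₗᵢ[ℝ] S.Scale s := S.e.repr.trans toL2Equiv.symm
  have h4 : TopologicalSpace.SeparableSpace (S.Scale s) :=
    g.surjective.denseRange.separableSpace g.continuous
  exact UniformSpace.secondCountable_of_separable _

/-- The vector `eₙ` of `H^s`. -/
noncomputable def single (n : ℕ) : S.Scale s :=
  ⟨Pi.single n 1, by
    have : (fun m => S.lam m ^ (s / 2) * (Pi.single n 1 : ℕ → ℝ) m)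
        = (lp.single 2 n (S.lam n ^ (s / 2)) : lp (fun _ : ℕ => ℝ) 2) := by
      funext m
      rw [lp.coeFn_single]
      by_cases h : m = n
      · subst h; simp
      · simp [h]
    change Memℓp (fun m => S.lam m ^ (s / 2) * (Pi.single n 1 : ℕ → ℝ) m) 2
    rw [this]
    exact lp.memℓp _⟩

theorem coeff_single (n m : ℕ) : coeff (single n : S.Scale s) m = if m = n then 1 else 0 := by
  change (Pi.single n 1 : ℕ → ℝ) m = _
  rw [Pi.single_apply]

/-- The finite sum `∑_{n ∈ F} aₙ eₙ` in `H^s`. -/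
noncomputable def ofFinset (F : Finset ℕ) (a : ℕ → ℝ) : S.Scale s := ∑ n ∈ F, a n • single n

theorem coeff_ofFinset (F : Finset ℕ) (a : ℕ → ℝ) (m : ℕ) :
    coeff (ofFinset F a : S.Scale s) m = if m ∈ F then a m else 0 := by
  rw [ofFinset, map_sum, Finset.sum_apply]
  simp [coeff_single]

theorem continuous_ofFinset {X : Type*} [TopologicalSpace X] (F : Finset ℕ) {a : X → ℕ → ℝ}
    (ha : ∀ n, Continuous fun x => a x n) : Continuous fun x => (ofFinset F (a x) : S.Scale s) := by
  unfold ofFinset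
  exact continuous_finsetSum _ fun n _ => (ha n).smul continuous_const

/-- Coordinatewise continuous families with locally uniformly small tails form a continuous map
into `H^s`. -/
theorem exists_continuous {X : Type*} [TopologicalSpace X] {a : X → ℕ → ℝ}
    (ha : ∀ n, Continuous fun x => a x n)
    (htail : ∀ x₀, ∃ U ∈ 𝓝 x₀, ∀ ε > 0, ∃ N, ∀ x ∈ U, ∀ M,
      ∑ n ∈ Finset.Ico N M, S.lam n ^ s * a x n ^ 2 ≤ ε) :
    ∃ v : X → S.Scale s, Continuous v ∧ ∀ x, coeff (v x) = a x := by
  have hex : ∀ x, ∃ y : S.Scale s, coeff y = a x := by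
    intro x
    obtain ⟨U, hU, h⟩ := htail x
    -- Any finite tail bound puts the sequence in H^s; the value 1 is arbitrary.
    obtain ⟨N, hN⟩ := h 1 one_pos
    have := exists_of_sum_le (S := S) (s := s) (a x)
      (C := (∑ n ∈ Finset.range N, S.lam n ^ s * a x n ^ 2) + 1) fun M => by
        have h1 : ∑ n ∈ Finset.range M, S.lam n ^ s * a x n ^ 2
            ≤ ∑ n ∈ Finset.range N ∪ Finset.Ico N M, S.lam n ^ s * a x n ^ 2 := by
          refine Finset.sum_le_sum_of_subset_of_nonneg (fun n hn => ?_)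
            fun n _ _ => lam_rpow_mul_sq_nonneg S s n _
          simp only [Finset.mem_union, Finset.mem_range, Finset.mem_Ico] at hn ⊢
          omega
        have h2 : Disjoint (Finset.range N) (Finset.Ico N M) := by
          rw [Finset.disjoint_left]
          intro n hn hn'
          simp only [Finset.mem_range, Finset.mem_Ico] at hn hn'
          omega
        rw [Finset.sum_union h2] at h1
        exact h1.trans (by gcongr; exact hN x (mem_of_mem_nhds hU) M)
    exact ⟨this.choose, this.choose_spec.1⟩
  choose v hv using hex
  refine ⟨v, ?_, hv⟩
  rw [continuous_iff_continuousAt]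
  intro x₀
  obtain ⟨U, hU, h⟩ := htail x₀
  -- Continuity passes to locally uniform limits, and the approximants are finite sums of continuous
  -- coordinates.
  refine continuousAt_of_locally_uniform_approx_of_continuousAt fun u hu => ?_
  obtain ⟨ε, hε, hεu⟩ := Metric.mem_uniformity_dist.mp hu
  obtain ⟨N, hN⟩ := h ((ε / 2) ^ 2) (by positivity)
  refine ⟨U, hU, fun x => ofFinset (Finset.range N) (a x),
    (continuous_ofFinset _ ha).continuousAt, fun x hx => hεu ?_⟩
  rw [dist_eq_norm]
  have h1 : ‖v x - ofFinset (Finset.range N) (a x)‖ ^ 2 ≤ (ε / 2) ^ 2 := by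
    refine norm_sq_le_of_sum_le _ fun M => ?_
    refine le_trans (le_trans ?_ (Finset.sum_le_sum_of_subset_of_nonneg
      (Finset.inter_subset_left : Finset.Ico N M ∩ Finset.range M ⊆ Finset.Ico N M)
      fun n _ _ => lam_rpow_mul_sq_nonneg S s n (a x n))) (hN x hx M)
    rw [← Finset.sum_subset (Finset.inter_subset_right : Finset.Ico N M ∩ Finset.range M ⊆ _)]
    · refine Finset.sum_le_sum fun n hn => ?_
      have : n ∉ Finset.range N := by
        simp only [Finset.mem_inter, Finset.mem_range, Finset.mem_Ico] at hn ⊢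
        omega
      rw [map_sub, Pi.sub_apply, coeff_ofFinset, if_neg this, hv, sub_zero]
    · intro n hn hn'
      have : n ∈ Finset.range N := by
        simp only [Finset.mem_inter, Finset.mem_range, Finset.mem_Ico] at hn hn' ⊢
        omega
      rw [map_sub, Pi.sub_apply, coeff_ofFinset, if_pos this, hv]
      simp
  have h2 := abs_le_of_sq_le_sq h1 (by positivity)
  rw [abs_norm] at h2
  linarith

theorem hasSum_sq_repr (S : PositiveOperator H) (x : H) :
    HasSum (fun n => S.e.repr x n ^ 2) (‖x‖ ^ 2) := by
  have h : ‖x‖ ^ 2 = ‖S.e.repr x‖ ^ 2 := by rw [LinearIsometryEquiv.norm_map]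
  rw [h, ← real_inner_self_eq_norm_sq]
  have h2 := lp.hasSum_inner (𝕜 := ℝ) (S.e.repr x) (S.e.repr x)
  simpa only [real_inner_self_eq_norm_sq, Real.norm_eq_abs, sq_abs] using h2

theorem norm_sq_toH (hs : 0 ≤ s) (x : S.Scale s) : ‖x.toH‖ ^ 2 = ∑' n, coeff x n ^ 2 := by
  rw [← (hasSum_sq_repr S x.toH).tsum_eq]
  exact tsum_congr fun n => by rw [repr_toH hs]

theorem sum_sq_coeff_le (hs : 0 ≤ s) (x : S.Scale s) (F : Finset ℕ) :
    ∑ n ∈ F, coeff x n ^ 2 ≤ ‖x.toH‖ ^ 2 := by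
  simp_rw [← repr_toH hs x]
  exact sum_le_hasSum F (fun _ _ => sq_nonneg _) (hasSum_sq_repr S x.toH)

theorem norm_sq_toH_le_of_sum_le (hs : 0 ≤ s) (x : S.Scale s) {C : ℝ}
    (h : ∀ N, ∑ n ∈ Finset.range N, coeff x n ^ 2 ≤ C) : ‖x.toH‖ ^ 2 ≤ C := by
  rw [norm_sq_toH hs]
  exact Real.tsum_le_of_sum_range_le (fun n => sq_nonneg _) h

theorem norm_toH_le (hs : 0 ≤ s) (x : S.Scale s) : ‖x.toH‖ ≤ S.lam 0 ^ (-(s / 2)) * ‖x‖ := by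
  have hp : 0 < S.lam 0 ^ (-(s / 2)) := Real.rpow_pos_of_pos (S.lam_pos 0) _
  refine le_of_sq_le_sq ?_ (by positivity)
  refine norm_sq_toH_le_of_sum_le hs x fun N => ?_
  rw [mul_pow, ← Real.rpow_mul_natCast (S.lam_pos 0).le]
  refine le_trans ?_ (mul_le_mul_of_nonneg_left (sum_le_norm_sq x (Finset.range N))
    (Real.rpow_nonneg (S.lam_pos 0).le _))
  rw [Finset.mul_sum]
  refine Finset.sum_le_sum fun n _ => ?_
  rw [← mul_assoc]
  refine le_mul_of_one_le_left (sq_nonneg _) ?_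
  have h1 : S.lam 0 ^ s ≤ S.lam n ^ s :=
    Real.rpow_le_rpow (S.lam_pos 0).le (S.lam_mono (Nat.zero_le n)) hs
  have h2 : S.lam 0 ^ (-(s / 2) * ((2 : ℕ) : ℝ)) * S.lam 0 ^ s = 1 := by
    rw [← Real.rpow_add (S.lam_pos 0)]
    norm_num
  rw [← h2]
  exact mul_le_mul_of_nonneg_left h1 (Real.rpow_nonneg (S.lam_pos 0).le _)

theorem repr_injective_ext (S : PositiveOperator H) {x y : H}
    (h : ∀ n, S.e.repr x n = S.e.repr y n) : x = y :=
  S.e.repr.injective (lp.ext (funext h))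

theorem toH_add (hs : 0 ≤ s) (x y : S.Scale s) : (x + y).toH = x.toH + y.toH :=
  repr_injective_ext S fun n => by
    rw [map_add, repr_toH hs, lp.coeFn_add, Pi.add_apply, repr_toH hs, repr_toH hs]
    simp

theorem toH_smul (hs : 0 ≤ s) (c : ℝ) (x : S.Scale s) : (c • x).toH = c • x.toH :=
  repr_injective_ext S fun n => by
    rw [map_smul, repr_toH hs, lp.coeFn_smul, Pi.smul_apply, repr_toH hs]
    simp

/-- The inclusion of `H^s` into `H` for `s ≥ 0`, as a continuous linear map. -/
noncomputable def toHL (hs : 0 ≤ s) : S.Scale s →L[ℝ] H :=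
  LinearMap.mkContinuous ⟨⟨toH, toH_add hs⟩, toH_smul hs⟩ (S.lam 0 ^ (-(s / 2)))
    (norm_toH_le hs)

end Scale
end PositiveOperator

/-! ### Scalar convolutions, linear Volterra equations and Gronwall's inequality. -/

/-- The convolution `∫₀ᵗ e^{-μ(t-s)} g(s) ds`. -/
noncomputable def duhamel (μ : ℝ) (g : ℝ → ℝ) (t : ℝ) : ℝ :=
  ∫ s in (0 : ℝ)..t, Real.exp (-μ * (t - s)) * g s

/-- Factoring the exponential frees the integrand of t; differentiation and the flow property both
start from this form. -/
theorem duhamel_eq (μ : ℝ) (g : ℝ → ℝ) (t : ℝ) :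
    duhamel μ g t = Real.exp (-μ * t) * ∫ s in (0 : ℝ)..t, Real.exp (μ * s) * g s := by
  rw [duhamel, ← intervalIntegral.integral_const_mul]
  refine intervalIntegral.integral_congr fun s _ => ?_
  simp only [← mul_assoc, ← Real.exp_add]
  congr 2
  ring

theorem duhamel_zero (μ : ℝ) (g : ℝ → ℝ) : duhamel μ g 0 = 0 := by simp [duhamel]

theorem hasDerivAt_integral {g : ℝ → ℝ} (hg : Continuous g) (t : ℝ) :
    HasDerivAt (fun t => ∫ s in (0 : ℝ)..t, g s) (g t) t :=
  intervalIntegral.integral_hasDerivAt_right (hg.intervalIntegrable _ _)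
    (hg.stronglyMeasurableAtFilter _ _) hg.continuousAt

theorem hasDerivAt_duhamel (μ : ℝ) {g : ℝ → ℝ} (hg : Continuous g) (t : ℝ) :
    HasDerivAt (duhamel μ g) (g t - μ * duhamel μ g t) t := by
  have h1 : HasDerivAt (fun t : ℝ => Real.exp (-μ * t)) (Real.exp (-μ * t) * -μ) t := by
    simpa using ((hasDerivAt_id t).const_mul (-μ)).exp
  have h2 := h1.mul (hasDerivAt_integral (g := fun s => Real.exp (μ * s) * g s) (by fun_prop) t)
  refine (h2.congr_of_eventuallyEq (Eventually.of_forall (duhamel_eq μ g))).congr_deriv ?_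
  rw [duhamel_eq, ← mul_assoc (Real.exp _), ← Real.exp_add]
  simp
  ring

theorem continuous_duhamel (μ : ℝ) {g : ℝ → ℝ} (hg : Continuous g) : Continuous (duhamel μ g) :=
  continuous_iff_continuousAt.mpr fun t => (hasDerivAt_duhamel μ hg t).continuousAt

theorem duhamel_congr {μ t : ℝ} (ht : 0 ≤ t) {g g' : ℝ → ℝ} (h : ∀ s ∈ Set.Icc 0 t, g s = g' s) :
    duhamel μ g t = duhamel μ g' t := by
  refine intervalIntegral.integral_congr fun s hs => ?_
  rw [Set.uIcc_of_le ht] at hs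
  simp only [h s hs]

theorem duhamel_add {μ : ℝ} {g g' : ℝ → ℝ} (hg : Continuous g) (hg' : Continuous g') (t : ℝ) :
    duhamel μ (fun s => g s + g' s) t = duhamel μ g t + duhamel μ g' t := by
  unfold duhamel
  rw [← intervalIntegral.integral_add]
  · simp [mul_add]
  · exact Continuous.intervalIntegrable (by fun_prop) _ _
  · exact Continuous.intervalIntegrable (by fun_prop) _ _

theorem duhamel_const_mul (μ c : ℝ) (g : ℝ → ℝ) (t : ℝ) :
    duhamel μ (fun s => c * g s) t = c * duhamel μ g t := by
  unfold duhamel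
  rw [← intervalIntegral.integral_const_mul]
  simp [mul_left_comm]

theorem duhamel_sub {μ : ℝ} {g g' : ℝ → ℝ} (hg : Continuous g) (hg' : Continuous g') (t : ℝ) :
    duhamel μ (fun s => g s - g' s) t = duhamel μ g t - duhamel μ g' t := by
  have := duhamel_add (μ := μ) (g := fun s => g s - g' s) (hg.sub hg') hg' t
  simp only [sub_add_cancel] at this
  linarith

/-- Flow property of the convolution. -/
theorem duhamel_add_time (μ : ℝ) {g : ℝ → ℝ} (hg : Continuous g) (s t : ℝ) :
    duhamel μ g (s + t)
      = Real.exp (-μ * t) * duhamel μ g s + duhamel μ (fun r => g (s + r)) t := by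
  rw [duhamel_eq, duhamel_eq, duhamel_eq,
    ← intervalIntegral.integral_add_adjacent_intervals (b := s)]
  · have h : ∫ r in s..s + t, Real.exp (μ * r) * g r
        = Real.exp (μ * s) * ∫ r in (0 : ℝ)..t, Real.exp (μ * r) * g (s + r) := by
      rw [← intervalIntegral.integral_const_mul]
      have := intervalIntegral.integral_comp_add_left (a := 0) (b := t)
        (fun r => Real.exp (μ * r) * g r) s
      rw [add_zero] at this
      rw [← this]
      refine intervalIntegral.integral_congr fun r _ => ?_
      simp only [← mul_assoc, ← Real.exp_add]
      congr 2
      ring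
    rw [h, mul_add, ← mul_assoc, ← mul_assoc, ← Real.exp_add, ← Real.exp_add]
    congr 3
    · ring_nf
    · ring_nf
  · exact Continuous.intervalIntegrable (by fun_prop) _ _
  · exact Continuous.intervalIntegrable (by fun_prop) _ _

/-- The convolution of a constant. -/
theorem mul_duhamel_const (μ c t : ℝ) :
    μ * duhamel μ (fun _ => c) t = c - Real.exp (-μ * t) * c := by
  have h := intervalIntegral.integral_eq_sub_of_hasDerivAt (a := 0) (b := t)
    (f := fun s => Real.exp (-μ * (t - s)) * c) (f' := fun s => μ * (Real.exp (-μ * (t - s)) * c))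
    (fun s _ => by
      have h1 : HasDerivAt (fun s => -μ * (t - s)) μ s := by
        simpa using ((hasDerivAt_id s).const_sub t).const_mul (-μ)
      exact (h1.exp.mul_const c).congr_deriv (by ring))
    (Continuous.intervalIntegrable (by fun_prop) _ _)
  rw [duhamel, ← intervalIntegral.integral_const_mul, h]
  simp

/-- The variation of constants formula solves `a + μ ∫₀ᵗ a = g`. -/
theorem volterra_solution (μ : ℝ) {g : ℝ → ℝ} (hg : Continuous g) (t : ℝ) :
    (g t - μ * duhamel μ g t) + μ * ∫ s in (0 : ℝ)..t, (g s - μ * duhamel μ g s) = g t := by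
  have h := intervalIntegral.integral_eq_sub_of_hasDerivAt (a := 0) (b := t)
    (fun s _ => hasDerivAt_duhamel μ hg s)
    (Continuous.intervalIntegrable (by have := continuous_duhamel μ hg; fun_prop) _ _)
  rw [h, duhamel_zero]
  ring

/-- Uniqueness for `a + μ ∫₀ᵗ a = g` on `[0,T]`. -/
theorem volterra_unique {μ T : ℝ} {a g : ℝ → ℝ} (ha : Continuous a) (hg : Continuous g)
    (h : ∀ t ∈ Set.Icc 0 T, a t + μ * ∫ s in (0 : ℝ)..t, a s = g t) {t : ℝ}
    (ht : t ∈ Set.Icc 0 T) : a t = g t - μ * duhamel μ g t := by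
  have hD : Continuous (duhamel μ g) := continuous_duhamel μ hg
  set d : ℝ → ℝ := fun s => a s - (g s - μ * duhamel μ g s) with hd
  have hdc : Continuous d := by fun_prop
  have h1 : ∀ s ∈ Set.Icc 0 T, d s = -μ * ∫ r in (0 : ℝ)..s, d r := by
    intro s hs
    have h2 := h s hs
    have h3 := volterra_solution μ hg s
    have h4 : ∫ r in (0 : ℝ)..s, d r
        = (∫ r in (0 : ℝ)..s, a r) - ∫ r in (0 : ℝ)..s, (g r - μ * duhamel μ g r) :=
      intervalIntegral.integral_sub (ha.intervalIntegrable _ _)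
        (Continuous.intervalIntegrable (by fun_prop) _ _)
    rw [h4]
    simp only [hd]
    linear_combination h2 - h3
  -- With the integrating factor e^{μs}, the primitive of d has derivative e^{μs} (μ ∫ d + d), which
  -- vanishes on [0,T] by `h1`.
  have h5 : ∀ s ∈ Set.Icc 0 T, Real.exp (μ * s) * ∫ r in (0 : ℝ)..s, d r = 0 := by
    intro s hs
    have h6 := intervalIntegral.integral_eq_sub_of_hasDerivAt (a := 0) (b := s)
      (f := fun s => Real.exp (μ * s) * ∫ r in (0 : ℝ)..s, d r)
      (f' := fun s => Real.exp (μ * s) * μ * (∫ r in (0 : ℝ)..s, d r) + Real.exp (μ * s) * d s)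
      (fun x _ => by
        have h7 : HasDerivAt (fun s => Real.exp (μ * s)) (Real.exp (μ * x) * μ) x := by
          simpa using ((hasDerivAt_id x).const_mul μ).exp
        exact h7.mul (hasDerivAt_integral hdc x))
      (Continuous.intervalIntegrable (by
        have : Continuous fun s => ∫ r in (0 : ℝ)..s, d r :=
          intervalIntegral.continuous_primitive (fun _ _ => hdc.intervalIntegrable _ _) _
        fun_prop) _ _)
    simp only [intervalIntegral.integral_same, mul_zero, sub_zero] at h6
    rw [← h6]
    have h8 : ∀ x ∈ Set.uIcc 0 s, Real.exp (μ * x) * μ * (∫ r in (0 : ℝ)..x, d r)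
        + Real.exp (μ * x) * d x = 0 := by
      intro x hx
      rw [Set.uIcc_of_le hs.1] at hx
      have h9 := h1 x ⟨hx.1, hx.2.trans hs.2⟩
      rw [h9]
      ring
    rw [intervalIntegral.integral_congr h8]
    simp
  have h10 : ∫ r in (0 : ℝ)..t, d r = 0 := by
    have := h5 t ht
    simpa [Real.exp_ne_zero] using this
  have h11 := h1 t ht
  rw [h10, mul_zero] at h11
  simp only [hd] at h11
  linarith

theorem hasDerivAt_mild (μ x : ℝ) {f : ℝ → ℝ} (hf : Continuous f) (t : ℝ) :
    HasDerivAt (fun t => Real.exp (-μ * t) * x - duhamel μ f t)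
      (-μ * (Real.exp (-μ * t) * x - duhamel μ f t) - f t) t := by
  have h1 : HasDerivAt (fun t : ℝ => Real.exp (-μ * t)) (Real.exp (-μ * t) * -μ) t := by
    simpa using ((hasDerivAt_id t).const_mul (-μ)).exp
  exact ((h1.mul_const x).sub (hasDerivAt_duhamel μ hf t)).congr_deriv (by ring)

/-- Energy identity for `a' = -μ a - f`. -/
theorem mild_sq_eq (μ x : ℝ) {f : ℝ → ℝ} (hf : Continuous f) {a : ℝ → ℝ} {t : ℝ} (ht : 0 ≤ t)
    (ha : ∀ s ∈ Set.Icc 0 t, a s = Real.exp (-μ * s) * x - duhamel μ f s) :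
    a t ^ 2 = x ^ 2 + ∫ s in (0 : ℝ)..t, (-2 * μ * a s ^ 2 - 2 * (f s * a s)) := by
  set b : ℝ → ℝ := fun s => Real.exp (-μ * s) * x - duhamel μ f s with hb
  have hbc : Continuous b := by
    have := continuous_duhamel μ hf
    fun_prop
  have h := intervalIntegral.integral_eq_sub_of_hasDerivAt (a := 0) (b := t)
    (f := fun s => b s ^ 2) (f' := fun s => -2 * μ * b s ^ 2 - 2 * (f s * b s))
    (fun s _ => ((hasDerivAt_mild μ x hf s).pow 2).congr_deriv (by simp only [hb]; ring))
    (Continuous.intervalIntegrable (by fun_prop) _ _)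
  have h2 : ∫ s in (0 : ℝ)..t, (-2 * μ * a s ^ 2 - 2 * (f s * a s))
      = ∫ s in (0 : ℝ)..t, (-2 * μ * b s ^ 2 - 2 * (f s * b s)) := by
    refine intervalIntegral.integral_congr fun s hs => ?_
    rw [Set.uIcc_of_le ht] at hs
    simp only [ha s hs, hb]
  rw [h2, h, ha t ⟨ht, le_rfl⟩]
  simp [hb, duhamel_zero]

/-- Energy inequality for `a' = -μ a - f`. -/
theorem mild_sq_le {μ : ℝ} (hμ : 0 < μ) (x : ℝ) {f : ℝ → ℝ} (hf : Continuous f) {t : ℝ}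
    (ht : 0 ≤ t) :
    (Real.exp (-μ * t) * x - duhamel μ f t) ^ 2 ≤ x ^ 2 + μ⁻¹ * ∫ s in (0 : ℝ)..t, f s ^ 2 := by
  set b : ℝ → ℝ := fun s => Real.exp (-μ * s) * x - duhamel μ f s with hb
  have hbc : Continuous b := by
    have := continuous_duhamel μ hf
    fun_prop
  have h := mild_sq_eq μ x hf (a := b) ht fun s _ => rfl
  change b t ^ 2 ≤ _
  rw [h, ← intervalIntegral.integral_const_mul]
  refine add_le_add_right (intervalIntegral.integral_mono_on ht
    (Continuous.intervalIntegrable (by fun_prop) _ _)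
    (Continuous.intervalIntegrable (by fun_prop) _ _) fun s _ => ?_) _
  -- Completing the square spends half of the dissipation 2μb² on the forcing; the other half is
  -- discarded.
  have h3 : μ⁻¹ * f s ^ 2 - (-2 * μ * b s ^ 2 - 2 * (f s * b s))
      = μ⁻¹ * (f s + μ * b s) ^ 2 + μ * b s ^ 2 := by
    field_simp
    ring
  have h4 : 0 ≤ μ⁻¹ * (f s + μ * b s) ^ 2 + μ * b s ^ 2 := by positivity
  linarith

/-- Gronwall's inequality in integral form. -/
theorem gronwall_integral {φ : ℝ → ℝ} (hφ : Continuous φ) {a b T : ℝ} (hb : 0 ≤ b)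
    (h : ∀ t ∈ Set.Icc 0 T, φ t ≤ a + b * ∫ s in (0 : ℝ)..t, φ s) {t : ℝ}
    (ht : t ∈ Set.Icc 0 T) : φ t ≤ a * Real.exp (b * t) := by
  -- The hypothesis says precisely that this function is nonincreasing, so no sign of φ is needed.
  set Φ : ℝ → ℝ := fun t => Real.exp (-b * t) * (a + b * ∫ s in (0 : ℝ)..t, φ s) with hΦ
  have hd : ∀ s, HasDerivAt Φ (Real.exp (-b * s) * -b * (a + b * ∫ s in (0 : ℝ)..s, φ s)
      + Real.exp (-b * s) * (b * φ s)) s := fun s => by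
    have h7 : HasDerivAt (fun s => Real.exp (-b * s)) (Real.exp (-b * s) * -b) s := by
      simpa using ((hasDerivAt_id s).const_mul (-b)).exp
    exact h7.mul (((hasDerivAt_integral hφ s).const_mul b).const_add a)
  have hanti : AntitoneOn Φ (Set.Icc 0 T) := by
    refine antitoneOn_of_deriv_nonpos (convex_Icc 0 T)
      (fun s _ => (hd s).continuousAt.continuousWithinAt)
      (fun s _ => (hd s).differentiableAt.differentiableWithinAt) fun s hs => ?_
    rw [interior_Icc] at hs
    rw [(hd s).deriv]
    have h1 := h s ⟨hs.1.le, hs.2.le⟩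
    have h2 : 0 ≤ Real.exp (-b * s) * b := by positivity
    nlinarith [mul_le_mul_of_nonneg_left h1 h2]
  have h3 := hanti ⟨le_rfl, ht.1.trans ht.2⟩ ht ht.1
  simp only [hΦ, mul_zero, Real.exp_zero, intervalIntegral.integral_same, add_zero, one_mul] at h3
  have h4 := h t ht
  have h5 : Real.exp (b * t) * Real.exp (-b * t) = 1 := by
    rw [← Real.exp_add]
    simp
  calc φ t ≤ a + b * ∫ s in (0 : ℝ)..t, φ s := h4
    _ = Real.exp (b * t) * (Real.exp (-b * t) * (a + b * ∫ s in (0 : ℝ)..t, φ s)) := by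
        rw [← mul_assoc, h5, one_mul]
    _ ≤ Real.exp (b * t) * a := mul_le_mul_of_nonneg_left h3 (Real.exp_pos _).le
    _ = a * Real.exp (b * t) := mul_comm _ _

/-! ### The linear parabolic problem and globally Lipschitz perturbations. -/

namespace PositiveOperator

open Scale

variable {H : Type*} [NormedAddCommGroup H] [InnerProductSpace ℝ H] [CompleteSpace H]
  {S : PositiveOperator H} {α β ν : ℝ}

/-- Parabolic energy estimate for finitely many coordinates. -/
theorem sum_mild_sq_le (hν : 0 < ν) (F : Finset ℕ) (x : ℕ → ℝ) {f : ℝ → S.Scale (α - 1)}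
    (hf : Continuous f) {t : ℝ} (ht : 0 ≤ t) :
    ∑ n ∈ F, S.lam n ^ α * (Real.exp (-(ν * S.lam n) * t) * x n
        - duhamel (ν * S.lam n) (fun s => coeff (f s) n) t) ^ 2
      ≤ ∑ n ∈ F, S.lam n ^ α * x n ^ 2
        + ν⁻¹ * ∫ s in (0 : ℝ)..t, ∑ n ∈ F, S.lam n ^ (α - 1) * coeff (f s) n ^ 2 := by
  have hfn : ∀ n, Continuous fun s => coeff (f s) n := fun n => (continuous_coeff n).comp hf
  rw [intervalIntegral.integral_finsetSum fun n _ =>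
      Continuous.intervalIntegrable (by have := hfn n; fun_prop) _ _,
    Finset.mul_sum, ← Finset.sum_add_distrib]
  refine Finset.sum_le_sum fun n _ => ?_
  have hl := S.lam_pos n
  have h := mild_sq_le (mul_pos hν hl) (x n) (hfn n) ht
  refine (mul_le_mul_of_nonneg_left h (Real.rpow_nonneg hl.le α)).trans_eq ?_
  -- The factor 1/(νλₙ) of the scalar estimate lowers the weight λₙ^α to λₙ^{α-1}: the smoothing by
  -- one derivative.
  rw [intervalIntegral.integral_const_mul, Real.rpow_sub_one hl.ne']
  field_simp

theorem mild_norm_sq_le (hν : 0 < ν) {x v : S.Scale α} {f : ℝ → S.Scale (α - 1)}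
    (hf : Continuous f) {t : ℝ} (ht : 0 ≤ t)
    (hv : ∀ n, coeff v n = Real.exp (-(ν * S.lam n) * t) * coeff x n
        - duhamel (ν * S.lam n) (fun s => coeff (f s) n) t) :
    ‖v‖ ^ 2 ≤ ‖x‖ ^ 2 + ν⁻¹ * ∫ s in (0 : ℝ)..t, ‖f s‖ ^ 2 := by
  refine norm_sq_le_of_sum_le v fun N => ?_
  simp only [hv]
  refine (sum_mild_sq_le hν _ (coeff x) hf ht).trans ?_
  have hfn : ∀ n, Continuous fun s => coeff (f s) n := fun n => (continuous_coeff n).comp hf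
  refine add_le_add (sum_le_norm_sq _ _) (mul_le_mul_of_nonneg_left ?_ (inv_nonneg.mpr hν.le))
  refine intervalIntegral.integral_mono_on ht (Continuous.intervalIntegrable (by fun_prop) _ _)
    (Continuous.intervalIntegrable (by fun_prop) _ _) fun s _ => sum_le_norm_sq _ _

theorem tendsto_tail (x : S.Scale α) :
    Tendsto (fun N => ‖x‖ ^ 2 - ∑ n ∈ Finset.range N, S.lam n ^ α * coeff x n ^ 2) atTop (𝓝 0) := by
  have h := (summable_sq x).hasSum.tendsto_sum_nat
  rw [← norm_sq_eq_tsum] at h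
  have h2 := h.const_sub (‖x‖ ^ 2)
  rwa [sub_self] at h2

/-- Writing the tail as total minus partial sum makes the bound independent of M and continuous in
x, so it can be integrated in time. -/
theorem sum_Ico_le_tail (x : S.Scale α) (N M : ℕ) :
    ∑ n ∈ Finset.Ico N M, S.lam n ^ α * coeff x n ^ 2
      ≤ ‖x‖ ^ 2 - ∑ n ∈ Finset.range N, S.lam n ^ α * coeff x n ^ 2 := by
  have h2 : Disjoint (Finset.range N) (Finset.Ico N M) := by
    rw [Finset.disjoint_left]
    intro n hn hn'
    simp only [Finset.mem_range, Finset.mem_Ico] at hn hn'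
    omega
  have := sum_le_norm_sq x (Finset.range N ∪ Finset.Ico N M)
  rw [Finset.sum_union h2] at this
  linarith

/-- The linear parabolic problem has a continuous solution. -/
theorem exists_linear_solution (hν : 0 < ν) (x : S.Scale α) {f : ℝ → S.Scale (α - 1)}
    (hf : Continuous f) :
    ∃ v : ℝ → S.Scale α, Continuous v ∧ ∀ t, 0 ≤ t → ∀ n,
      coeff (v t) n = Real.exp (-(ν * S.lam n) * t) * coeff x n
        - duhamel (ν * S.lam n) (fun s => coeff (f s) n) t := by
  have hfn : ∀ n, Continuous fun s => coeff (f s) n := fun n => (continuous_coeff n).comp hf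
  -- The estimates hold for nonnegative times only; replacing t by max(t,0) gives a path on the
  -- whole line without altering it there.
  suffices h : ∃ v : ℝ → S.Scale α, Continuous v ∧ ∀ t, coeff (v t) = fun n =>
      Real.exp (-(ν * S.lam n) * max t 0) * coeff x n
        - duhamel (ν * S.lam n) (fun s => coeff (f s) n) (max t 0) by
    obtain ⟨v, hv, hv2⟩ := h
    refine ⟨v, hv, fun t ht n => ?_⟩
    rw [hv2, max_eq_left ht]
  refine exists_continuous (fun n => ?_) ?_
  · have := continuous_duhamel (ν * S.lam n) (hfn n)
    fun_prop
  · intro t₀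
    set T : ℝ := max (t₀ + 1) 0 with hT
    have hT0 : 0 ≤ T := le_max_right _ _
    refine ⟨Set.Iio (t₀ + 1), Iio_mem_nhds (by linarith), fun ε hε => ?_⟩
    -- Dominated convergence on the fixed interval [0,T] makes the tails small uniformly in t ≤ T,
    -- as the integral over [0,t] only grows when the interval is enlarged.
    have hlim : Tendsto (fun N => ∫ s in (0 : ℝ)..T, (‖f s‖ ^ 2
        - ∑ n ∈ Finset.range N, S.lam n ^ (α - 1) * coeff (f s) n ^ 2)) atTop (𝓝 0) := by
      have := intervalIntegral.tendsto_integral_filter_of_dominated_convergence (μ := volume)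
        (a := 0) (b := T) (l := atTop) (f := fun _ => (0 : ℝ)) (fun s => ‖f s‖ ^ 2)
        (F := fun N s => (‖f s‖ ^ 2
          - ∑ n ∈ Finset.range N, S.lam n ^ (α - 1) * coeff (f s) n ^ 2))
        (Eventually.of_forall fun N => Continuous.aestronglyMeasurable (by fun_prop))
        (Eventually.of_forall fun N => Eventually.of_forall fun s _ => by
          have h1 := sum_le_norm_sq (f s) (Finset.range N)
          have h2 : 0 ≤ ∑ n ∈ Finset.range N, S.lam n ^ (α - 1) * coeff (f s) n ^ 2 :=
            Finset.sum_nonneg fun n _ => lam_rpow_mul_sq_nonneg S _ n _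
          rw [Real.norm_eq_abs, abs_of_nonneg (by linarith)]
          linarith)
        (Continuous.intervalIntegrable (by fun_prop) _ _)
        (Eventually.of_forall fun s _ => tendsto_tail (f s))
      simpa using this
    have h1 := (hlim.const_mul ν⁻¹).add (tendsto_tail x)
    rw [mul_zero, add_zero] at h1
    obtain ⟨N, hN⟩ := (h1.eventually (ge_mem_nhds hε)).exists
    refine ⟨N, fun t ht M => ?_⟩
    have ht0 : (0 : ℝ) ≤ max t 0 := le_max_right _ _
    have htT : max t 0 ≤ T := max_le_max (le_of_lt ht) le_rfl
    refine (sum_mild_sq_le hν _ (coeff x) hf ht0).trans ?_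
    have h2 := sum_Ico_le_tail x N M
    have h3 : ∫ s in (0 : ℝ)..(max t 0), ∑ n ∈ Finset.Ico N M, S.lam n ^ (α - 1) * coeff (f s) n ^ 2
        ≤ ∫ s in (0 : ℝ)..T, (‖f s‖ ^ 2
          - ∑ n ∈ Finset.range N, S.lam n ^ (α - 1) * coeff (f s) n ^ 2) := by
      refine le_trans (intervalIntegral.integral_mono_interval le_rfl ht0 htT
        (Eventually.of_forall fun s => Finset.sum_nonneg
          fun n _ => lam_rpow_mul_sq_nonneg S _ n _)
        (Continuous.intervalIntegrable (by fun_prop) _ _)) ?_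
      exact intervalIntegral.integral_mono_on hT0 (Continuous.intervalIntegrable (by fun_prop) _ _)
        (Continuous.intervalIntegrable (by fun_prop) _ _) fun s _ => sum_Ico_le_tail _ _ _
    have h4 := mul_le_mul_of_nonneg_left h3 (inv_nonneg.mpr hν.le)
    linarith

/-- `u` solves `u(t) = e^{-νtA} x + z(t) - ∫₀ᵗ e^{-ν(t-s)A} f(s) ds` on `[0,T]`. -/
def IsMild (ν : ℝ) (x : S.Scale α) (z : ℝ → S.Scale α) (f : ℝ → S.Scale (α - 1)) (T : ℝ)
    (u : ℝ → S.Scale α) : Prop :=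
  ∀ t ∈ Set.Icc 0 T, ∀ n, coeff (u t - z t) n = Real.exp (-(ν * S.lam n) * t) * coeff x n
    - duhamel (ν * S.lam n) (fun s => coeff (f s) n) t

theorem IsMild.congr {x : S.Scale α} {z : ℝ → S.Scale α} {f g : ℝ → S.Scale (α - 1)} {T : ℝ}
    {u : ℝ → S.Scale α} (h : IsMild ν x z f T u) (hfg : ∀ s ∈ Set.Icc 0 T, f s = g s) :
    IsMild ν x z g T u := fun t ht n => by
  rw [h t ht n]
  congr 1
  exact duhamel_congr ht.1 fun s hs => by rw [hfg s ⟨hs.1, hs.2.trans ht.2⟩]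

/-- Difference of two mild solutions. -/
theorem IsMild.norm_sq_sub_le (hν : 0 < ν) {x x' : S.Scale α} {z z' : ℝ → S.Scale α}
    {f f' : ℝ → S.Scale (α - 1)} (hf : Continuous f) (hf' : Continuous f') {T : ℝ}
    {u u' : ℝ → S.Scale α} (h : IsMild ν x z f T u) (h' : IsMild ν x' z' f' T u') {t : ℝ}
    (ht : t ∈ Set.Icc 0 T) :
    ‖(u t - z t) - (u' t - z' t)‖ ^ 2
      ≤ ‖x - x'‖ ^ 2 + ν⁻¹ * ∫ s in (0 : ℝ)..t, ‖f s - f' s‖ ^ 2 := by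
  refine mild_norm_sq_le hν (hf.sub hf') ht.1 fun n => ?_
  rw [map_sub, Pi.sub_apply, h t ht n, h' t ht n]
  have := duhamel_sub (μ := ν * S.lam n) ((continuous_coeff n).comp hf)
    ((continuous_coeff n).comp hf') t
  simp only [Function.comp_def] at this
  simp only [map_sub, Pi.sub_apply, this]
  ring

/-- Global existence for globally Lipschitz nonlinearities. -/
theorem exists_isMild_of_lipschitz (hν : 0 < ν) {G : S.Scale α → S.Scale (α - 1)} {ℓ : ℝ≥0}
    (hG : LipschitzWith ℓ G) (x : S.Scale α) {z : ℝ → S.Scale α} (hz : Continuous z) {T : ℝ}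
    (hT : 0 ≤ T) : ∃ u : ℝ → S.Scale α, Continuous u ∧ IsMild ν x z (fun s => G (u s)) T u := by
  -- The rate of the weight e^{-Lt}. Integrating e^{2Ls} gains 1/(2L), so the squared contraction
  -- factor is at most (L/2)/(2L) = 1/4; the summand 1 keeps L positive when ℓ = 0.
  set L : ℝ := 2 * ℓ ^ 2 / ν + 1 with hL
  have hL0 : 0 < L := by positivity
  have hLℓ : ν⁻¹ * (ℓ : ℝ) ^ 2 ≤ L / 2 := by
    rw [hL]
    have : ν⁻¹ * (ℓ : ℝ) ^ 2 = (2 * (ℓ : ℝ) ^ 2 / ν) / 2 := by field_simp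
    linarith
  -- The unknown g stands for e^{-Lt} u(t), so the plain sup norm of g is the weighted norm of u and
  -- the iteration contracts on all of [0,T] at once.
  let ext : C(Set.Icc 0 T, S.Scale α) → ℝ → S.Scale α :=
    fun g s => Real.exp (L * s) • g (Set.projIcc 0 T hT s)
  have hext : ∀ g, Continuous (ext g) := fun g =>
    (by fun_prop : Continuous fun s : ℝ => Real.exp (L * s)).smul
      (g.continuous.comp continuous_projIcc)
  have hGc := hG.continuous
  choose v hvc hv using fun g => exists_linear_solution hν x (hGc.comp (hext g))
  let Φ : C(Set.Icc 0 T, S.Scale α) → C(Set.Icc 0 T, S.Scale α) := fun g =>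
    ⟨fun t => Real.exp (-L * t) • (v g t + z t), by
      have := hvc g
      fun_prop⟩
  have hmild : ∀ g, IsMild ν x z (fun s => G (ext g s)) T (fun t => v g t + z t) := by
    intro g t ht n
    rw [add_sub_cancel_right, hv g t ht.1 n]
    rfl
  have hΦ : ContractingWith (1 / 2) Φ := by
    refine ⟨by rw [← NNReal.coe_lt_coe]; norm_num, LipschitzWith.of_dist_le_mul fun g g' => ?_⟩
    rw [ContinuousMap.dist_le (by positivity)]
    intro t
    have ht := t.2
    rw [dist_eq_norm]
    change ‖Real.exp (-L * t) • (v g t + z t) - Real.exp (-L * t) • (v g' t + z t)‖ ≤ _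
    rw [← smul_sub, norm_smul, Real.norm_of_nonneg (Real.exp_pos _).le]
    have h1 := (hmild g).norm_sq_sub_le hν (hGc.comp (hext g)) (hGc.comp (hext g')) (hmild g') ht
    simp only [add_sub_cancel_right, sub_self, norm_zero] at h1
    have h2 : ∫ s in (0 : ℝ)..t, ‖G (ext g s) - G (ext g' s)‖ ^ 2
        ≤ ∫ s in (0 : ℝ)..t, (ℓ : ℝ) ^ 2 * dist g g' ^ 2 * Real.exp (2 * L * s) := by
      refine intervalIntegral.integral_mono_on ht.1
        (Continuous.intervalIntegrable (by have := hext g; have := hext g'; fun_prop) _ _)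
        (Continuous.intervalIntegrable (by fun_prop) _ _) fun s _ => ?_
      have h3 := hG.dist_le_mul (ext g s) (ext g' s)
      rw [dist_eq_norm, dist_eq_norm] at h3
      have h4 : ‖ext g s - ext g' s‖ ≤ Real.exp (L * s) * dist g g' := by
        change ‖Real.exp (L * s) • _ - Real.exp (L * s) • _‖ ≤ _
        rw [← smul_sub, norm_smul, Real.norm_of_nonneg (Real.exp_pos _).le, ← dist_eq_norm]
        exact mul_le_mul_of_nonneg_left (ContinuousMap.dist_apply_le_dist _) (Real.exp_pos _).le
      have h5 : Real.exp (2 * L * s) = Real.exp (L * s) ^ 2 := by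
        rw [← Real.exp_nat_mul]
        congr 1
        push_cast
        ring
      rw [h5]
      calc ‖G (ext g s) - G (ext g' s)‖ ^ 2 ≤ (ℓ * (Real.exp (L * s) * dist g g')) ^ 2 := by
            gcongr
            exact h3.trans (mul_le_mul_of_nonneg_left h4 ℓ.2)
        _ = _ := by ring
    have h6 : ∫ s in (0 : ℝ)..t, Real.exp (2 * L * s) ≤ Real.exp (2 * L * t) / (2 * L) := by
      rw [intervalIntegral.integral_comp_mul_left _ (by positivity : (2 * L) ≠ 0), integral_exp]
      simp only [mul_zero, Real.exp_zero, smul_eq_mul]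
      rw [inv_mul_eq_div]
      gcongr
      linarith
    rw [intervalIntegral.integral_const_mul] at h2
    have h7 : ‖v g t - v g' t‖ ^ 2 ≤ (Real.exp (L * t) * (1 / 2 * dist g g')) ^ 2 := by
      have h8 : Real.exp (2 * L * t) = Real.exp (L * t) ^ 2 := by
        rw [← Real.exp_nat_mul]
        congr 1
        push_cast
        ring
      rw [h8] at h6
      have h9 : v g t - v g' t = (v g t + z t) - (v g' t + z t) := by abel
      calc ‖v g t - v g' t‖ ^ 2
          ≤ ν⁻¹ * ∫ s in (0 : ℝ)..t, ‖G (ext g s) - G (ext g' s)‖ ^ 2 := by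
            simpa using h1
        _ ≤ ν⁻¹ * ((ℓ : ℝ) ^ 2 * dist g g' ^ 2 * (Real.exp (L * t) ^ 2 / (2 * L))) := by
            gcongr
            exact h2.trans (by gcongr)
        _ = (ν⁻¹ * (ℓ : ℝ) ^ 2) * (dist g g' ^ 2 * (Real.exp (L * t) ^ 2 / (2 * L))) := by ring
        _ ≤ (L / 2) * (dist g g' ^ 2 * (Real.exp (L * t) ^ 2 / (2 * L))) := by gcongr
        _ = _ := by
            field_simp
    have h10 := abs_le_of_sq_le_sq h7 (by positivity)
    rw [abs_norm] at h10
    have h11 : v g t + z t - (v g' t + z t) = v g t - v g' t := by abel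
    rw [h11]
    have h12 : Real.exp (-L * t) * Real.exp (L * t) = 1 := by
      rw [← Real.exp_add]
      simp
    calc Real.exp (-L * t) * ‖v g t - v g' t‖
        ≤ Real.exp (-L * t) * (Real.exp (L * t) * (1 / 2 * dist g g')) := by gcongr
      _ = ((1 / 2 : ℝ≥0) : ℝ) * dist g g' := by
          rw [← mul_assoc, h12]
          push_cast
          ring
  have : Nonempty C(Set.Icc 0 T, S.Scale α) := ⟨0⟩
  set g := ContractingWith.fixedPoint Φ hΦ with hg
  have hfix : Φ g = g := hΦ.fixedPoint_isFixedPt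
  refine ⟨ext g, hext g, fun t ht n => ?_⟩
  have h1 : ext g t = v g t + z t := by
    change Real.exp (L * t) • g (Set.projIcc 0 T hT t) = _
    rw [Set.projIcc_of_mem hT ht, ← hfix]
    change Real.exp (L * t) • Real.exp (-L * t) • (v (_) t + z t) = _
    rw [hfix, smul_smul, ← Real.exp_add]
    simp
  rw [h1]
  exact hmild g t ht n

end PositiveOperator

/-! ### The bilinear term and the energy estimate in H. -/

namespace PositiveOperator

open Scale

variable {H : Type*} [NormedAddCommGroup H] [InnerProductSpace ℝ H] [CompleteSpace H]
  {S : PositiveOperator H} {α β ν : ℝ} {B : H →ₗ[ℝ] H →ₗ[ℝ] S.Scale (-1)}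

/-- For α = 0 this is the basic bound, for α > 0 the second bound of `CondC4`. The estimate is
linear in the strong norm, with only |u| in front, which is what keeps the H^α Gronwall argument
linear. -/
theorem exists_smoothing_bound (hB : S.BasicBound B) (hα : 0 ≤ α) (hC4 : CondC4 S B α β) :
    ∃ c > 0, ∀ u v : S.Scale α, ∃ f : S.Scale (α - 1),
      coeff f = coeff (B u.toH v.toH) ∧ ‖f‖ ≤ c * ‖u.toH‖ * ‖v‖ := by
  rcases hα.eq_or_lt with rfl | h
  · obtain ⟨c, hc, h⟩ := hB
    refine ⟨c, hc, fun u v => ?_⟩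
    have h0 : (0 : ℝ) - 1 = -1 := by norm_num
    rw [h0]
    refine ⟨B u.toH v.toH, rfl, (h _ _).trans ?_⟩
    have := norm_toH_le le_rfl v
    simp only [zero_div, neg_zero, Real.rpow_zero, one_mul] at this
    gcongr
  · obtain ⟨c, hc, h⟩ := hC4.bound' h
    exact ⟨c, hc, fun u v => h u.toH v⟩

/-- `B` as a bounded bilinear map `H^α × H^α → H^{α-1}`. -/
theorem exists_bilin (hB : S.BasicBound B) (hα : 0 ≤ α) (hC4 : CondC4 S B α β) :
    ∃ (b : S.Scale α →L[ℝ] S.Scale α →L[ℝ] S.Scale (α - 1)) (c : ℝ), 0 ≤ c ∧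
      (∀ u v, coeff (b u v) = coeff (B u.toH v.toH)) ∧
      ∀ u v, ‖b u v‖ ≤ c * ‖u.toH‖ * ‖v‖ := by
  obtain ⟨c, hc, h⟩ := exists_smoothing_bound hB hα hC4
  choose f hf hfb using h
  let g : S.Scale α →ₗ[ℝ] S.Scale α →ₗ[ℝ] S.Scale (α - 1) := LinearMap.mk₂ ℝ f
    (fun u u' v => coeff_injective (by simp [hf, toH_add hα]))
    (fun a u v => coeff_injective (by simp [hf, toH_smul hα]))
    (fun u v v' => coeff_injective (by simp [hf, toH_add hα]))
    (fun a u v => coeff_injective (by simp [hf, toH_smul hα]))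
  refine ⟨g.mkContinuous₂ (c * S.lam 0 ^ (-(α / 2))) fun u v => ?_, c, hc.le, hf, hfb⟩
  refine (hfb u v).trans ?_
  have := norm_toH_le hα u
  rw [mul_assoc c, mul_assoc c, mul_assoc c]
  gcongr

theorem toH_ofFinset (hs : 0 ≤ α) (F : Finset ℕ) (a : ℕ → ℝ) :
    (ofFinset F a : S.Scale α).toH = ∑ n ∈ F, a n • S.e n := by
  refine repr_injective_ext S fun m => ?_
  rw [repr_toH hs, coeff_ofFinset, map_sum, lp.coeFn_sum, Finset.sum_apply]
  simp only [map_smul, lp.coeFn_smul, Pi.smul_apply, HilbertBasis.repr_self, lp.single_apply,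
    smul_eq_mul]
  simp [Pi.single_apply]

theorem pairing_ofFinset (g : ℕ → ℝ) (F : Finset ℕ) (a : ℕ → ℝ) :
    pairing g (coeff (ofFinset F a : S.Scale α)) = ∑ n ∈ F, g n * a n := by
  rw [pairing, tsum_eq_sum (s := F)]
  · exact Finset.sum_congr rfl fun n hn => by rw [coeff_ofFinset, if_pos hn]
  · intro n hn
    rw [coeff_ofFinset, if_neg hn, mul_zero]

/-- Cauchy–Schwarz with the weights λₙ^{∓1/2}: the H^{-1}–H^1 duality on finitely many modes. -/
theorem abs_sum_mul_le (g : S.Scale (-1)) (F : Finset ℕ) (a : ℕ → ℝ) :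
    |∑ n ∈ F, coeff g n * a n| ≤ ‖g‖ * √(∑ n ∈ F, S.lam n * a n ^ 2) := by
  refine abs_le_of_sq_le_sq ?_ (by positivity)
  have h0 : 0 ≤ ∑ n ∈ F, S.lam n * a n ^ 2 :=
    Finset.sum_nonneg fun n _ => mul_nonneg (S.lam_pos n).le (sq_nonneg _)
  rw [mul_pow, Real.sq_sqrt h0]
  have h1 := Finset.sum_mul_sq_le_sq_mul_sq F (fun n => (√(S.lam n))⁻¹ * coeff g n)
    fun n => √(S.lam n) * a n
  have h2 : ∀ n, √(S.lam n) ≠ 0 := fun n => (Real.sqrt_pos.mpr (S.lam_pos n)).ne'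
  have h3 : ∀ n, (√(S.lam n))⁻¹ * coeff g n * (√(S.lam n) * a n) = coeff g n * a n := fun n => by
    have := h2 n
    field_simp
  simp only [h3, mul_pow, inv_pow, Real.sq_sqrt (S.lam_pos _).le] at h1
  refine h1.trans (mul_le_mul_of_nonneg_right ?_ h0)
  have h4 := sum_le_norm_sq g F
  simpa only [Real.rpow_neg_one] using h4

/-- The cancellation `⟨B(u,w), w⟩ = 0` for a truncation `w` of `a`. -/
theorem abs_sum_bilin_le (hC2 : CondC2 S B β) {c : ℝ}
    (hc : ∀ u v : H, ‖B u v‖ ≤ c * ‖u‖ * ‖v‖) (u g : H) (F : Finset ℕ) (a : ℕ → ℝ) :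
    |∑ n ∈ F, coeff (B u g) n * a n|
      ≤ c * ‖u‖ * ‖g - ∑ n ∈ F, a n • S.e n‖ * √(∑ n ∈ F, S.lam n * a n ^ 2) := by
  have h1 := hC2.energy u (ofFinset F a)
  rw [toH_ofFinset zero_le_one, pairing_ofFinset] at h1
  have h2 : ∑ n ∈ F, coeff (B u g) n * a n
      = ∑ n ∈ F, coeff (B u (g - ∑ n ∈ F, a n • S.e n)) n * a n := by
    rw [← sub_zero (∑ n ∈ F, coeff (B u g) n * a n), ← h1, ← Finset.sum_sub_distrib]
    refine Finset.sum_congr rfl fun n _ => ?_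
    rw [map_sub, map_sub, Pi.sub_apply]
    ring
  rw [h2]
  exact (abs_sum_mul_le _ F a).trans (mul_le_mul_of_nonneg_right (hc _ _) (Real.sqrt_nonneg _))

theorem tendsto_sum_coeff_smul (hα : 0 ≤ α) (v : S.Scale α) :
    Tendsto (fun N => ∑ n ∈ Finset.range N, coeff v n • S.e n) atTop (𝓝 v.toH) := by
  have h := (S.e.hasSum_repr v.toH).tendsto_sum_nat
  simpa only [repr_toH hα] using h

theorem norm_sum_coeff_smul_le (hα : 0 ≤ α) (v : S.Scale α) (F : Finset ℕ) :
    ‖∑ n ∈ F, coeff v n • S.e n‖ ≤ ‖v.toH‖ := by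
  refine le_of_sq_le_sq ?_ (norm_nonneg _)
  rw [← toH_ofFinset zero_le_one]
  refine norm_sq_toH_le_of_sum_le zero_le_one _ fun N => ?_
  refine le_trans (le_of_eq ?_) (sum_sq_coeff_le hα v ((Finset.range N).filter (· ∈ F)))
  rw [Finset.sum_filter]
  exact Finset.sum_congr rfl fun n _ => by
    rw [coeff_ofFinset]
    split_ifs <;> simp

theorem continuous_toH (hα : 0 ≤ α) : Continuous (toH : S.Scale α → H) := (toHL hα).continuous

/-- Energy estimate in `H`. -/
theorem IsMild.norm_sq_toH_le (hν : 0 < ν) (hα : 0 ≤ α) (hC2 : CondC2 S B β) {c : ℝ}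
    (hc : ∀ u v : H, ‖B u v‖ ≤ c * ‖u‖ * ‖v‖) {x : S.Scale α} {z u : ℝ → S.Scale α}
    (hz : Continuous z) (hu : Continuous u) {f : ℝ → S.Scale (α - 1)} (hf : Continuous f)
    {χ : ℝ → ℝ} (hχ : ∀ s, 0 ≤ χ s ∧ χ s ≤ 1)
    (hfB : ∀ s n, coeff (f s) n = χ s * coeff (B (u s).toH (u s).toH) n) {T : ℝ}
    (h : IsMild ν x z f T u) {t : ℝ} (ht : t ∈ Set.Icc 0 T) :
    ‖(u t - z t).toH‖ ^ 2 ≤ ‖x.toH‖ ^ 2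
      + c ^ 2 / (2 * ν) * ∫ s in (0 : ℝ)..t, ‖(u s).toH‖ ^ 2 * ‖(z s).toH‖ ^ 2 := by
  set v : ℝ → S.Scale α := fun s => u s - z s with hv
  have hvc : Continuous v := hu.sub hz
  have hH := continuous_toH (S := S) hα
  have hcn : ∀ n, Continuous fun s => coeff (v s) n := fun n => (continuous_coeff n).comp hvc
  have hfn : ∀ n, Continuous fun s => coeff (f s) n := fun n => (continuous_coeff n).comp hf
  let P : ℕ → ℝ → H := fun N s => ∑ n ∈ Finset.range N, coeff (v s) n • S.e n
  have hPc : ∀ N, Continuous (P N) := fun N => by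
    simp only [P]
    fun_prop
  -- v(s) need not lie in H^1, so the cancellation is applied to its truncation P N s. This leaves u
  -- - P N s in place of z, and z reappears as N → ∞.
  have hN : ∀ N, ∑ n ∈ Finset.range N, coeff (v t) n ^ 2 ≤ ‖x.toH‖ ^ 2
      + c ^ 2 / (2 * ν) * ∫ s in (0 : ℝ)..t, ‖(u s).toH‖ ^ 2 * ‖(u s).toH - P N s‖ ^ 2 := by
    intro N
    have h1 : ∀ n, coeff (v t) n ^ 2 = coeff x n ^ 2 + ∫ s in (0 : ℝ)..t,
        (-2 * (ν * S.lam n) * coeff (v s) n ^ 2 - 2 * (coeff (f s) n * coeff (v s) n)) :=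
      fun n => mild_sq_eq (ν * S.lam n) (coeff x n) (hfn n) (a := fun s => coeff (v s) n) ht.1
        fun s hs => h s ⟨hs.1, hs.2.trans ht.2⟩ n
    rw [Finset.sum_congr rfl fun n _ => h1 n, Finset.sum_add_distrib,
      ← intervalIntegral.integral_finsetSum fun n _ =>
        Continuous.intervalIntegrable (by have := hfn n; have := hcn n; fun_prop) _ _,
      ← intervalIntegral.integral_const_mul]
    refine add_le_add (sum_sq_coeff_le hα x _) (intervalIntegral.integral_mono_on ht.1
      (Continuous.intervalIntegrable (by fun_prop) _ _)
      (Continuous.intervalIntegrable (by have := hPc N; fun_prop) _ _) fun s _ => ?_)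
    set e : ℝ := ∑ n ∈ Finset.range N, S.lam n * coeff (v s) n ^ 2 with he
    have he0 : 0 ≤ e :=
      Finset.sum_nonneg fun n _ => mul_nonneg (S.lam_pos n).le (sq_nonneg _)
    have h2 := abs_sum_bilin_le hC2 hc (u s).toH (u s).toH (Finset.range N) (coeff (v s))
    have h3 : ∑ n ∈ Finset.range N,
        (-2 * (ν * S.lam n) * coeff (v s) n ^ 2 - 2 * (coeff (f s) n * coeff (v s) n))
        = -2 * ν * e - 2 * (χ s * ∑ n ∈ Finset.range N,
          coeff (B (u s).toH (u s).toH) n * coeff (v s) n) := by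
      rw [Finset.sum_sub_distrib, he, Finset.mul_sum, Finset.mul_sum, Finset.mul_sum]
      congr 1
      · exact Finset.sum_congr rfl fun n _ => by ring
      · exact Finset.sum_congr rfl fun n _ => by rw [hfB]; ring
    rw [h3]
    set q : ℝ := ∑ n ∈ Finset.range N, coeff (B (u s).toH (u s).toH) n * coeff (v s) n
    set g : ℝ := ‖(u s).toH‖ * ‖(u s).toH - P N s‖ with hg
    have hg0 : 0 ≤ g := by positivity
    have h4 : -(χ s * q) ≤ c * g * √e := by
      have h5 : |χ s * q| ≤ |q| := by
        rw [abs_mul, abs_of_nonneg (hχ s).1]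
        exact mul_le_of_le_one_left (abs_nonneg _) (hχ s).2
      have h6 := neg_le_of_abs_le (h5.trans h2)
      have h7 : c * ‖(u s).toH‖ * ‖(u s).toH - ∑ n ∈ Finset.range N, coeff (v s) n • S.e n‖ * √e
          = c * g * √e := by
        simp only [hg, P]
        ring
      linarith
    have h8 : c ^ 2 / (2 * ν) * (‖(u s).toH‖ ^ 2 * ‖(u s).toH - P N s‖ ^ 2)
        = c ^ 2 * g ^ 2 / (2 * ν) := by
      rw [hg]
      ring
    rw [h8]
    -- Young's inequality: the H^1 part √e of the truncation is absorbed entirely by the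
    -- dissipation, so the bound is uniform in N.
    have h9 : 2 * (c * g * √e) - 2 * ν * e ≤ c ^ 2 * g ^ 2 / (2 * ν) := by
      rw [le_div_iff₀ (by positivity)]
      have h10 := Real.sq_sqrt he0
      have h11 : (2 * (c * g * √e) - 2 * ν * e) * (2 * ν)
          = c ^ 2 * g ^ 2 - (c * g - 2 * ν * √e) ^ 2 + 4 * ν ^ 2 * (√e ^ 2 - e) := by ring
      rw [h11, h10]
      linarith [sq_nonneg (c * g - 2 * ν * √e)]
    linarith
  refine norm_sq_toH_le_of_sum_le hα _ fun M => ?_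
  have hlim : Tendsto (fun N => ‖x.toH‖ ^ 2 + c ^ 2 / (2 * ν) *
      ∫ s in (0 : ℝ)..t, ‖(u s).toH‖ ^ 2 * ‖(u s).toH - P N s‖ ^ 2) atTop
      (𝓝 (‖x.toH‖ ^ 2 + c ^ 2 / (2 * ν) *
        ∫ s in (0 : ℝ)..t, ‖(u s).toH‖ ^ 2 * ‖(z s).toH‖ ^ 2)) := by
    refine Tendsto.const_add _ (Tendsto.const_mul _ ?_)
    refine intervalIntegral.tendsto_integral_filter_of_dominated_convergence
      (fun s => ‖(u s).toH‖ ^ 2 * (‖(u s).toH‖ + ‖(v s).toH‖) ^ 2)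
      (Eventually.of_forall fun N =>
        Continuous.aestronglyMeasurable (by have := hPc N; fun_prop))
      (Eventually.of_forall fun N => Eventually.of_forall fun s _ => ?_)
      (Continuous.intervalIntegrable (by fun_prop) _ _)
      (Eventually.of_forall fun s _ => ?_)
    · rw [Real.norm_of_nonneg (by positivity)]
      gcongr
      exact (norm_sub_le _ _).trans (add_le_add_right (norm_sum_coeff_smul_le hα _ _) _)
    · have h1 := tendsto_sum_coeff_smul hα (v s)
      have h2 : (z s).toH = (u s).toH - (v s).toH := by
        have h3 := toH_add hα (v s) (z s)
        rw [hv] at h3 ⊢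
        simp only [sub_add_cancel] at h3
        rw [h3]
        abel
      rw [h2]
      exact ((h1.const_sub _).norm.pow 2).const_mul _
  refine ge_of_tendsto hlim ?_
  -- The number M of modes on the left stays fixed while the truncation level N of the estimate goes
  -- to infinity.
  filter_upwards [eventually_ge_atTop M] with N hMN
  refine le_trans ?_ (hN N)
  exact Finset.sum_le_sum_of_subset_of_nonneg (Finset.range_mono hMN) fun _ _ _ => sq_nonneg _

end PositiveOperator

/-! ### A priori bounds, stability, and existence on bounded intervals. -/

namespace PositiveOperator

open Scale

variable {H : Type*} [NormedAddCommGroup H] [InnerProductSpace ℝ H] [CompleteSpace H]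
  {S : PositiveOperator H} {α β ν : ℝ} {B : H →ₗ[ℝ] H →ₗ[ℝ] S.Scale (-1)}
  {b : S.Scale α →L[ℝ] S.Scale α →L[ℝ] S.Scale (α - 1)}

theorem add_norm_sq_le {E : Type*} [SeminormedAddCommGroup E] (x y : E) :
    ‖x + y‖ ^ 2 ≤ 2 * ‖x‖ ^ 2 + 2 * ‖y‖ ^ 2 := by
  have h1 := norm_add_le x y
  have h2 : ‖x + y‖ ^ 2 ≤ (‖x‖ + ‖y‖) ^ 2 := pow_le_pow_left₀ (norm_nonneg _) h1 2
  nlinarith [sq_nonneg (‖x‖ - ‖y‖)]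

/-- A priori bound for the equation with a damped nonlinearity. -/
theorem exists_apriori_bound (hν : 0 < ν) (hα : 0 ≤ α) (hB : S.BasicBound B) (hC2 : CondC2 S B β)
    {c : ℝ} (hbB : ∀ u v, coeff (b u v) = coeff (B u.toH v.toH))
    (hb : ∀ u v, ‖b u v‖ ≤ c * ‖u.toH‖ * ‖v‖) (K T : ℝ) (hT : 0 ≤ T) :
    ∃ M > 0, ∀ (x : S.Scale α) (z u : ℝ → S.Scale α) (χ : ℝ → ℝ), Continuous z → Continuous u →
      Continuous χ → (∀ s, 0 ≤ χ s ∧ χ s ≤ 1) → ‖x‖ ≤ K → (∀ s ∈ Set.Icc 0 T, ‖z s‖ ≤ K) →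
      IsMild ν x z (fun s => χ s • b (u s) (u s)) T u → ∀ t ∈ Set.Icc 0 T, ‖u t‖ ≤ M := by
  obtain ⟨c₀, hc₀, hB⟩ := hB
  set k : ℝ := S.lam 0 ^ (-(α / 2)) with hk
  have hk0 : 0 < k := Real.rpow_pos_of_pos (S.lam_pos 0) _
  -- k K bounds the data in H, and 2D is the Gronwall rate of |v|² after |u|² ≤ 2|v|² + 2|z|². M₀
  -- then bounds |u|² on [0,T], and D', A' play the roles of D, A for ‖v‖_α².
  set D : ℝ := c₀ ^ 2 / (2 * ν) * (k * K) ^ 2 with hD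
  have hD0 : 0 ≤ D := by positivity
  set A : ℝ := (k * K) ^ 2 + D * (2 * (k * K) ^ 2 * T) with hA
  have hA0 : 0 ≤ A := by positivity
  set M₀ : ℝ := 2 * (A * Real.exp (2 * D * T)) + 2 * (k * K) ^ 2 with hM₀
  have hM₀0 : 0 ≤ M₀ := by positivity
  set D' : ℝ := ν⁻¹ * (c ^ 2 * M₀) with hD'
  have hD'0 : 0 ≤ D' := by positivity
  set A' : ℝ := K ^ 2 + D' * (2 * K ^ 2 * T) with hA'
  have hA'0 : 0 ≤ A' := by positivity
  refine ⟨√(2 * (A' * Real.exp (2 * D' * T)) + 2 * K ^ 2) + 1, by positivity, ?_⟩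
  intro x z u χ hz hu hχc hχ hxK hzK hmild t ht
  have hbc : Continuous fun s => χ s • b (u s) (u s) := by fun_prop
  have hH := continuous_toH (S := S) hα
  have hxH : ‖x.toH‖ ^ 2 ≤ (k * K) ^ 2 := by
    have := norm_toH_le hα x
    gcongr
    exact this.trans (by gcongr)
  have hzH : ∀ s ∈ Set.Icc 0 T, ‖(z s).toH‖ ^ 2 ≤ (k * K) ^ 2 := fun s hs => by
    have h1 := norm_toH_le hα (z s)
    have h2 := hzK s hs
    gcongr
    exact h1.trans (by gcongr)
  set v : ℝ → S.Scale α := fun s => u s - z s with hv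
  have hvc : Continuous v := hu.sub hz
  have huv : ∀ s, u s = v s + z s := fun s => by simp [hv]
  have hvH : ∀ t ∈ Set.Icc 0 T, ‖(v t).toH‖ ^ 2 ≤ A * Real.exp (2 * D * t) := by
    intro t ht
    refine gronwall_integral (φ := fun s => ‖(v s).toH‖ ^ 2) (by fun_prop)
      (by positivity) (fun t ht => ?_) ht
    have h1 := IsMild.norm_sq_toH_le hν hα hC2 hB hz hu hbc hχ
      (fun s n => by rw [map_smul, Pi.smul_apply, hbB, smul_eq_mul]) hmild ht
    have h2 : ∫ s in (0 : ℝ)..t, ‖(u s).toH‖ ^ 2 * ‖(z s).toH‖ ^ 2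
        ≤ ∫ s in (0 : ℝ)..t, (2 * ‖(v s).toH‖ ^ 2 + 2 * (k * K) ^ 2) * (k * K) ^ 2 := by
      refine intervalIntegral.integral_mono_on ht.1 (Continuous.intervalIntegrable (by fun_prop) _ _)
        (Continuous.intervalIntegrable (by fun_prop) _ _) fun s hs => ?_
      have hs' := hzH s ⟨hs.1, hs.2.trans ht.2⟩
      have h3 := add_norm_sq_le (v s).toH (z s).toH
      rw [← toH_add hα, ← huv] at h3
      refine mul_le_mul ?_ hs' (by positivity) (by positivity)
      linarith
    rw [intervalIntegral.integral_mul_const, intervalIntegral.integral_add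
      (Continuous.intervalIntegrable (by fun_prop) _ _)
      (Continuous.intervalIntegrable (by fun_prop) _ _), intervalIntegral.integral_const_mul,
      intervalIntegral.integral_const, smul_eq_mul, sub_zero] at h2
    have h4 := mul_le_mul_of_nonneg_left h2 (by positivity : 0 ≤ c₀ ^ 2 / (2 * ν))
    have h5 : D * (2 * (k * K) ^ 2 * t) ≤ D * (2 * (k * K) ^ 2 * T) := by
      have := ht.2
      gcongr
    calc ‖(v t).toH‖ ^ 2 ≤ _ := h1
      _ ≤ (k * K) ^ 2 + c₀ ^ 2 / (2 * ν) * ((2 * (∫ s in (0 : ℝ)..t, ‖(v s).toH‖ ^ 2)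
            + t * (2 * (k * K) ^ 2)) * (k * K) ^ 2) := add_le_add hxH h4
      _ = (k * K) ^ 2 + D * (2 * (k * K) ^ 2 * t)
            + 2 * D * ∫ s in (0 : ℝ)..t, ‖(v s).toH‖ ^ 2 := by
          rw [hD]
          ring
      _ ≤ _ := by
          rw [hA]
          gcongr
  have huH : ∀ t ∈ Set.Icc 0 T, ‖(u t).toH‖ ^ 2 ≤ M₀ := by
    intro t ht
    have h3 := add_norm_sq_le (v t).toH (z t).toH
    rw [← toH_add hα, ← huv] at h3
    have h4 := hvH t ht
    have h5 : A * Real.exp (2 * D * t) ≤ A * Real.exp (2 * D * T) := by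
      have := ht.2
      gcongr
    have h6 := hzH t ht
    linarith
  have hvE : ∀ t ∈ Set.Icc 0 T, ‖v t‖ ^ 2 ≤ A' * Real.exp (2 * D' * t) := by
    intro t ht
    refine gronwall_integral (φ := fun s => ‖v s‖ ^ 2) (by fun_prop)
      (by positivity) (fun t ht => ?_) ht
    have h1 := mild_norm_sq_le hν hbc ht.1 (hmild t ht)
    have h2 : ∫ s in (0 : ℝ)..t, ‖χ s • b (u s) (u s)‖ ^ 2
        ≤ ∫ s in (0 : ℝ)..t, (c ^ 2 * M₀) * (2 * ‖v s‖ ^ 2 + 2 * K ^ 2) := by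
      refine intervalIntegral.integral_mono_on ht.1 (Continuous.intervalIntegrable (by fun_prop) _ _)
        (Continuous.intervalIntegrable (by fun_prop) _ _) fun s hs => ?_
      have hs' : s ∈ Set.Icc 0 T := ⟨hs.1, hs.2.trans ht.2⟩
      have h3 := add_norm_sq_le (v s) (z s)
      rw [← huv] at h3
      have h4 : ‖z s‖ ^ 2 ≤ K ^ 2 := by
        have := hzK s hs'
        gcongr
      have h5 : ‖χ s • b (u s) (u s)‖ ≤ c * ‖(u s).toH‖ * ‖u s‖ := by
        rw [norm_smul, Real.norm_of_nonneg (hχ s).1]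
        exact (mul_le_of_le_one_left (norm_nonneg _) (hχ s).2).trans (hb _ _)
      calc ‖χ s • b (u s) (u s)‖ ^ 2 ≤ (c * ‖(u s).toH‖ * ‖u s‖) ^ 2 := by gcongr
        _ = (c ^ 2 * ‖(u s).toH‖ ^ 2) * ‖u s‖ ^ 2 := by ring
        _ ≤ (c ^ 2 * M₀) * (2 * ‖v s‖ ^ 2 + 2 * K ^ 2) := by
            have := huH s hs'
            gcongr
            linarith
    rw [intervalIntegral.integral_const_mul, intervalIntegral.integral_add
      (Continuous.intervalIntegrable (by fun_prop) _ _)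
      (Continuous.intervalIntegrable (by fun_prop) _ _), intervalIntegral.integral_const_mul,
      intervalIntegral.integral_const, smul_eq_mul, sub_zero] at h2
    have h4 := mul_le_mul_of_nonneg_left h2 (by positivity : 0 ≤ ν⁻¹)
    have h5 : D' * (2 * K ^ 2 * t) ≤ D' * (2 * K ^ 2 * T) := by
      have := ht.2
      gcongr
    have hx2 : ‖x‖ ^ 2 ≤ K ^ 2 := by gcongr
    calc ‖v t‖ ^ 2 ≤ _ := h1
      _ ≤ K ^ 2 + ν⁻¹ * (c ^ 2 * M₀ * (2 * (∫ s in (0 : ℝ)..t, ‖v s‖ ^ 2)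
            + t * (2 * K ^ 2))) := add_le_add hx2 h4
      _ = K ^ 2 + D' * (2 * K ^ 2 * t) + 2 * D' * ∫ s in (0 : ℝ)..t, ‖v s‖ ^ 2 := by
          rw [hD']
          ring
      _ ≤ _ := by
          rw [hA']
          gcongr
  refine le_trans (Real.le_sqrt_of_sq_le ?_) (le_add_of_nonneg_right zero_le_one)
  have h3 := add_norm_sq_le (v t) (z t)
  rw [← huv] at h3
  have h4 : ‖z t‖ ^ 2 ≤ K ^ 2 := by
    have := hzK t ht
    gcongr
  have h5 := hvE t ht
  have h6 : A' * Real.exp (2 * D' * t) ≤ A' * Real.exp (2 * D' * T) := by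
    have := ht.2
    gcongr
  linarith

theorem norm_bilin_sub_le {κ M : ℝ} (hκ : 0 ≤ κ) (hb : ∀ u v, ‖b u v‖ ≤ κ * ‖u‖ * ‖v‖)
    {p q : S.Scale α} (hp : ‖p‖ ≤ M) (hq : ‖q‖ ≤ M) :
    ‖b p p - b q q‖ ≤ 2 * κ * M * ‖p - q‖ := by
  -- Bilinearity, with the increment placed once in each argument; this accounts for the factor 2 in
  -- the local Lipschitz constant.
  have h1 : b p p - b q q = b p (p - q) + b (p - q) q := by
    rw [map_sub, map_sub, sub_apply]
    abel
  rw [h1]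
  have h2 := hb p (p - q)
  have h3 := hb (p - q) q
  have h4 : κ * ‖p‖ * ‖p - q‖ ≤ κ * M * ‖p - q‖ := by gcongr
  have h5 : κ * ‖p - q‖ * ‖q‖ ≤ κ * ‖p - q‖ * M := by gcongr
  refine (norm_add_le _ _).trans ?_
  linarith

/-- Lipschitz dependence on the data for solutions bounded by `M`. -/
theorem IsMild.norm_sub_le (hν : 0 < ν) {κ M D T : ℝ} (hκ : 0 ≤ κ)
    (hb : ∀ u v, ‖b u v‖ ≤ κ * ‖u‖ * ‖v‖) (hT : 0 ≤ T) {x x' : S.Scale α}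
    {z z' u u' : ℝ → S.Scale α}
    (hz : Continuous z) (hz' : Continuous z') (hu : Continuous u) (hu' : Continuous u')
    (h : IsMild ν x z (fun s => b (u s) (u s)) T u)
    (h' : IsMild ν x' z' (fun s => b (u' s) (u' s)) T u')
    (hM : ∀ t ∈ Set.Icc 0 T, ‖u t‖ ≤ M) (hM' : ∀ t ∈ Set.Icc 0 T, ‖u' t‖ ≤ M)
    (hD : 0 ≤ D) (hx : ‖x - x'‖ ≤ D) (hzD : ∀ t ∈ Set.Icc 0 T, ‖z t - z' t‖ ≤ D) {t : ℝ}
    (ht : t ∈ Set.Icc 0 T) :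
    ‖u t - u' t‖ ≤ D * √(2 * ((1 + ν⁻¹ * (2 * κ * M) ^ 2 * (2 * T))
      * Real.exp (2 * (ν⁻¹ * (2 * κ * M) ^ 2) * T)) + 2) := by
  set C : ℝ := ν⁻¹ * (2 * κ * M) ^ 2 with hC
  have hC0 : 0 ≤ C := by positivity
  set v : ℝ → S.Scale α := fun s => (u s - z s) - (u' s - z' s) with hv
  have hvc : Continuous v := (hu.sub hz).sub (hu'.sub hz')
  have huv : ∀ s, u s - u' s = v s + (z s - z' s) := fun s => by
    simp only [hv]
    abel
  have hx2 : ‖x - x'‖ ^ 2 ≤ D ^ 2 := by gcongr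
  have hvE : ∀ t ∈ Set.Icc 0 T, ‖v t‖ ^ 2 ≤ D ^ 2 * (1 + C * (2 * T)) * Real.exp (2 * C * t) := by
    intro t ht
    refine gronwall_integral (φ := fun s => ‖v s‖ ^ 2) (by fun_prop)
      (by positivity) (fun t ht => ?_) ht
    have h1 := IsMild.norm_sq_sub_le hν (by fun_prop) (by fun_prop) h h' ht
    have h2 : ∫ s in (0 : ℝ)..t, ‖b (u s) (u s) - b (u' s) (u' s)‖ ^ 2
        ≤ ∫ s in (0 : ℝ)..t, (2 * κ * M) ^ 2 * (2 * ‖v s‖ ^ 2 + 2 * D ^ 2) := by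
      refine intervalIntegral.integral_mono_on ht.1 (Continuous.intervalIntegrable (by fun_prop) _ _)
        (Continuous.intervalIntegrable (by fun_prop) _ _) fun s hs => ?_
      have hs' : s ∈ Set.Icc 0 T := ⟨hs.1, hs.2.trans ht.2⟩
      have h3 := add_norm_sq_le (v s) (z s - z' s)
      rw [← huv] at h3
      have h4 : ‖z s - z' s‖ ^ 2 ≤ D ^ 2 := by
        have := hzD s hs'
        gcongr
      have h5 := norm_bilin_sub_le hκ hb (hM s hs') (hM' s hs')
      calc ‖b (u s) (u s) - b (u' s) (u' s)‖ ^ 2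
          ≤ (2 * κ * M * ‖u s - u' s‖) ^ 2 := by gcongr
        _ = (2 * κ * M) ^ 2 * ‖u s - u' s‖ ^ 2 := by ring
        _ ≤ _ := by
            gcongr
            linarith
    rw [intervalIntegral.integral_const_mul, intervalIntegral.integral_add
      (Continuous.intervalIntegrable (by fun_prop) _ _)
      (Continuous.intervalIntegrable (by fun_prop) _ _), intervalIntegral.integral_const_mul,
      intervalIntegral.integral_const, smul_eq_mul, sub_zero] at h2
    have h4 := mul_le_mul_of_nonneg_left h2 (by positivity : 0 ≤ ν⁻¹)
    have h5 : D ^ 2 * (1 + C * (2 * t)) ≤ D ^ 2 * (1 + C * (2 * T)) := by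
      have := ht.2
      gcongr
    calc ‖v t‖ ^ 2 ≤ _ := h1
      _ ≤ D ^ 2 + ν⁻¹ * ((2 * κ * M) ^ 2 * (2 * (∫ s in (0 : ℝ)..t, ‖v s‖ ^ 2)
            + t * (2 * D ^ 2))) := add_le_add hx2 h4
      _ = D ^ 2 * (1 + C * (2 * t)) + 2 * C * ∫ s in (0 : ℝ)..t, ‖v s‖ ^ 2 := by
          rw [hC]
          ring
      _ ≤ _ := by gcongr
  have h3 := add_norm_sq_le (v t) (z t - z' t)
  rw [← huv] at h3
  have h4 : ‖z t - z' t‖ ^ 2 ≤ D ^ 2 := by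
    have := hzD t ht
    gcongr
  have h5 := hvE t ht
  have h6 : D ^ 2 * (1 + C * (2 * T)) * Real.exp (2 * C * t)
      ≤ D ^ 2 * (1 + C * (2 * T)) * Real.exp (2 * C * T) := by
    have := ht.2
    gcongr
  have h7 : ‖u t - u' t‖ ^ 2
      ≤ (D * √(2 * ((1 + C * (2 * T)) * Real.exp (2 * C * T)) + 2)) ^ 2 := by
    rw [mul_pow, Real.sq_sqrt (by positivity)]
    linarith
  have h8 := abs_le_of_sq_le_sq h7 (by positivity)
  rwa [abs_norm] at h8

/-- Radial retraction onto the ball of radius `R`. -/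
noncomputable def retract (R : ℝ) (u : S.Scale α) : S.Scale α := (R / max R ‖u‖) • u

theorem norm_retract_le {R : ℝ} (hR : 0 < R) (u : S.Scale α) : ‖retract R u‖ ≤ R := by
  have hm : 0 < max R ‖u‖ := lt_max_of_lt_left hR
  rw [retract, norm_smul, Real.norm_of_nonneg (by positivity), div_mul_eq_mul_div, div_le_iff₀ hm]
  gcongr
  exact le_max_right _ _

/-- The constant 2 is what the triangle inequality gives: one unit from moving the vector and one
from the change of the scalar factor. Any finite constant serves the contraction argument. -/
theorem norm_retract_sub_le {R : ℝ} (hR : 0 < R) (u v : S.Scale α) :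
    ‖retract R u - retract R v‖ ≤ 2 * ‖u - v‖ := by
  have hm : 0 < max R ‖u‖ := lt_max_of_lt_left hR
  have hm' : 0 < max R ‖v‖ := lt_max_of_lt_left hR
  have h1 : retract R u - retract R v
      = (R / max R ‖u‖) • (u - v) + (R / max R ‖u‖ - R / max R ‖v‖) • v := by
    simp only [retract, smul_sub, sub_smul]
    abel
  have h2 : |R / max R ‖u‖ - R / max R ‖v‖| * ‖v‖ ≤ ‖u - v‖ := by
    have h3 : R / max R ‖u‖ - R / max R ‖v‖
        = (R / max R ‖u‖) * ((max R ‖v‖ - max R ‖u‖) / max R ‖v‖) := by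
      field_simp
    rw [h3, abs_mul, abs_of_nonneg (by positivity : 0 ≤ R / max R ‖u‖),
      abs_div, abs_of_pos hm']
    have h4 : R / max R ‖u‖ ≤ 1 := (div_le_one hm).mpr (le_max_left _ _)
    have h5 : |max R ‖v‖ - max R ‖u‖| ≤ ‖u - v‖ := by
      refine (abs_max_sub_max_le_max R ‖v‖ R ‖u‖).trans ?_
      rw [sub_self, abs_zero, max_eq_right (abs_nonneg _), norm_sub_rev]
      exact abs_norm_sub_norm_le _ _
    have h6 : ‖v‖ / max R ‖v‖ ≤ 1 := (div_le_one hm').mpr (le_max_right _ _)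
    calc R / max R ‖u‖ * (|max R ‖v‖ - max R ‖u‖| / max R ‖v‖) * ‖v‖
        = R / max R ‖u‖ * |max R ‖v‖ - max R ‖u‖| * (‖v‖ / max R ‖v‖) := by ring
      _ ≤ 1 * ‖u - v‖ * 1 := by gcongr
      _ = _ := by ring
  rw [h1]
  refine (norm_add_le _ _).trans ?_
  rw [norm_smul, norm_smul, Real.norm_of_nonneg (by positivity), Real.norm_eq_abs]
  have h4 : R / max R ‖u‖ ≤ 1 := (div_le_one hm).mpr (le_max_left _ _)
  have h5 : R / max R ‖u‖ * ‖u - v‖ ≤ 1 * ‖u - v‖ := by gcongr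
  linarith

/-- Existence on a bounded interval. -/
theorem exists_isMild (hν : 0 < ν) (hα : 0 ≤ α) (hB : S.BasicBound B) (hC2 : CondC2 S B β)
    {c : ℝ} (hbB : ∀ u v, coeff (b u v) = coeff (B u.toH v.toH))
    (hb : ∀ u v, ‖b u v‖ ≤ c * ‖u.toH‖ * ‖v‖) {κ : ℝ} (hκ : 0 ≤ κ)
    (hbκ : ∀ u v, ‖b u v‖ ≤ κ * ‖u‖ * ‖v‖) (x : S.Scale α) {z : ℝ → S.Scale α}
    (hz : Continuous z) {T : ℝ} (hT : 0 ≤ T) :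
    ∃ u : ℝ → S.Scale α, Continuous u ∧ IsMild ν x z (fun s => b (u s) (u s)) T u := by
  obtain ⟨K₀, hK₀⟩ := isCompact_Icc.exists_bound_of_continuousOn (s := Set.Icc 0 T) hz.continuousOn
  -- The bound is uniform over all damping factors χ in [0,1], so R can be fixed before the
  -- truncation at radius R is introduced.
  obtain ⟨R, hR, hbound⟩ := exists_apriori_bound (b := b) hν hα hB hC2 hbB hb (max ‖x‖ K₀) T hT
  let G : S.Scale α → S.Scale (α - 1) := fun u => b (retract R u) (retract R u)
  have hG : LipschitzWith ⟨2 * κ * R * 2, by positivity⟩ G :=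
    LipschitzWith.of_dist_le_mul fun u v => by
      rw [dist_eq_norm, dist_eq_norm]
      refine (norm_bilin_sub_le hκ hbκ (norm_retract_le hR u) (norm_retract_le hR v)).trans ?_
      have := norm_retract_sub_le hR u v
      calc 2 * κ * R * ‖retract R u - retract R v‖
          ≤ 2 * κ * R * (2 * ‖u - v‖) := by gcongr
        _ = _ := by
            rw [← mul_assoc]
            rfl
  obtain ⟨u, hu, hmild⟩ := exists_isMild_of_lipschitz hν hG x hz hT
  -- Radial truncation is scalar damping of B(u,u), so it preserves the energy cancellation. The
  -- truncated solution therefore stays in the ball where truncation does nothing.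
  have hGχ : ∀ s, G (u s) = ((R / max R ‖u s‖) ^ 2) • b (u s) (u s) := fun s => by
    simp only [G, retract, map_smul, smul_apply, smul_smul, sq]
  have hm : ∀ s, 0 < max R ‖u s‖ := fun s => lt_max_of_lt_left hR
  have hle : ∀ t ∈ Set.Icc 0 T, ‖u t‖ ≤ R := by
    refine hbound x z u (fun s => (R / max R ‖u s‖) ^ 2) hz hu ?_ (fun s => ⟨by positivity, ?_⟩)
      (le_max_left _ _) (fun s hs => (hK₀ s hs).trans (le_max_right _ _)) ?_
    · exact (continuous_const.div (continuous_const.max hu.norm) fun s => (hm s).ne').pow 2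
    · exact pow_le_one₀ (by have := hm s; positivity)
        ((div_le_one (hm s)).mpr (le_max_left _ _))
    · simpa only [hGχ] using hmild
  refine ⟨u, hu, hmild.congr fun s hs => ?_⟩
  rw [hGχ, max_eq_left (hle s hs), div_self hR.ne']
  simp

end PositiveOperator

/-! ### The global solution map and its continuity in the data. -/

namespace PositiveOperator

open Scale

variable {H : Type*} [NormedAddCommGroup H] [InnerProductSpace ℝ H] [CompleteSpace H]
  {S : PositiveOperator H} {α β ν : ℝ} {B : H →ₗ[ℝ] H →ₗ[ℝ] S.Scale (-1)}

theorem BasicBound.continuous_coeff (hB : S.BasicBound B) (hα : 0 ≤ α) (n : ℕ) :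
    Continuous fun u : S.Scale α => coeff (B u.toH u.toH) n := by
  obtain ⟨c, hc, h⟩ := hB
  have h1 : Continuous fun u : S.Scale α => B.mkContinuous₂ c h u.toH u.toH := by
    have := continuous_toH (S := S) hα
    fun_prop
  exact (Scale.continuous_coeff n).comp h1

/-- The mild form, on `[0,T]`, of the equation with initial datum `x` and forcing `z`. -/
def IsMildOn (B : H →ₗ[ℝ] H →ₗ[ℝ] S.Scale (-1)) (ν : ℝ) (x : S.Scale α)
    (z : C(ℝ≥0, S.Scale α)) (T : ℝ≥0) (u : C(ℝ≥0, S.Scale α)) : Prop :=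
  ∀ t ≤ T, ∀ n, coeff (u t) n = Real.exp (-(ν * S.lam n) * t) * coeff x n + coeff (z t) n
    - duhamel (ν * S.lam n)
      (fun s => coeff (B (u s.toNNReal).toH (u s.toNNReal).toH) n) t

theorem isMildOn_iff {b : S.Scale α →L[ℝ] S.Scale α →L[ℝ] S.Scale (α - 1)}
    (hbB : ∀ u v, coeff (b u v) = coeff (B u.toH v.toH)) {x : S.Scale α}
    {z : C(ℝ≥0, S.Scale α)} {T : ℝ≥0} {u : C(ℝ≥0, S.Scale α)} :
    IsMildOn B ν x z T u ↔ IsMild ν x (fun t => z t.toNNReal)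
      (fun s => b (u s.toNNReal) (u s.toNNReal)) T (fun t => u t.toNNReal) := by
  constructor
  · intro h t ht n
    have := h t.toNNReal (Real.toNNReal_le_iff_le_coe.mpr ht.2) n
    rw [Real.coe_toNNReal t ht.1] at this
    simp only [map_sub, Pi.sub_apply, hbB, this]
    ring
  · intro h t ht n
    have := h t ⟨t.coe_nonneg, by exact_mod_cast ht⟩ n
    simp only [map_sub, Pi.sub_apply, hbB, Real.toNNReal_coe] at this
    linarith

/-- The stability estimate at data distance zero; a common bound for both solutions comes from
compactness of [0,T]. The forcings are compared on [0,T] only, which later gives non-anticipation.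
-/
theorem IsMild.unique {b : S.Scale α →L[ℝ] S.Scale α →L[ℝ] S.Scale (α - 1)} (hν : 0 < ν) {κ : ℝ}
    (hκ : 0 ≤ κ) (hb : ∀ u v, ‖b u v‖ ≤ κ * ‖u‖ * ‖v‖) {T : ℝ} {x : S.Scale α}
    {z z' u u' : ℝ → S.Scale α}
    (hz : Continuous z) (hz' : Continuous z') (hu : Continuous u) (hu' : Continuous u')
    (hzz : ∀ t ∈ Set.Icc 0 T, z t = z' t)
    (h : IsMild ν x z (fun s => b (u s) (u s)) T u)
    (h' : IsMild ν x z' (fun s => b (u' s) (u' s)) T u') {t : ℝ} (ht : t ∈ Set.Icc 0 T) :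
    u t = u' t := by
  obtain ⟨M, hM⟩ := isCompact_Icc.exists_bound_of_continuousOn (s := Set.Icc 0 T) hu.continuousOn
  obtain ⟨M', hM'⟩ := isCompact_Icc.exists_bound_of_continuousOn (s := Set.Icc 0 T) hu'.continuousOn
  have := IsMild.norm_sub_le (D := 0) (M := max M M') hν hκ hb (ht.1.trans ht.2) hz hz' hu hu' h h'
    (fun t ht => (hM t ht).trans (le_max_left _ _))
    (fun t ht => (hM' t ht).trans (le_max_right _ _)) le_rfl (by simp)
    (fun t ht => by simp [hzz t ht]) ht
  rw [zero_mul] at this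
  exact sub_eq_zero.mp (norm_le_zero_iff.mp this)

theorem exists_bilin' (hB : S.BasicBound B) (hα : 0 ≤ α) (hC4 : CondC4 S B α β) :
    ∃ (b : S.Scale α →L[ℝ] S.Scale α →L[ℝ] S.Scale (α - 1)) (c κ : ℝ), 0 ≤ κ ∧
      (∀ u v, coeff (b u v) = coeff (B u.toH v.toH)) ∧
      (∀ u v, ‖b u v‖ ≤ c * ‖u.toH‖ * ‖v‖) ∧ ∀ u v, ‖b u v‖ ≤ κ * ‖u‖ * ‖v‖ := by
  obtain ⟨b, c, hc, hbB, hb⟩ := exists_bilin hB hα hC4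
  have hp : 0 < S.lam 0 ^ (-(α / 2)) := Real.rpow_pos_of_pos (S.lam_pos 0) _
  refine ⟨b, c, c * S.lam 0 ^ (-(α / 2)), by positivity, hbB, hb, fun u v => (hb u v).trans ?_⟩
  have := norm_toH_le hα u
  rw [mul_assoc c, mul_assoc c, mul_assoc c]
  gcongr

theorem IsMildOn.unique (hν : 0 < ν) (hα : 0 ≤ α) (hB : S.BasicBound B) (hC4 : CondC4 S B α β)
    {x : S.Scale α} {z z' u u' : C(ℝ≥0, S.Scale α)} {T : ℝ≥0} (hzz : ∀ t ≤ T, z t = z' t)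
    (h : IsMildOn B ν x z T u) (h' : IsMildOn B ν x z' T u') {t : ℝ≥0} (ht : t ≤ T) :
    u t = u' t := by
  obtain ⟨b, c, κ, hκ, hbB, hb, hbκ⟩ := exists_bilin' hB hα hC4
  rw [isMildOn_iff hbB] at h h'
  have := IsMild.unique hν hκ hbκ (by fun_prop) (by fun_prop) (by fun_prop) (by fun_prop)
    (fun t ht => hzz _ (Real.toNNReal_le_iff_le_coe.mpr ht.2)) h h'
    (t := t) ⟨t.coe_nonneg, by exact_mod_cast ht⟩
  simpa using this

theorem IsMildOn.mono {x : S.Scale α} {z u : C(ℝ≥0, S.Scale α)} {T T' : ℝ≥0}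
    (h : IsMildOn B ν x z T u) (hT : T' ≤ T) : IsMildOn B ν x z T' u :=
  fun t ht => h t (ht.trans hT)

theorem IsMildOn.congr {x : S.Scale α} {z u u' : C(ℝ≥0, S.Scale α)} {T : ℝ≥0}
    (h : IsMildOn B ν x z T u) (hu : ∀ t ≤ T, u t = u' t) : IsMildOn B ν x z T u' :=
  fun t ht n => by
    rw [← hu t ht, h t ht n]
    congr 1
    refine duhamel_congr t.coe_nonneg fun s hs => ?_
    rw [hu _ ((Real.toNNReal_le_iff_le_coe.mpr hs.2).trans ht)]

/-- The solutions on the intervals [0,N] agree on overlaps by uniqueness and glue to a path on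
[0,∞). -/
theorem exists_isMildOn (hν : 0 < ν) (hα : 0 ≤ α) (hB : S.BasicBound B) (hC2 : CondC2 S B β)
    (hC4 : CondC4 S B α β) (x : S.Scale α) (z : C(ℝ≥0, S.Scale α)) :
    ∃ u : C(ℝ≥0, S.Scale α), ∀ T, IsMildOn B ν x z T u := by
  obtain ⟨b, c, κ, hκ, hbB, hb, hbκ⟩ := exists_bilin' hB hα hC4
  have hex : ∀ N : ℕ, ∃ u : C(ℝ≥0, S.Scale α), IsMildOn B ν x z N u := by
    intro N
    obtain ⟨u, hu, h⟩ := exists_isMild hν hα hB hC2 hbB hb hκ hbκ x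
      (z := fun t => z t.toNNReal) (by fun_prop) (T := N) (by positivity)
    refine ⟨⟨fun t => u t, by fun_prop⟩, (isMildOn_iff hbB).mpr fun t ht n => ?_⟩
    have h2 := h.congr (g := fun s => b (u (s.toNNReal : ℝ)) (u (s.toNNReal : ℝ)))
      (fun s hs => by rw [Real.coe_toNNReal s hs.1]) t (by simpa using ht) n
    change coeff (u (t.toNNReal : ℝ) - z t.toNNReal) n = _
    rw [Real.coe_toNNReal t ht.1]
    exact h2
  choose u hu using hex
  have hagree : ∀ {N M : ℕ} {t : ℝ≥0}, t ≤ N → t ≤ M → u N t = u M t := by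
    intro N M t hN hM
    exact IsMildOn.unique hν hα hB hC4 (T := t) (fun _ _ => rfl) ((hu N).mono hN) ((hu M).mono hM)
      le_rfl
  have hN : ∀ t : ℝ≥0, t < ((⌈t⌉₊ + 1 : ℕ) : ℝ≥0) := fun t => by
    have := Nat.le_ceil t
    push_cast
    exact this.trans_lt (lt_add_one _)
  -- The extra 1 keeps t strictly inside the interval of the chosen solution, so that w coincides
  -- with one continuous path near t.
  let w : ℝ≥0 → S.Scale α := fun t => u (⌈t⌉₊ + 1) t
  have hw : ∀ {N : ℕ} {t : ℝ≥0}, t ≤ N → w t = u N t := fun {N t} h => hagree (hN t).le h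
  have hwc : Continuous w := by
    rw [continuous_iff_continuousAt]
    intro t
    refine ((u (⌈t⌉₊ + 1)).continuous.continuousAt (x := t)).congr ?_
    filter_upwards [Iio_mem_nhds (hN t)] with s hs
    exact (hw (le_of_lt hs)).symm
  refine ⟨⟨w, hwc⟩, fun T => ?_⟩
  refine ((hu (⌈T⌉₊ + 1)).mono (hN T).le).congr fun t ht => ?_
  exact (hw (ht.trans (hN T).le)).symm

/-- The solution map of the forced equation is continuous. -/
theorem exists_solution_map (hν : 0 < ν) (hα : 0 ≤ α) (hB : S.BasicBound B) (hC2 : CondC2 S B β)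
    (hC4 : CondC4 S B α β) :
    ∃ Sol : S.Scale α × C(ℝ≥0, S.Scale α) → C(ℝ≥0, S.Scale α), Continuous Sol ∧
      ∀ x z T, IsMildOn B ν x z T (Sol (x, z)) := by
  choose sol hsol using exists_isMildOn (B := B) hν hα hB hC2 hC4
  refine ⟨fun p => sol p.1 p.2, ?_, hsol⟩
  obtain ⟨b, c, κ, hκ, hbB, hb, hbκ⟩ := exists_bilin' hB hα hC4
  rw [continuous_iff_continuousAt]
  rintro ⟨x₀, z₀⟩
  rw [ContinuousAt, ContinuousMap.tendsto_iff_forall_isCompact_tendstoUniformlyOn]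
  intro Q hQ
  obtain ⟨T, hT⟩ := hQ.bddAbove
  obtain ⟨K₀, hK₀⟩ := (isCompact_Icc (a := (0 : ℝ≥0)) (b := T)).exists_bound_of_continuousOn
    z₀.continuous.continuousOn
  -- The extra 1 in the data bound leaves room for perturbations of size at most 1, so one M covers
  -- all nearby solutions.
  obtain ⟨M, hM, hbound⟩ := exists_apriori_bound (b := b) hν hα hB hC2 hbB hb
    (max ‖x₀‖ K₀ + 1) T T.coe_nonneg
  have hbd : ∀ x (z : C(ℝ≥0, S.Scale α)), ‖x - x₀‖ ≤ 1 → (∀ t ≤ T, ‖z t - z₀ t‖ ≤ 1) →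
      ∀ t ∈ Set.Icc (0 : ℝ) T, ‖sol x z t.toNNReal‖ ≤ M := by
    intro x z hx hz
    refine hbound x (fun t => z t.toNNReal) (fun t => sol x z t.toNNReal) (fun _ => 1)
      (by fun_prop) (by fun_prop) continuous_const (fun _ => ⟨zero_le_one, le_rfl⟩) ?_ ?_ ?_
    · have := norm_le_norm_add_norm_sub' x x₀
      have := le_max_left ‖x₀‖ K₀
      linarith
    · intro s hs
      have hs' : s.toNNReal ≤ T := Real.toNNReal_le_iff_le_coe.mpr hs.2
      have := norm_le_norm_add_norm_sub' (z s.toNNReal) (z₀ s.toNNReal)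
      have := hz _ hs'
      have := hK₀ s.toNNReal ⟨zero_le, hs'⟩
      have := le_max_right ‖x₀‖ K₀
      linarith
    · simpa only [one_smul] using (isMildOn_iff hbB).mp (hsol x z T)
  set C : ℝ := √(2 * ((1 + ν⁻¹ * (2 * κ * M) ^ 2 * (2 * T))
      * Real.exp (2 * (ν⁻¹ * (2 * κ * M) ^ 2) * T)) + 2) with hC
  rw [Metric.tendstoUniformlyOn_iff]
  intro ε hε
  set δ : ℝ := min 1 (ε / (2 * (C + 1))) with hδ
  have hC0 : 0 ≤ C := Real.sqrt_nonneg _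
  have hδ0 : 0 < δ := lt_min one_pos (by positivity)
  have h1 : ∀ᶠ p : S.Scale α × C(ℝ≥0, S.Scale α) in 𝓝 (x₀, z₀), ‖p.1 - x₀‖ ≤ δ := by
    have h2 := (continuous_fst (X := S.Scale α) (Y := C(ℝ≥0, S.Scale α))).tendsto (x₀, z₀)
    filter_upwards [h2.eventually (Metric.closedBall_mem_nhds x₀ hδ0)] with p hp
    rwa [dist_eq_norm] at hp
  have h2 : ∀ᶠ p : S.Scale α × C(ℝ≥0, S.Scale α) in 𝓝 (x₀, z₀), ∀ t ≤ T, ‖p.2 t - z₀ t‖ ≤ δ := by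
    have h3 := (continuous_snd (X := S.Scale α) (Y := C(ℝ≥0, S.Scale α))).tendsto (x₀, z₀)
    rw [ContinuousMap.tendsto_iff_forall_isCompact_tendstoUniformlyOn] at h3
    have h4 := Metric.tendstoUniformlyOn_iff.mp (h3 _ (isCompact_Icc (a := 0) (b := T))) δ hδ0
    filter_upwards [h4] with p hp t ht
    have := hp t ⟨zero_le, ht⟩
    rw [dist_comm, dist_eq_norm] at this
    exact this.le
  filter_upwards [h1, h2] with p hp1 hp2 t ht
  rw [dist_comm, dist_eq_norm]
  have hδ1 : δ ≤ 1 := min_le_left _ _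
  have h5 := IsMild.norm_sub_le hν hκ hbκ T.coe_nonneg (by fun_prop) (by fun_prop) (by fun_prop)
    (by fun_prop) ((isMildOn_iff hbB).mp (hsol p.1 p.2 T)) ((isMildOn_iff hbB).mp (hsol x₀ z₀ T))
    (hbd p.1 p.2 (hp1.trans hδ1) fun t ht => (hp2 t ht).trans hδ1)
    (hbd x₀ z₀ (by simp) (by simp)) hδ0.le hp1
    (fun s hs => hp2 _ (Real.toNNReal_le_iff_le_coe.mpr hs.2))
    (t := t) ⟨t.coe_nonneg, by exact_mod_cast hT ht⟩
  simp only [Real.toNNReal_coe] at h5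
  refine h5.trans_lt ?_
  rw [← hC]
  have h6 : δ ≤ ε / (2 * (C + 1)) := min_le_right _ _
  calc δ * C ≤ ε / (2 * (C + 1)) * C := by gcongr
    _ < ε := by
        rw [div_mul_eq_mul_div, div_lt_iff₀ (by positivity)]
        nlinarith

end PositiveOperator

/-! ### Measurability on path space and Ornstein–Uhlenbeck functionals. -/

namespace PathSpace

instance {E : Type*} [TopologicalSpace E] : MeasurableSpace C(ℝ≥0, E) := borel _

instance {E : Type*} [TopologicalSpace E] : BorelSpace C(ℝ≥0, E) := ⟨rfl⟩

section

variable {E : Type*} [MetricSpace E] [MeasurableSpace E] [BorelSpace E]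

/-- The compact-open topology has the subbasis {f maps K into U}. A compact image inside U keeps a
positive distance from the complement of U, and a lower bound on that distance can be tested on a
countable dense subset of K. Each subbasic event thus becomes a countable combination of
evaluations. -/
theorem measurable_of_eval [SecondCountableTopology E] {Ω : Type*} [MeasurableSpace Ω] {f : Ω → C(ℝ≥0, E)}
    (h : ∀ t, Measurable fun ω => f ω t) : Measurable f := by
  have hb : borel C(ℝ≥0, E) = MeasurableSpace.generateFrom
      (Set.image2 (fun K U => {f : C(ℝ≥0, E) | Set.MapsTo f K U}) {K | IsCompact K}
        {U | IsOpen U}) := borel_eq_generateFrom_of_subbasis rfl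
  change Measurable[_, borel _] f
  rw [hb]
  refine measurable_generateFrom ?_
  rintro _ ⟨K, hK, U, hU, rfl⟩
  obtain ⟨D, hDK, hDc, hDd⟩ :=
    (TopologicalSpace.IsSeparable.of_separableSpace K).exists_countable_dense_subset
  have hset : f ⁻¹' {g : C(ℝ≥0, E) | Set.MapsTo g K U}
      = ⋃ n : ℕ, ⋂ t ∈ D, {ω | ((n : ℝ≥0∞) + 1)⁻¹ ≤ Metric.infEDist (f ω t) Uᶜ} := by
    ext ω
    simp only [Set.mem_preimage, Set.mem_ofPred_eq, Set.mem_iUnion, Set.mem_iInter]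
    constructor
    · intro hm
      have h1 : IsCompact (f ω '' K) := hK.image (f ω).continuous
      obtain ⟨δ, hδ, hsub⟩ := h1.exists_thickening_subset_open hU hm.image_subset
      obtain ⟨n, hn⟩ := exists_nat_one_div_lt hδ
      refine ⟨n, fun t ht => ?_⟩
      refine Metric.le_infEDist.mpr fun y hy => ?_
      by_contra hlt
      push Not at hlt
      refine hy (hsub ?_)
      rw [Metric.mem_thickening_iff]
      refine ⟨f ω t, Set.mem_image_of_mem _ (hDK ht), ?_⟩
      rw [edist_dist, ← ENNReal.ofReal_natCast, ← ENNReal.ofReal_one,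
        ← ENNReal.ofReal_add (by positivity) zero_le_one, ← ENNReal.ofReal_inv_of_pos (by positivity),
        ENNReal.ofReal_lt_ofReal_iff (by positivity)] at hlt
      rw [dist_comm]
      rw [one_div] at hn
      exact hlt.trans hn
    · rintro ⟨n, hn⟩ t ht
      have hcl : IsClosed {t | ((n : ℝ≥0∞) + 1)⁻¹ ≤ Metric.infEDist (f ω t) Uᶜ} :=
        isClosed_le continuous_const (Metric.continuous_infEDist.comp (f ω).continuous)
      have h2 : t ∈ {t | ((n : ℝ≥0∞) + 1)⁻¹ ≤ Metric.infEDist (f ω t) Uᶜ} :=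
        hcl.closure_subset_iff.mpr hn (hDd ht)
      by_contra hU'
      have h3 : Metric.infEDist (f ω t) Uᶜ = 0 := Metric.infEDist_zero_of_mem hU'
      simp only [Set.mem_ofPred_eq, h3, nonpos_iff_eq_zero, ENNReal.inv_eq_zero] at h2
      exact ENNReal.add_ne_top.mpr ⟨ENNReal.natCast_ne_top n, ENNReal.one_ne_top⟩ h2
  rw [hset]
  refine MeasurableSet.iUnion fun n => MeasurableSet.biInter hDc fun t _ => ?_
  exact measurableSet_le measurable_const
    (Metric.continuous_infEDist.measurable.comp (h t))

theorem measurable_eval (t : ℝ≥0) : Measurable fun f : C(ℝ≥0, E) => f t :=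
  (continuous_eval_const t).measurable

end

/-- The path frozen after time `t`. -/
def stopAt {E : Type*} [TopologicalSpace E] (t : ℝ≥0) (f : C(ℝ≥0, E)) : C(ℝ≥0, E) :=
  ⟨fun s => f (min s t), by fun_prop⟩

/-- The increments of the path after time `t`. -/
def shift (t : ℝ≥0) (f : C(ℝ≥0, ℝ)) : C(ℝ≥0, ℝ) := ⟨fun s => f (t + s) - f t, by fun_prop⟩

theorem measurable_shift (t : ℝ≥0) : Measurable (shift t) :=
  measurable_of_eval fun s => (measurable_eval (t + s)).sub (measurable_eval t)

/-- The solution of `da = -μ a dt + dw`, `a(0) = w(0)`, as a function of the path `w`. -/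
noncomputable def ou (μ : ℝ) (w : C(ℝ≥0, ℝ)) : C(ℝ≥0, ℝ) :=
  ⟨fun t => w t - μ * duhamel μ (fun s => w s.toNNReal) t, by
    have := continuous_duhamel μ (g := fun s => w s.toNNReal) (by fun_prop)
    fun_prop⟩

theorem ou_apply (μ : ℝ) (w : C(ℝ≥0, ℝ)) (t : ℝ≥0) :
    ou μ w t = w t - μ * duhamel μ (fun s => w s.toNNReal) t := rfl

theorem continuous_ou (μ : ℝ) : Continuous (ou μ) := by
  refine ContinuousMap.continuous_of_continuous_uncurry _ ?_
  have h1 : Continuous fun p : C(ℝ≥0, ℝ) × ℝ≥0 => p.1 p.2 := by fun_prop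
  refine h1.sub (continuous_const.mul ?_)
  unfold duhamel
  refine intervalIntegral.continuous_parametric_intervalIntegral_of_continuous ?_ (by fun_prop)
  have h2 : Continuous fun q : (C(ℝ≥0, ℝ) × ℝ≥0) × ℝ => q.1.1 q.2.toNNReal := by fun_prop
  simp only [Function.uncurry_def]
  fun_prop

/-- Non-anticipation of the linear filter, used for adaptedness. -/
theorem ou_congr {μ : ℝ} {w w' : C(ℝ≥0, ℝ)} {t : ℝ≥0} (h : ∀ s ≤ t, w s = w' s) :
    ou μ w t = ou μ w' t := by
  rw [ou_apply, ou_apply, h t le_rfl]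
  congr 2
  exact duhamel_congr t.coe_nonneg fun s hs => h _ (Real.toNNReal_le_iff_le_coe.mpr hs.2)

/-- After time s the path relaxes from its value at s and is driven by increments alone. The
constant w(s) subtracted in `shift` is accounted for by the convolution of a constant. -/
theorem ou_add_time (μ : ℝ) (w : C(ℝ≥0, ℝ)) (s t : ℝ≥0) :
    ou μ w (s + t) = Real.exp (-μ * t) * ou μ w s + ou μ (shift s w) t := by
  have hc : Continuous fun r : ℝ => w r.toNNReal := by fun_prop
  have h1 := duhamel_add_time μ hc s t
  have h2 : duhamel μ (fun r => w (s + r.toNNReal)) t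
      = duhamel μ (fun r => w ((s + r : ℝ)).toNNReal) t :=
    duhamel_congr t.coe_nonneg fun r hr => by
      rw [Real.toNNReal_add s.coe_nonneg hr.1, Real.toNNReal_coe]
  have h3 : duhamel μ (fun r => shift s w r.toNNReal) t
      = duhamel μ (fun r => w (s + r.toNNReal)) t - duhamel μ (fun _ => w s) t :=
    duhamel_sub (by fun_prop) continuous_const _
  have h4 := mul_duhamel_const μ (w s) t
  rw [ou_apply, ou_apply, ou_apply, NNReal.coe_add, h1, h3, h2]
  change _ = _ + (w (s + t) - w s - _)
  linear_combination -h4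

end PathSpace

/-! ### Chaining, and Ornstein–Uhlenbeck blocks on their relaxation scale. -/

/-- Chaining along dyadic subdivisions of intervals of length `h`. -/
theorem norm_sub_le_of_dyadic {E : Type*} [NormedAddCommGroup E] {g : ℝ → E} (hg : Continuous g)
    {h D r : ℝ} (hh : 0 < h) (hD : 0 ≤ D) (hr0 : 0 ≤ r) (hr : r < 1) {J : ℕ}
    (hΔ : ∀ m j : ℕ, j < J * 2 ^ m →
      ‖g ((j + 1) * (h / 2 ^ m)) - g (j * (h / 2 ^ m))‖ ≤ D * r ^ m)
    {i : ℕ} (hi : i < J) {t : ℝ} (ht : t ∈ Set.Icc (i * h) ((i + 1) * h)) :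
    ‖g t - g (i * h)‖ ≤ D / (1 - r) := by
  have hsum : ∀ m : ℕ, ∑ l ∈ Finset.range m, D * r ^ l ≤ D / (1 - r) := fun m => by
    rw [div_eq_mul_inv]
    exact sum_le_hasSum _ (fun l _ => by positivity)
      ((hasSum_geometric_of_lt_one hr0 hr).mul_left D)
  -- Induction on the level: an even grid point belongs to the coarser grid, an odd one is a single
  -- fine step to the right of a coarser point. Each level costs D r^l, independently of k.
  have key : ∀ m k : ℕ, i * 2 ^ m ≤ k → k ≤ (i + 1) * 2 ^ m →
      ‖g (k * (h / 2 ^ m)) - g (i * h)‖ ≤ ∑ l ∈ Finset.range (m + 1), D * r ^ l := by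
    intro m
    induction m with
    | zero =>
      intro k hk1 hk2
      have hk : k = i ∨ k = i + 1 := by omega
      rcases hk with rfl | rfl
      · simpa using hD
      · have := hΔ 0 i (by simpa using hi)
        simpa using this
    | succ m ih =>
      intro k hk1 hk2
      rw [Finset.sum_range_succ]
      have hp : (2 : ℕ) ^ (m + 1) = 2 * 2 ^ m := by ring
      have hstep : ∀ q : ℕ, ((2 * q : ℕ) : ℝ) * (h / 2 ^ (m + 1)) = q * (h / 2 ^ m) := fun q => by
        push_cast
        rw [pow_succ]
        field_simp
      rw [hp] at hk1 hk2
      have hk1' : 2 * (i * 2 ^ m) ≤ k := by linarith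
      have hk2' : k ≤ 2 * ((i + 1) * 2 ^ m) := by linarith
      rcases Nat.even_or_odd' k with ⟨q, rfl | rfl⟩
      · rw [hstep]
        have := ih q (by omega) (by omega)
        have h0 : 0 ≤ D * r ^ (m + 1) := by positivity
        linarith
      · have h1 := ih q (by omega) (by omega)
        have h2 : 2 * q < J * 2 ^ (m + 1) := by
          have h3 : (i + 1) * 2 ^ m ≤ J * 2 ^ m := Nat.mul_le_mul_right _ hi
          rw [hp]
          have h4 : J * (2 * 2 ^ m) = 2 * (J * 2 ^ m) := by ring
          omega
        have h3 := hΔ (m + 1) (2 * q) h2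
        rw [hstep] at h3
        have h4 : (((2 * q + 1 : ℕ) : ℝ)) = ((2 * q : ℕ) : ℝ) + 1 := by push_cast; ring
        rw [h4]
        calc _ = ‖(g ((((2 * q : ℕ) : ℝ) + 1) * (h / 2 ^ (m + 1))) - g (q * (h / 2 ^ m)))
              + (g (q * (h / 2 ^ m)) - g (i * h))‖ := by congr 1; abel
          _ ≤ _ := norm_add_le _ _
          _ ≤ _ := by linarith
  have hlim : Tendsto (fun m : ℕ => (⌊t * 2 ^ m / h⌋₊ : ℝ) * (h / 2 ^ m)) atTop (𝓝 t) := by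
    have h0 : 0 ≤ t := le_trans (by positivity) ht.1
    have h1 : Tendsto (fun m : ℕ => h / 2 ^ m) atTop (𝓝 0) := by
      have := (tendsto_pow_atTop_nhds_zero_of_lt_one (r := (1 / 2 : ℝ)) (by norm_num)
        (by norm_num)).const_mul h
      rw [mul_zero] at this
      refine this.congr fun m => ?_
      rw [one_div, inv_pow, div_eq_mul_inv]
    have h2 : Tendsto (fun m : ℕ => t - h / 2 ^ m) atTop (𝓝 t) := by
      simpa using h1.const_sub t
    refine tendsto_of_tendsto_of_tendsto_of_le_of_le h2 tendsto_const_nhds (fun m => ?_)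
      fun m => ?_
    · have := (Nat.lt_floor_add_one (t * 2 ^ m / h)).le
      rw [div_le_iff₀ hh] at this
      have hpow : (0 : ℝ) < 2 ^ m := by positivity
      simp only
      rw [← mul_div_assoc, sub_le_iff_le_add, ← add_div, le_div_iff₀ hpow]
      linarith
    · have := Nat.floor_le (by positivity : 0 ≤ t * 2 ^ m / h)
      rw [le_div_iff₀ hh] at this
      have hpow : (0 : ℝ) < 2 ^ m := by positivity
      simp only
      rw [← mul_div_assoc, div_le_iff₀ hpow]
      exact this
  have hlim2 := ((hg.tendsto t).comp hlim).sub_const (g (i * h)) |>.norm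
  refine le_of_tendsto' hlim2 fun m => (key m _ ?_ ?_).trans (hsum _)
  · refine Nat.le_floor ?_
    rw [le_div_iff₀ hh]
    push_cast
    have := mul_le_mul_of_nonneg_right ht.1 (by positivity : (0 : ℝ) ≤ 2 ^ m)
    linarith
  · rw [← Nat.cast_le (α := ℝ)]
    refine (Nat.floor_le (by have := le_trans (by positivity) ht.1; positivity)).trans ?_
    rw [div_le_iff₀ hh]
    push_cast
    have := mul_le_mul_of_nonneg_right ht.2 (by positivity : (0 : ℝ) ≤ 2 ^ m)
    linarith

/-- The coordinates of `a` in `F` as a Euclidean vector. -/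
noncomputable def finVec (F : Finset ℕ) (a : ℕ → ℝ) : EuclideanSpace ℝ F :=
  WithLp.toLp 2 fun n => a n

theorem norm_sq_finVec (F : Finset ℕ) (a : ℕ → ℝ) : ‖finVec F a‖ ^ 2 = ∑ n ∈ F, a n ^ 2 := by
  rw [EuclideanSpace.norm_sq_eq]
  simpa [finVec] using Finset.sum_coe_sort F fun n => a n ^ 2

theorem finVec_sub (F : Finset ℕ) (a b : ℕ → ℝ) :
    finVec F (fun n => a n - b n) = finVec F a - finVec F b := rfl

theorem continuous_finVec {X : Type*} [TopologicalSpace X] (F : Finset ℕ) {a : X → ℕ → ℝ}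
    (ha : ∀ n, Continuous fun x => a x n) : Continuous fun x => finVec F (a x) := by
  unfold finVec
  fun_prop

namespace PathSpace

/-- Bound for a block of Ornstein–Uhlenbeck processes over one time step. -/
theorem norm_finVec_ou_le_of_step {F : Finset ℕ} {μ : ℕ → ℝ} {ν h M : ℝ} (hν : 0 < ν) (hh : 0 < h)
    (hM : 0 ≤ M) (hμ0 : ∀ n ∈ F, 0 < μ n) (hμ : ∀ n ∈ F, μ n * h ≤ 2 * ν) {w : ℕ → C(ℝ≥0, ℝ)}
    {r : ℝ≥0} (hr : r ≤ h) (hw : ∀ s ≤ r, ‖finVec F fun n => w n s‖ ≤ M) :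
    ‖finVec F fun n => ou (μ n) (w n) r‖ ≤ (1 + √(2 * ν)) * M := by
  have h1 : (finVec F fun n => ou (μ n) (w n) r) = (finVec F fun n => w n r)
      - finVec F fun n => μ n * duhamel (μ n) (fun s => w n s.toNNReal) r := rfl
  rw [h1, add_mul, one_mul]
  refine (norm_sub_le _ _).trans (add_le_add (hw r le_rfl) ?_)
  refine le_of_sq_le_sq ?_ (by positivity)
  rw [norm_sq_finVec, mul_pow, Real.sq_sqrt (by positivity)]
  have h2 : ∀ n ∈ F, (μ n * duhamel (μ n) (fun s => w n s.toNNReal) r) ^ 2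
      ≤ 2 * ν / h * ∫ s in (0 : ℝ)..r, w n s.toNNReal ^ 2 := by
    intro n hn
    have h3 := mild_sq_le (hμ0 n hn) 0 (f := fun s => w n s.toNNReal) (by fun_prop) r.coe_nonneg
    rw [mul_zero, zero_sub, neg_sq, zero_pow two_ne_zero, zero_add] at h3
    have h4 : 0 ≤ ∫ s in (0 : ℝ)..r, w n s.toNNReal ^ 2 :=
      intervalIntegral.integral_nonneg r.coe_nonneg fun s _ => sq_nonneg _
    have h5 : μ n ≤ 2 * ν / h := (le_div_iff₀ hh).mpr (hμ n hn)
    calc (μ n * duhamel (μ n) (fun s => w n s.toNNReal) r) ^ 2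
        = μ n ^ 2 * duhamel (μ n) (fun s => w n s.toNNReal) r ^ 2 := by ring
      _ ≤ μ n ^ 2 * ((μ n)⁻¹ * ∫ s in (0 : ℝ)..r, w n s.toNNReal ^ 2) := by gcongr
      _ = μ n * ∫ s in (0 : ℝ)..r, w n s.toNNReal ^ 2 := by
          have := (hμ0 n hn).ne'
          field_simp
      _ ≤ _ := by gcongr
  refine (Finset.sum_le_sum h2).trans ?_
  rw [← Finset.mul_sum, ← intervalIntegral.integral_finsetSum fun n _ =>
    Continuous.intervalIntegrable (by fun_prop) _ _]
  have h6 : ∫ s in (0 : ℝ)..r, ∑ n ∈ F, w n s.toNNReal ^ 2 ≤ ∫ _ in (0 : ℝ)..r, M ^ 2 := by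
    refine intervalIntegral.integral_mono_on r.coe_nonneg
      (Continuous.intervalIntegrable (by fun_prop) _ _)
      (Continuous.intervalIntegrable (by fun_prop) _ _) fun s hs => ?_
    rw [← norm_sq_finVec]
    have := hw s.toNNReal (Real.toNNReal_le_iff_le_coe.mpr hs.2)
    gcongr
  rw [intervalIntegral.integral_const, sub_zero, smul_eq_mul] at h6
  calc 2 * ν / h * ∫ s in (0 : ℝ)..r, ∑ n ∈ F, w n s.toNNReal ^ 2
      ≤ 2 * ν / h * (h * M ^ 2) := by
        gcongr
        exact h6.trans (by gcongr)
    _ = 2 * ν * M ^ 2 := by field_simp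

/-- Uniform bound for a block of Ornstein–Uhlenbeck processes by the oscillation of the driving
paths over time steps of the relaxation scale. -/
theorem norm_finVec_ou_le {F : Finset ℕ} {μ : ℕ → ℝ} {ν M : ℝ} {h : ℝ≥0} (hν : 0 < ν) (hh : 0 < h)
    (hM : 0 ≤ M) (hμ0 : ∀ n ∈ F, ν ≤ μ n * h) (hμ : ∀ n ∈ F, μ n * h ≤ 2 * ν)
    {w : ℕ → C(ℝ≥0, ℝ)} (hw0 : ∀ n ∈ F, w n 0 = 0) {J : ℕ}
    (hw : ∀ i < J, ∀ s ≤ h, ‖finVec F fun n => w n (i * h + s) - w n (i * h)‖ ≤ M)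
    {t : ℝ≥0} (ht : t ≤ J * h) (hJ : 0 < J) :
    ‖finVec F fun n => ou (μ n) (w n) t‖
      ≤ (1 + √(2 * ν)) * (1 + (1 - Real.exp (-ν))⁻¹) * M := by
  set C : ℝ := (1 + √(2 * ν)) * M with hC
  have hC0 : 0 ≤ C := by positivity
  set q : ℝ := Real.exp (-ν) with hq
  have hq1 : q < 1 := by
    rw [hq, Real.exp_lt_one_iff]
    linarith
  have hq0 : 0 < q := Real.exp_pos _
  have hh' : (0 : ℝ) < h := by exact_mod_cast hh
  have hμpos : ∀ n ∈ F, 0 < μ n := fun n hn => by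
    have := hν.trans_le (hμ0 n hn)
    exact pos_of_mul_pos_left this h.coe_nonneg
  -- Over one step the block is the damped starting value plus a response of size C to the
  -- increments within the step.
  have hstep : ∀ i < J, ∀ s ≤ h, ‖finVec F fun n => ou (μ n) (w n) (i * h + s)‖
      ≤ ‖finVec F fun n => Real.exp (-μ n * s) * ou (μ n) (w n) (i * h)‖ + C := by
    intro i hi s hs
    have h1 : (finVec F fun n => ou (μ n) (w n) (i * h + s))
        = (finVec F fun n => Real.exp (-μ n * s) * ou (μ n) (w n) (i * h))
          + finVec F fun n => ou (μ n) (shift (i * h) (w n)) s := by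
      simp only [ou_add_time]
      rfl
    rw [h1]
    refine (norm_add_le _ _).trans (add_le_add_right ?_ _)
    exact norm_finVec_ou_le_of_step (h := h) hν hh' hM hμpos hμ (by exact_mod_cast hs)
      fun r hr => hw i hi r (hr.trans hs)
  have hcontr : ∀ (a : ℕ → ℝ) (s : ℝ≥0) (p : ℝ), 0 ≤ p → (∀ n ∈ F, Real.exp (-μ n * s) ≤ p) →
      ‖finVec F fun n => Real.exp (-μ n * s) * a n‖ ≤ p * ‖finVec F a‖ := by
    intro a s p hp hle
    refine le_of_sq_le_sq ?_ (by positivity)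
    rw [mul_pow, norm_sq_finVec, norm_sq_finVec, Finset.mul_sum]
    refine Finset.sum_le_sum fun n hn => ?_
    rw [mul_pow]
    have := hle n hn
    gcongr
  -- A full step damps every mode by at least q = e^{-ν} because μₙh ≥ ν, so the grid values obey a
  -- ↦ qa + C, whose fixed point bounds them for all i.
  have hgrid : ∀ i ≤ J, ‖finVec F fun n => ou (μ n) (w n) (i * h)‖ ≤ C * (1 - q)⁻¹ := by
    intro i
    have hq2 : 0 < 1 - q := by linarith
    induction i with
    | zero =>
      intro _
      have : ‖finVec F fun n => ou (μ n) (w n) ((0 : ℕ) * h)‖ ^ 2 = 0 := by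
        rw [norm_sq_finVec]
        refine Finset.sum_eq_zero fun n hn => ?_
        simp [ou_apply, hw0 n hn, duhamel_zero]
      rw [pow_eq_zero_iff two_ne_zero] at this
      rw [this]
      positivity
    | succ i ih =>
      intro hi
      have h1 := hstep i hi h le_rfl
      have h2 := hcontr (fun n => ou (μ n) (w n) (i * h)) h q hq0.le fun n hn => by
        rw [hq, Real.exp_le_exp]
        have := hμ0 n hn
        linarith
      have h3 := ih (by omega)
      have h4 : ((i + 1 : ℕ) : ℝ≥0) * h = i * h + h := by
        push_cast
        ring
      rw [h4]
      calc _ ≤ q * (C * (1 - q)⁻¹) + C := by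
            refine h1.trans (add_le_add_left (h2.trans ?_) _)
            gcongr
        _ = C * (1 - q)⁻¹ := by
            field_simp
            ring
  -- The endpoint t = Jh is attributed to the last step, since the floor would return the excluded
  -- index J.
  obtain ⟨i, hi, s, hs, rfl⟩ : ∃ i < J, ∃ s ≤ h, t = i * h + s := by
    rcases ht.lt_or_eq with hlt | rfl
    · refine ⟨⌊t / h⌋₊, ?_, t - ⌊t / h⌋₊ * h, ?_, ?_⟩
      · rw [Nat.floor_lt zero_le, div_lt_iff₀ hh]
        exact hlt
      · rw [tsub_le_iff_left]
        have := (Nat.lt_floor_add_one (t / h)).le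
        rw [div_le_iff₀ hh, add_mul, one_mul] at this
        exact this
      · have := Nat.floor_le (a := t / h) zero_le
        rw [le_div_iff₀ hh] at this
        exact (add_tsub_cancel_of_le this).symm
    · refine ⟨J - 1, by omega, h, le_rfl, ?_⟩
      have : (J : ℝ≥0) = ((J - 1 : ℕ) : ℝ≥0) + 1 := by
        exact_mod_cast (Nat.sub_add_cancel hJ).symm
      rw [this]
      simp
      ring
  refine (hstep i hi s hs).trans ?_
  have h2 := hcontr (fun n => ou (μ n) (w n) (i * h)) s 1 zero_le_one fun n hn => by
    rw [Real.exp_le_one_iff]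
    have := (hμpos n hn).le
    have := s.coe_nonneg
    nlinarith
  have h3 := hgrid i hi.le
  calc _ ≤ C * (1 - q)⁻¹ + C := by linarith
    _ = _ := by
        rw [hC]
        ring

end PathSpace

/-! ### Gaussian exponential moments and almost sure bounds for Brownian increments. -/

theorem lintegral_exp_sq_gaussianReal_le {v : ℝ≥0} (hv : v ≠ 0) :
    ∫⁻ x, ENNReal.ofReal (Real.exp (x ^ 2 / (4 * v))) ∂(gaussianReal 0 v) ≤ 2 := by
  have hv0 : (0 : ℝ) < v := by
    have := pos_iff_ne_zero.mpr hv
    exact_mod_cast this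
  rw [gaussianReal_of_var_ne_zero 0 hv,
    lintegral_withDensity_eq_lintegral_mul _ (measurable_gaussianPDF 0 v) (by fun_prop)]
  have h1 : ∀ x, (gaussianPDF 0 v * fun x => ENNReal.ofReal (Real.exp (x ^ 2 / (4 * v)))) x
      = ENNReal.ofReal ((√(2 * Real.pi * v))⁻¹ * Real.exp (-(4 * v : ℝ)⁻¹ * x ^ 2)) := by
    intro x
    rw [Pi.mul_apply, gaussianPDF, ← ENNReal.ofReal_mul (gaussianPDFReal_nonneg 0 v x),
      gaussianPDFReal, mul_assoc, ← Real.exp_add]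
    congr 3
    field_simp
    ring
  simp only [h1]
  have hint : Integrable fun x : ℝ => (√(2 * Real.pi * v))⁻¹ * Real.exp (-(4 * v : ℝ)⁻¹ * x ^ 2) :=
    (integrable_exp_neg_mul_sq (by positivity)).const_mul _
  rw [← ofReal_integral_eq_lintegral_ofReal hint
    (Eventually.of_forall fun x => by positivity), integral_const_mul, integral_gaussian]
  refine ENNReal.ofReal_le_of_le_toReal ?_
  rw [ENNReal.toReal_ofNat]
  -- The exponent x²/(4v) halves the Gaussian one, so the integral equals √2, which is at most 2.
  have h2 : Real.pi / (4 * v : ℝ)⁻¹ = 2 * (2 * Real.pi * v) := by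
    field_simp
    ring
  have hpos : 0 < 2 * Real.pi * v := by positivity
  rw [h2, Real.sqrt_mul zero_le_two, mul_left_comm, inv_mul_cancel₀ (Real.sqrt_pos.mpr hpos).ne',
    mul_one, Real.sqrt_le_left zero_le_two]
  norm_num

section

variable {Ω : Type*} [mΩ : MeasurableSpace Ω] {P : Measure Ω}

/-- A countable family with exponential moments is bounded up to logarithmic corrections. -/
theorem ae_exists_bound_of_exp_moment {ι : Type*} [Countable ι] {A : ι → Ω → ℝ}
    (hA : ∀ i, Measurable (A i)) {c K : ι → ℝ} (hc : ∀ i, 0 < c i) (hK : ∀ i, 0 < K i)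
    (hcs : Summable c)
    (h : ∀ i, ∫⁻ ω, ENNReal.ofReal (Real.exp (A i ω)) ∂P ≤ ENNReal.ofReal (K i)) :
    ∀ᵐ ω ∂P, ∃ X : ℝ, 0 ≤ X ∧ ∀ i, A i ω ≤ X + Real.log (K i) - Real.log (c i) := by
  -- The weights c/K make the expectation of f at most ∑ c. Where f is finite each single term is at
  -- most f, and taking logarithms gives the bound.
  let f : Ω → ℝ≥0∞ := fun ω =>
    ∑' i, ENNReal.ofReal (c i / K i) * ENNReal.ofReal (Real.exp (A i ω))
  have hfm : Measurable f := Measurable.tsum fun i => by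
    have := hA i
    fun_prop
  have hfi : ∫⁻ ω, f ω ∂P ≠ ∞ := by
    rw [lintegral_tsum fun i => by
      have := hA i
      fun_prop]
    refine ne_top_of_le_ne_top (hcs.tsum_ofReal_ne_top) (ENNReal.tsum_le_tsum fun i => ?_)
    rw [lintegral_const_mul _ (by have := hA i; fun_prop)]
    calc ENNReal.ofReal (c i / K i) * ∫⁻ ω, ENNReal.ofReal (Real.exp (A i ω)) ∂P
        ≤ ENNReal.ofReal (c i / K i) * ENNReal.ofReal (K i) := by
          gcongr
          exact h i
      _ = ENNReal.ofReal (c i) := by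
          rw [← ENNReal.ofReal_mul (div_pos (hc i) (hK i)).le, div_mul_cancel₀ _ (hK i).ne']
  filter_upwards [ae_lt_top hfm hfi] with ω hω
  refine ⟨Real.log (1 + (f ω).toReal), Real.log_nonneg (by
    have := ENNReal.toReal_nonneg (a := f ω)
    linarith), fun i => ?_⟩
  have h1 : ENNReal.ofReal (c i / K i) * ENNReal.ofReal (Real.exp (A i ω)) ≤ f ω :=
    ENNReal.le_tsum i
  rw [← ENNReal.ofReal_mul (div_pos (hc i) (hK i)).le, ENNReal.ofReal_le_iff_le_toReal hω.ne] at h1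
  have h2 : c i / K i * Real.exp (A i ω) ≤ 1 + (f ω).toReal := by linarith
  have hcK := div_pos (hc i) (hK i)
  have h3 := Real.log_le_log (mul_pos hcK (Real.exp_pos _)) h2
  rw [Real.log_mul hcK.ne' (Real.exp_pos _).ne', Real.log_exp,
    Real.log_div (hc i).ne' (hK i).ne'] at h3
  linarith

variable {w : ℕ → ℝ≥0 → Ω → ℝ}

/-- By independence the exponential moment factorises over the modes, so its logarithm grows like
the number of modes in the block, with no additional logarithm per mode. -/
theorem lintegral_exp_block_le (hbr : ∀ n, IsPreBrownianReal (w n) P)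
    (hind : iIndepFun (fun (n : ℕ) (ω : Ω) (t : ℝ≥0) => w n t ω) P)
    (hm : ∀ n t, Measurable (w n t)) (F : Finset ℕ) (s : ℝ≥0) {v : ℝ≥0} (hv : v ≠ 0) :
    ∫⁻ ω, ENNReal.ofReal (Real.exp ((∑ n ∈ F, (w n (s + v) ω - w n s ω) ^ 2) / (4 * v))) ∂P
      ≤ ENNReal.ofReal (2 ^ F.card) := by
  have h1 : ∀ ω, ENNReal.ofReal (Real.exp ((∑ n ∈ F, (w n (s + v) ω - w n s ω) ^ 2) / (4 * v)))
      = ∏ n ∈ F, ENNReal.ofReal (Real.exp ((w n (s + v) ω - w n s ω) ^ 2 / (4 * v))) := by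
    intro ω
    rw [Finset.sum_div, Real.exp_sum, ENNReal.ofReal_prod_of_nonneg fun _ _ => (Real.exp_pos _).le]
  simp only [h1]
  have hi : iIndepFun (fun (n : ℕ) (ω : Ω) =>
      ENNReal.ofReal (Real.exp ((w n (s + v) ω - w n s ω) ^ 2 / (4 * v)))) P :=
    hind.comp (fun _ (x : ℝ≥0 → ℝ) =>
      ENNReal.ofReal (Real.exp ((x (s + v) - x s) ^ 2 / (4 * v)))) fun _ => by fun_prop
  rw [lintegral_prod_eq_prod_lintegral_of_indepFun F _ hi fun n => by
    have := hm n (s + v)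
    have := hm n s
    fun_prop]
  have h2 : ∀ n ∈ F, ∫⁻ ω, ENNReal.ofReal (Real.exp ((w n (s + v) ω - w n s ω) ^ 2 / (4 * v))) ∂P
      ≤ 2 := by
    intro n _
    have hl := (hbr n).hasLaw_sub (s + v) s
    have hvar : nndist ((s + v : ℝ≥0) : ℝ) (s : ℝ) = v := by
      rw [← NNReal.coe_inj, coe_nndist, Real.dist_eq]
      simp
    have hvar' : nndist (s + v).1 s.1 = v := hvar
    rw [hvar'] at hl
    have h3 := hl.lintegral_comp (f := fun x => ENNReal.ofReal (Real.exp (x ^ 2 / (4 * v))))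
      (by fun_prop)
    simp only [Pi.sub_apply] at h3
    rw [h3]
    exact lintegral_exp_sq_gaussianReal_le hv
  refine (Finset.prod_le_prod' h2).trans_eq ?_
  rw [Finset.prod_const, ENNReal.ofReal_pow zero_le_two, ENNReal.ofReal_ofNat]

/-- Almost sure bound for the dyadic increments of all blocks of Brownian motions. -/
theorem ae_block_increments_bound (hbr : ∀ n, IsPreBrownianReal (w n) P)
    (hind : iIndepFun (fun (n : ℕ) (ω : Ω) (t : ℝ≥0) => w n t ω) P)
    (hm : ∀ n t, Measurable (w n t)) (F : ℕ → Finset ℕ) {h : ℕ → ℝ≥0} (hh : ∀ k, h k ≠ 0) :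
    ∀ᵐ ω ∂P, ∃ X : ℝ, 0 ≤ X ∧ ∀ k m j : ℕ,
      (∑ n ∈ F k, (w n (j * (h k / 2 ^ m) + h k / 2 ^ m) ω - w n (j * (h k / 2 ^ m)) ω) ^ 2)
        / (4 * (h k / 2 ^ m)) ≤ X + (F k).card + k + m + 2 * Real.log (j + 1) := by
  have h1 := ae_exists_bound_of_exp_moment (P := P) (ι := ℕ × ℕ × ℕ)
    (A := fun i ω => (∑ n ∈ F i.1, (w n (i.2.2 * (h i.1 / 2 ^ i.2.1) + h i.1 / 2 ^ i.2.1) ω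
      - w n (i.2.2 * (h i.1 / 2 ^ i.2.1)) ω) ^ 2) / (4 * (h i.1 / 2 ^ i.2.1 : ℝ≥0)))
    (fun i => by fun_prop)
    -- Summable weights over block, level and position; their logarithms produce the corrections k,
    -- m and 2 log(j+1), and log K the cardinality.
    (c := fun i => (1 / 2) ^ i.1 * ((1 / 2) ^ i.2.1 * (1 / ((i.2.2 : ℝ) + 1) ^ 2)))
    (K := fun i => 2 ^ (F i.1).card) (fun i => by positivity) (fun i => by positivity) ?_
    (fun i => lintegral_exp_block_le hbr hind hm _ _ (div_ne_zero (hh _) (by positivity)))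
  · filter_upwards [h1] with ω hω
    obtain ⟨X, hX, hb⟩ := hω
    refine ⟨X, hX, fun k m j => ?_⟩
    have h2 := hb (k, m, j)
    simp only at h2
    push_cast at h2
    refine h2.trans ?_
    have hj : (0 : ℝ) < (j : ℝ) + 1 := by positivity
    rw [Real.log_pow, Real.log_mul (by positivity) (by positivity),
      Real.log_mul (by positivity) (by positivity), Real.log_pow, Real.log_pow, one_div, one_div,
      Real.log_inv, Real.log_inv, Real.log_pow]
    have hl : Real.log 2 ≤ 1 := by
      have := Real.log_two_lt_d9
      linarith
    have e1 : ((F k).card : ℝ) * Real.log 2 ≤ (F k).card * 1 := by gcongr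
    have e2 : (k : ℝ) * Real.log 2 ≤ k * 1 := by gcongr
    have e3 : (m : ℝ) * Real.log 2 ≤ m * 1 := by gcongr
    push_cast
    linarith
  · have hg : Summable fun k : ℕ => (1 / 2 : ℝ) ^ k := summable_geometric_two
    have hj : Summable fun j : ℕ => 1 / ((j : ℝ) + 1) ^ 2 := by
      have := (summable_nat_add_iff 1).mpr (Real.summable_one_div_nat_pow.mpr one_lt_two)
      simpa using this
    exact hg.mul_of_nonneg (hg.mul_of_nonneg hj (fun _ => by positivity) fun _ => by positivity)
      (fun _ => by positivity) fun _ => by positivity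

end

/-! ### From increment bounds to the oscillation of a block. -/

namespace PathSpace

/-- Oscillation of a block of paths over steps of length `h`. -/
theorem norm_finVec_increment_le {F : Finset ℕ} {h : ℝ≥0} (hh : 0 < h) {p : ℕ → C(ℝ≥0, ℝ)}
    {X : ℝ} (hX : 0 ≤ X)
    (hp : ∀ m j : ℕ,
      (∑ n ∈ F, (p n (j * (h / 2 ^ m) + h / 2 ^ m) - p n (j * (h / 2 ^ m))) ^ 2)
        / (4 * (h / 2 ^ m)) ≤ X + m + 2 * Real.log (j + 1))
    {J : ℕ} (hJ : 0 < J) {i : ℕ} (hi : i < J) {s : ℝ≥0} (hs : s ≤ h) :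
    ‖finVec F fun n => p n (i * h + s) - p n (i * h)‖
      ≤ 40 * √(h * (X + 2 * Real.log J + 1)) := by
  have hh' : (0 : ℝ) < h := by exact_mod_cast hh
  have hJ1 : (1 : ℝ) ≤ J := by exact_mod_cast hJ
  have hlogJ : 0 ≤ Real.log J := Real.log_nonneg hJ1
  set L : ℝ := X + 2 * Real.log J + 1 with hL
  have hL1 : 1 ≤ L := by linarith
  have hl2 : Real.log 2 ≤ 1 := by
    have := Real.log_two_lt_d9
    linarith
  -- Linear growth in the level is traded for a geometric factor. The ratio 49/32 is chosen so that,
  -- divided by the factor 2 lost in the step length, it equals (7/8)²; then 5/(1 - 7/8) = 40 is the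
  -- final constant.
  have hpow : ∀ m : ℕ, (1 + 3 * m : ℝ) ≤ 6 * (49 / 32) ^ m := by
    intro m
    have := one_add_mul_le_pow (a := (17 / 32 : ℝ)) (by norm_num) m
    norm_num at this
    linarith
  let g : ℝ → EuclideanSpace ℝ F := fun t => finVec F fun n => p n t.toNNReal
  have hg : Continuous g := continuous_finVec F fun n => by fun_prop
  have hΔ : ∀ m j : ℕ, j < J * 2 ^ m →
      ‖g ((j + 1) * (h / 2 ^ m)) - g (j * (h / 2 ^ m))‖ ≤ 5 * √(h * L) * (7 / 8) ^ m := by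
    intro m j hj
    have e1 : ((j : ℝ) * (h / 2 ^ m)).toNNReal = j * (h / 2 ^ m) := by
      rw [← NNReal.coe_inj, Real.coe_toNNReal _ (by positivity)]
      push_cast
      rfl
    have e2 : (((j : ℝ) + 1) * (h / 2 ^ m)).toNNReal = j * (h / 2 ^ m) + h / 2 ^ m := by
      rw [← NNReal.coe_inj, Real.coe_toNNReal _ (by positivity)]
      push_cast
      ring
    have e3 : g ((j + 1) * (h / 2 ^ m)) - g (j * (h / 2 ^ m))
        = finVec F fun n => p n (j * (h / 2 ^ m) + h / 2 ^ m) - p n (j * (h / 2 ^ m)) := by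
      simp only [g, e1, e2, finVec_sub]
    rw [e3]
    refine le_of_sq_le_sq ?_ (by positivity)
    rw [norm_sq_finVec]
    have h1 := hp m j
    rw [div_le_iff₀ (by positivity)] at h1
    have h2 : Real.log (j + 1) ≤ Real.log J + m := by
      have h3 : ((j : ℝ) + 1) ≤ J * 2 ^ m := by exact_mod_cast hj
      have h4 := Real.log_le_log (by positivity) h3
      rw [Real.log_mul (by positivity) (by positivity), Real.log_pow] at h4
      have : (m : ℝ) * Real.log 2 ≤ m * 1 := by gcongr
      linarith
    have h5 : X + m + 2 * Real.log (j + 1) ≤ L * (6 * (49 / 32) ^ m) := by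
      have h6 : (m : ℝ) * 1 ≤ m * L := by gcongr
      calc X + m + 2 * Real.log (j + 1) ≤ L * (1 + 3 * m) := by linarith
        _ ≤ _ := by gcongr; exact hpow m
    calc _ ≤ (X + m + 2 * Real.log (j + 1)) * (4 * (h / 2 ^ m)) := h1
      _ ≤ L * (6 * (49 / 32) ^ m) * (4 * (h / 2 ^ m)) := by gcongr
      _ = 24 * (h * L) * (49 / 64) ^ m := by
          have : (49 / 64 : ℝ) ^ m = (49 / 32) ^ m / 2 ^ m := by
            rw [← div_pow]
            norm_num
          rw [this]
          ring
      _ ≤ 25 * (h * L) * (49 / 64) ^ m := by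
          gcongr
          norm_num
      _ = (5 * √(h * L) * (7 / 8) ^ m) ^ 2 := by
          rw [mul_pow, mul_pow, Real.sq_sqrt (by positivity), ← pow_mul, mul_comm m 2, pow_mul]
          norm_num
  have hs0 := s.coe_nonneg
  have hs1 : (s : ℝ) ≤ h := by exact_mod_cast hs
  have h6 := norm_sub_le_of_dyadic hg hh' (by positivity) (by norm_num) (by norm_num) hΔ hi
    (t := i * h + s) ⟨by linarith, by linarith⟩
  have e4 : ((i : ℝ) * h + s).toNNReal = i * h + s := by
    rw [← NNReal.coe_inj, Real.coe_toNNReal _ (by positivity)]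
    push_cast
    rfl
  have e5 : ((i : ℝ) * h).toNNReal = i * h := by
    rw [← NNReal.coe_inj, Real.coe_toNNReal _ (by positivity)]
    push_cast
    rfl
  simp only [g, e4, e5] at h6
  rw [finVec_sub]
  refine h6.trans_eq ?_
  ring

end PathSpace

/-! ### Dyadic spectral blocks and pathwise convergence of the stochastic convolution. -/

namespace PositiveOperator

open Scale PathSpace

variable {H : Type*} [NormedAddCommGroup H] [InnerProductSpace ℝ H] [CompleteSpace H]
  {S : PositiveOperator H} {α β ν : ℝ}

theorem norm_sq_sub_ofFinset_le (v : S.Scale α) {N : ℕ} {ε : ℝ}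
    (h : ∀ M, ∑ n ∈ Finset.Ico N M, S.lam n ^ α * coeff v n ^ 2 ≤ ε) {N' : ℕ} (hN : N ≤ N') :
    ‖v - ofFinset (Finset.range N') (coeff v)‖ ^ 2 ≤ ε := by
  refine norm_sq_le_of_sum_le _ fun M => ?_
  refine le_trans ?_ (h M)
  have h1 : ∀ n ∈ Finset.range M, S.lam n ^ α
      * coeff (v - ofFinset (Finset.range N') (coeff v)) n ^ 2
      ≤ if N ≤ n then S.lam n ^ α * coeff v n ^ 2 else 0 := by
    intro n _
    rw [map_sub, Pi.sub_apply, coeff_ofFinset]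
    by_cases hn : n ∈ Finset.range N'
    · rw [if_pos hn, sub_self, zero_pow two_ne_zero, mul_zero]
      split_ifs
      · exact lam_rpow_mul_sq_nonneg S α n _
      · exact le_rfl
    · rw [if_neg hn, sub_zero, if_pos]
      rw [Finset.mem_range] at hn
      omega
  refine (Finset.sum_le_sum h1).trans_eq ?_
  rw [← Finset.sum_filter]
  congr 1
  ext n
  simp only [Finset.mem_filter, Finset.mem_range, Finset.mem_Ico]
  omega

/-- The convergence of the partial sums in `exists_continuous`. -/
theorem exists_tendsto_ofFinset {a : ℝ≥0 → ℕ → ℝ} (ha : ∀ n, Continuous fun t => a t n)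
    (htail : ∀ T : ℕ, ∀ ε > 0, ∃ N, ∀ t ≤ (T : ℝ≥0), ∀ M,
      ∑ n ∈ Finset.Ico N M, S.lam n ^ α * a t n ^ 2 ≤ ε) :
    ∃ l : C(ℝ≥0, S.Scale α), Tendsto (fun N => (⟨fun t => ofFinset (Finset.range N) (a t),
      continuous_ofFinset _ ha⟩ : C(ℝ≥0, S.Scale α))) atTop (𝓝 l) := by
  have htail' : ∀ t₀ : ℝ≥0, ∃ U ∈ 𝓝 t₀, ∀ ε > 0, ∃ N, ∀ t ∈ U, ∀ M,
      ∑ n ∈ Finset.Ico N M, S.lam n ^ α * a t n ^ 2 ≤ ε := by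
    intro t₀
    obtain ⟨T, hT⟩ := exists_nat_gt t₀
    refine ⟨Set.Iio T, Iio_mem_nhds hT, fun ε hε => ?_⟩
    obtain ⟨N, hN⟩ := htail T ε hε
    exact ⟨N, fun t ht => hN t (le_of_lt ht)⟩
  obtain ⟨v, hv, hva⟩ := exists_continuous ha htail'
  refine ⟨⟨v, hv⟩, ContinuousMap.tendsto_of_tendstoLocallyUniformly ?_⟩
  rw [Metric.tendstoLocallyUniformly_iff]
  intro ε hε t₀
  obtain ⟨U, hU, h⟩ := htail' t₀
  obtain ⟨N, hN⟩ := h ((ε / 2) ^ 2) (by positivity)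
  refine ⟨U, hU, ?_⟩
  filter_upwards [eventually_ge_atTop N] with N' hN' t ht
  have h1 := norm_sq_sub_ofFinset_le (v t) (ε := (ε / 2) ^ 2) (by rw [hva]; exact hN t ht) hN'
  rw [hva] at h1
  have h2 := abs_le_of_sq_le_sq h1 (by positivity)
  rw [abs_norm] at h2
  rw [dist_eq_norm]
  exact h2.trans_lt (by linarith)

/-- The dyadic block of the eigenvalue `λₙ`. -/
noncomputable def blockIndex (S : PositiveOperator H) (n : ℕ) : ℕ :=
  Nat.log 2 ⌊S.lam n / S.lam 0⌋₊

theorem one_le_lam_div (S : PositiveOperator H) (n : ℕ) : 1 ≤ S.lam n / S.lam 0 :=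
  (one_le_div (S.lam_pos 0)).mpr (S.lam_mono (Nat.zero_le n))

theorem blockIndex_lower (S : PositiveOperator H) (n : ℕ) :
    S.lam 0 * 2 ^ S.blockIndex n ≤ S.lam n := by
  have h0 : ⌊S.lam n / S.lam 0⌋₊ ≠ 0 :=
    (Nat.floor_pos.mpr (S.one_le_lam_div n)).ne'
  have h1 := Nat.pow_log_le_self 2 h0
  have h2 : (2 : ℝ) ^ S.blockIndex n ≤ S.lam n / S.lam 0 :=
    le_trans (by exact_mod_cast h1) (Nat.floor_le (zero_le_one.trans (S.one_le_lam_div n)))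
  rw [le_div_iff₀ (S.lam_pos 0)] at h2
  linarith

theorem blockIndex_upper (S : PositiveOperator H) (n : ℕ) :
    S.lam n ≤ 2 * (S.lam 0 * 2 ^ S.blockIndex n) := by
  have h1 := Nat.lt_pow_succ_log_self (b := 2) one_lt_two ⌊S.lam n / S.lam 0⌋₊
  have h2 : S.lam n / S.lam 0 < 2 ^ (S.blockIndex n + 1) := by
    refine (Nat.lt_floor_add_one _).trans_le ?_
    exact_mod_cast h1
  rw [div_lt_iff₀ (S.lam_pos 0), pow_succ] at h2
  linarith

theorem le_blockIndex {n k : ℕ} (h : S.lam 0 * 2 ^ k ≤ S.lam n) : k ≤ S.blockIndex n := by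
  refine Nat.le_log_of_pow_le one_lt_two (Nat.le_floor ?_)
  rw [le_div_iff₀ (S.lam_pos 0)]
  push_cast
  linarith

theorem tendsto_blockIndex (S : PositiveOperator H) : Tendsto S.blockIndex atTop atTop := by
  rw [tendsto_atTop]
  intro k
  filter_upwards [S.lam_tendsto.eventually_ge_atTop (S.lam 0 * 2 ^ k)] with n hn
  exact le_blockIndex hn

theorem finite_blockIndex (S : PositiveOperator H) (k : ℕ) : {n | S.blockIndex n = k}.Finite := by
  obtain ⟨N, hN⟩ := eventually_atTop.mp (S.tendsto_blockIndex.eventually_gt_atTop k)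
  refine (Set.finite_Iio N).subset fun n hn => ?_
  by_contra h
  have := hN n (not_lt.mp h)
  rw [Set.mem_ofPred_eq] at hn
  omega

/-- The indices of the eigenvalues in `[2ᵏ λ₀, 2ᵏ⁺¹ λ₀)`. -/
noncomputable def block (S : PositiveOperator H) (k : ℕ) : Finset ℕ := (S.finite_blockIndex k).toFinset

theorem mem_block {n k : ℕ} : n ∈ S.block k ↔ S.blockIndex n = k := by simp [block]

/-- The relaxation time of the `k`-th block. -/
noncomputable def step (S : PositiveOperator H) (k : ℕ) : ℝ≥0 := ((S.lam 0 * 2 ^ k)⁻¹).toNNReal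

theorem coe_step (S : PositiveOperator H) (k : ℕ) : (S.step k : ℝ) = (S.lam 0 * 2 ^ k)⁻¹ :=
  Real.coe_toNNReal _ (by have := S.lam_pos 0; positivity)

theorem step_pos (S : PositiveOperator H) (k : ℕ) : 0 < S.step k := by
  have : (0 : ℝ) < S.step k := by
    rw [coe_step]
    have := S.lam_pos 0
    positivity
  exact_mod_cast this

/-- The coordinates of the stochastic convolution driven by the paths `p`. -/
noncomputable def noiseCoeff (S : PositiveOperator H) (ν β : ℝ) (p : ℕ → C(ℝ≥0, ℝ)) (t : ℝ≥0)
    (n : ℕ) : ℝ :=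
  √(2 * S.lam n ^ (1 - β)) * ou (ν * S.lam n) (p n) t

theorem continuous_noiseCoeff (p : ℕ → C(ℝ≥0, ℝ)) (n : ℕ) :
    Continuous fun t => S.noiseCoeff ν β p t n := by
  unfold noiseCoeff
  fun_prop

/-- The weights λ^α λ^{1-β} are of order Λ Λ^{α-β} on the block, and the squared oscillation over a
relaxation time carries the step length Λ⁻¹. The two powers of Λ cancel and leave Λ^{α-β} times the
cardinality plus terms linear in k. -/
theorem sum_noiseCoeff_le (hν : 0 < ν) (hC3 : S.CondC3 α β) {p : ℕ → C(ℝ≥0, ℝ)}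
    (hp0 : ∀ n, p n 0 = 0) {X : ℝ} (hX : 0 ≤ X) {k : ℕ}
    (hp : ∀ m j : ℕ, (∑ n ∈ S.block k, (p n (j * (S.step k / 2 ^ m) + S.step k / 2 ^ m)
      - p n (j * (S.step k / 2 ^ m))) ^ 2) / (4 * (S.step k / 2 ^ m))
        ≤ X + (S.block k).card + k + m + 2 * Real.log (j + 1)) {T t : ℝ≥0} (ht : t ≤ T) :
    ∑ n ∈ S.block k, S.lam n ^ α * S.noiseCoeff ν β p t n ^ 2
      ≤ 6400 * ((1 + √(2 * ν)) * (1 + (1 - Real.exp (-ν))⁻¹)) ^ 2 * ((S.lam 0 * 2 ^ k) ^ (α - β)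
        * (X + (S.block k).card + k + 2 * (T * S.lam 0 + 1 + k) + 1)) := by
  have hl0 := S.lam_pos 0
  set Λ : ℝ := S.lam 0 * 2 ^ k with hΛ
  have hΛ0 : 0 < Λ := by positivity
  have hstep : (S.step k : ℝ) = Λ⁻¹ := S.coe_step k
  have hlow : ∀ n ∈ S.block k, Λ ≤ S.lam n := fun n hn => by
    have := S.blockIndex_lower n
    rwa [mem_block.mp hn] at this
  have hup : ∀ n ∈ S.block k, S.lam n ≤ 2 * Λ := fun n hn => by
    have := S.blockIndex_upper n
    rwa [mem_block.mp hn] at this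
  -- The number of relaxation times covering [0,T]. It grows like 2^k, so log J is only linear in k;
  -- the added 1 ensures J > 0.
  set J : ℕ := ⌈T * Λ⌉₊ + 1 with hJ
  have hJ0 : 0 < J := Nat.succ_pos _
  have htJ : t ≤ J * S.step k := by
    have h1 : (T : ℝ) ≤ J * S.step k := by
      rw [hstep, ← div_eq_mul_inv, le_div_iff₀ hΛ0, hJ]
      push_cast
      have := Nat.le_ceil ((T : ℝ) * Λ)
      linarith
    exact ht.trans (by exact_mod_cast h1)
  have hlogJ : Real.log J ≤ T * S.lam 0 + 1 + k := by
    have h2k : (1 : ℝ) ≤ 2 ^ k := one_le_pow₀ one_le_two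
    have h1 : (J : ℝ) ≤ (T * S.lam 0 + 2) * 2 ^ k := by
      rw [hJ]
      push_cast
      have h2 := (Nat.ceil_lt_add_one (a := (T : ℝ) * Λ) (by positivity)).le
      have h3 : (T : ℝ) * Λ = T * S.lam 0 * 2 ^ k := by
        rw [hΛ]
        ring
      rw [h3] at h2 ⊢
      linarith
    have h4 := Real.log_le_log (by exact_mod_cast hJ0) h1
    rw [Real.log_mul (by positivity) (by positivity), Real.log_pow] at h4
    have h5 := Real.log_le_sub_one_of_pos (x := T * S.lam 0 + 2) (by positivity)
    have h6 : (k : ℝ) * Real.log 2 ≤ k * 1 := by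
      have := Real.log_two_lt_d9
      gcongr
      linarith
    linarith
  have hosc : ∀ i < J, ∀ s ≤ S.step k,
      ‖finVec (S.block k) fun n => p n (i * S.step k + s) - p n (i * S.step k)‖
        ≤ 40 * √(S.step k * ((X + (S.block k).card + k) + 2 * Real.log J + 1)) :=
    fun i hi s hs => norm_finVec_increment_le (S.step_pos k) (by positivity) hp hJ0 hi hs
  have hou := norm_finVec_ou_le (μ := fun n => ν * S.lam n) hν (S.step_pos k) (by positivity)
    (fun n hn => by
      rw [hstep, ← div_eq_mul_inv, le_div_iff₀ hΛ0]
      have := hlow n hn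
      gcongr)
    (fun n hn => by
      rw [hstep, ← div_eq_mul_inv, div_le_iff₀ hΛ0]
      have := mul_le_mul_of_nonneg_left (hup n hn) hν.le
      linarith) (fun n _ => hp0 n) hosc htJ hJ0
  set D : ℝ := (1 + √(2 * ν)) * (1 + (1 - Real.exp (-ν))⁻¹)
  have hlogJ0 : 0 ≤ Real.log J := Real.log_nonneg (by exact_mod_cast hJ0)
  have hsq : ∑ n ∈ S.block k, ou (ν * S.lam n) (p n) t ^ 2
      ≤ D ^ 2 * (1600 * (Λ⁻¹ * ((X + (S.block k).card + k) + 2 * Real.log J + 1))) := by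
    rw [← norm_sq_finVec (S.block k) fun n => ou (ν * S.lam n) (p n) t]
    refine (pow_le_pow_left₀ (norm_nonneg _) hou 2).trans_eq ?_
    rw [mul_pow D, mul_pow 40, Real.sq_sqrt (by positivity), hstep]
    norm_num
  have hw : ∀ n ∈ S.block k, S.lam n ^ α * S.noiseCoeff ν β p t n ^ 2
      ≤ 4 * Λ * Λ ^ (α - β) * ou (ν * S.lam n) (p n) t ^ 2 := by
    intro n hn
    have hn0 := S.lam_pos n
    rw [noiseCoeff, mul_pow, Real.sq_sqrt (by positivity)]
    have h1 : S.lam n ^ α * (2 * S.lam n ^ (1 - β) * ou (ν * S.lam n) (p n) t ^ 2)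
        = 2 * (S.lam n * S.lam n ^ (α - β)) * ou (ν * S.lam n) (p n) t ^ 2 := by
      have h2 : S.lam n * S.lam n ^ (α - β) = S.lam n ^ α * S.lam n ^ (1 - β) := by
        rw [← Real.rpow_add hn0, mul_comm, ← Real.rpow_add_one hn0.ne']
        congr 1
        ring
      rw [h2]
      ring
    rw [h1]
    have h3 : S.lam n ^ (α - β) ≤ Λ ^ (α - β) :=
      Real.rpow_le_rpow_of_nonpos hΛ0 (hlow n hn) (by have := hC3.lt; linarith)
    have h4 := hup n hn
    have h5 : S.lam n * S.lam n ^ (α - β) ≤ 2 * Λ * Λ ^ (α - β) := by gcongr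
    have h6 := mul_le_mul_of_nonneg_right h5 (sq_nonneg (ou (ν * S.lam n) (p n) t))
    linarith
  refine (Finset.sum_le_sum hw).trans ?_
  rw [← Finset.mul_sum]
  calc 4 * Λ * Λ ^ (α - β) * ∑ n ∈ S.block k, ou (ν * S.lam n) (p n) t ^ 2
      ≤ 4 * Λ * Λ ^ (α - β)
        * (D ^ 2 * (1600 * (Λ⁻¹ * ((X + (S.block k).card + k) + 2 * Real.log J + 1)))) := by
        gcongr
    _ = 6400 * D ^ 2 * (Λ ^ (α - β) * ((X + (S.block k).card + k) + 2 * Real.log J + 1)) := by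
        field_simp
        ring
    _ ≤ _ := by gcongr

/-- Within a block every λₙ^{α-β} is comparable to Λ^{α-β}, so the series is dominated by the
Hilbert–Schmidt sum. -/
theorem summable_card_block (hC3 : S.CondC3 α β) :
    Summable fun k => (S.lam 0 * 2 ^ k) ^ (α - β) * (S.block k).card := by
  have hl0 := S.lam_pos 0
  refine summable_of_sum_range_le (c := 2 ^ (β - α) * ∑' n, S.lam n ^ (α - β))
    (fun k => by positivity) fun K => ?_
  have h1 : ∀ k, (S.lam 0 * 2 ^ k) ^ (α - β) * (S.block k).card
      ≤ 2 ^ (β - α) * ∑ n ∈ S.block k, S.lam n ^ (α - β) := by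
    intro k
    rw [Finset.mul_sum, mul_comm, ← nsmul_eq_mul]
    refine Finset.card_nsmul_le_sum _ _ _ fun n hn => ?_
    have h2 := S.blockIndex_upper n
    rw [mem_block.mp hn] at h2
    have h3 := Real.rpow_le_rpow_of_nonpos (z := α - β) (S.lam_pos n) h2
      (by have := hC3.lt; linarith)
    rw [Real.mul_rpow zero_le_two (by positivity)] at h3
    have h4 : (2 : ℝ) ^ (β - α) * 2 ^ (α - β) = 1 := by
      rw [← Real.rpow_add zero_lt_two]
      simp
    calc (S.lam 0 * 2 ^ k) ^ (α - β)
        = 2 ^ (β - α) * (2 ^ (α - β) * (S.lam 0 * 2 ^ k) ^ (α - β)) := by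
          rw [← mul_assoc, h4, one_mul]
      _ ≤ _ := by gcongr
  refine (Finset.sum_le_sum fun k _ => h1 k).trans ?_
  rw [← Finset.mul_sum]
  gcongr
  rw [← Finset.sum_biUnion]
  · exact hC3.summable.sum_le_tsum _ fun n _ => Real.rpow_nonneg (S.lam_pos n).le _
  · intro k _ l _ hkl
    simp only [Function.onFun]
    rw [Finset.disjoint_left]
    intro n hn hn'
    exact hkl ((mem_block.mp hn).symm.trans (mem_block.mp hn'))

/-- The cardinalities are summed by the Hilbert–Schmidt condition, the terms affine in k by the
geometric decay 2^{k(α-β)}, which is where α < β enters. -/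
theorem summable_blockBound (hC3 : S.CondC3 α β) (D X T : ℝ) :
    Summable fun k : ℕ => D * ((S.lam 0 * 2 ^ k) ^ (α - β)
        * (X + (S.block k).card + k + 2 * (T * S.lam 0 + 1 + k) + 1)) := by
  have hl0 := S.lam_pos 0
  have hr : ‖(2 : ℝ) ^ (α - β)‖ < 1 := by
    rw [Real.norm_of_nonneg (by positivity)]
    exact Real.rpow_lt_one_of_one_lt_of_neg one_lt_two (by have := hC3.lt; linarith)
  have e : ∀ k : ℕ, (S.lam 0 * 2 ^ k) ^ (α - β) = S.lam 0 ^ (α - β) * ((2 : ℝ) ^ (α - β)) ^ k := by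
    intro k
    rw [Real.mul_rpow hl0.le (by positivity), ← Real.rpow_natCast, ← Real.rpow_mul zero_le_two,
      mul_comm (k : ℝ), Real.rpow_mul_natCast zero_le_two]
  have h0 : Summable fun k : ℕ => (S.lam 0 * 2 ^ k) ^ (α - β) := by
    simp only [e]
    exact (summable_geometric_of_norm_lt_one hr).mul_left _
  have h1 : Summable fun k : ℕ => (S.lam 0 * 2 ^ k) ^ (α - β) * k := by
    have := (summable_pow_mul_geometric_of_norm_lt_one 1 hr).mul_left (S.lam 0 ^ (α - β))
    refine this.congr fun k => ?_
    rw [e]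
    ring
  have h2 := summable_card_block hC3
  refine ((((h0.mul_right (X + 2 * (T * S.lam 0 + 1) + 1)).add h2).add
    (h1.mul_left 3)).mul_left D).congr fun k => ?_
  ring

/-- Pathwise convergence of the stochastic convolution. -/
theorem exists_tendsto_noise (hν : 0 < ν) (hC3 : S.CondC3 α β) {p : ℕ → C(ℝ≥0, ℝ)}
    (hp0 : ∀ n, p n 0 = 0) {X : ℝ} (hX : 0 ≤ X)
    (hp : ∀ k m j : ℕ, (∑ n ∈ S.block k, (p n (j * (S.step k / 2 ^ m) + S.step k / 2 ^ m)
      - p n (j * (S.step k / 2 ^ m))) ^ 2) / (4 * (S.step k / 2 ^ m))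
        ≤ X + (S.block k).card + k + m + 2 * Real.log (j + 1)) :
    ∃ l : C(ℝ≥0, S.Scale α), Tendsto (fun N => (⟨fun t =>
      ofFinset (Finset.range N) (S.noiseCoeff ν β p t),
      continuous_ofFinset _ (continuous_noiseCoeff p)⟩ : C(ℝ≥0, S.Scale α))) atTop (𝓝 l) := by
  refine exists_tendsto_ofFinset (continuous_noiseCoeff p) fun T ε hε => ?_
  set b : ℕ → ℝ := fun k => 6400 * ((1 + √(2 * ν)) * (1 + (1 - Real.exp (-ν))⁻¹)) ^ 2
    * ((S.lam 0 * 2 ^ k) ^ (α - β)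
      * (X + (S.block k).card + k + 2 * ((T : ℝ) * S.lam 0 + 1 + k) + 1)) with hb
  have hbs : Summable b := summable_blockBound hC3 _ X T
  have hb0 : ∀ k, 0 ≤ b k := fun k => by
    have := S.lam_pos 0
    simp only [hb]
    positivity
  obtain ⟨K, hK⟩ := (hbs.hasSum.tendsto_sum_nat.eventually
    (lt_mem_nhds (sub_lt_self (∑' k, b k) hε))).exists
  obtain ⟨N, hN⟩ := eventually_atTop.mp (S.tendsto_blockIndex.eventually_ge_atTop K)
  refine ⟨N, fun t ht M => ?_⟩
  set K' : ℕ := (Finset.Ico N M).sup S.blockIndex + 1 with hK'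
  have hmaps : ∀ n ∈ Finset.Ico N M, S.blockIndex n ∈ Finset.Ico K K' := fun n hn => by
    rw [Finset.mem_Ico]
    exact ⟨hN n (Finset.mem_Ico.mp hn).1, Nat.lt_succ_of_le (Finset.le_sup hn)⟩
  -- The tail is regrouped by blocks of index at least K; partially filled blocks are completed, all
  -- terms being nonnegative.
  rw [← Finset.sum_fiberwise_of_maps_to hmaps]
  have h1 : ∀ k ∈ Finset.Ico K K', ∑ n ∈ Finset.Ico N M with S.blockIndex n = k,
      S.lam n ^ α * S.noiseCoeff ν β p t n ^ 2 ≤ b k := by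
    intro k _
    refine le_trans (Finset.sum_le_sum_of_subset_of_nonneg (t := S.block k) (fun n hn => ?_)
      fun n _ _ => lam_rpow_mul_sq_nonneg S α n _) ?_
    · exact mem_block.mpr (Finset.mem_filter.mp hn).2
    · have := sum_noiseCoeff_le hν hC3 hp0 hX (hp k) ht
      simpa only [hb, NNReal.coe_natCast] using this
  refine (Finset.sum_le_sum h1).trans ?_
  have h2 : ∑ k ∈ Finset.range K, b k + ∑ k ∈ Finset.Ico K K', b k ≤ ∑' k, b k := by
    rw [← Finset.sum_union]
    · exact hbs.sum_le_tsum _ fun k _ => hb0 k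
    · rw [Finset.disjoint_left]
      intro n hn hn'
      simp only [Finset.mem_range, Finset.mem_Ico] at hn hn'
      omega
  linarith

end PositiveOperator

/-! ### Integrated versus mild equation, restarting, and non-anticipation. -/

theorem volterra_iff {μ T : ℝ} {a g : ℝ → ℝ} (ha : Continuous a) (hg : Continuous g) :
    (∀ t ∈ Set.Icc 0 T, a t + μ * ∫ s in (0 : ℝ)..t, a s = g t) ↔
      ∀ t ∈ Set.Icc 0 T, a t = g t - μ * duhamel μ g t := by
  refine ⟨fun h t ht => volterra_unique ha hg h ht, fun h t ht => ?_⟩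
  rw [h t ht]
  refine Eq.trans ?_ (volterra_solution μ hg t)
  congr 2
  refine intervalIntegral.integral_congr fun s hs => ?_
  rw [Set.uIcc_of_le ht.1] at hs
  exact h s ⟨hs.1, hs.2.trans ht.2⟩

/-- Integrating its differential equation shows that the convolution of f solves the Volterra
equation with right side ∫ f; the identity is then uniqueness for that equation. -/
theorem integral_sub_mul_duhamel_integral (μ : ℝ) {f : ℝ → ℝ} (hf : Continuous f) {t : ℝ}
    (ht : 0 ≤ t) :
    (∫ s in (0 : ℝ)..t, f s) - μ * duhamel μ (fun r => ∫ s in (0 : ℝ)..r, f s) t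
      = duhamel μ f t := by
  have hD := continuous_duhamel μ hf
  refine ((volterra_iff (T := t) hD
    (intervalIntegral.continuous_primitive (fun _ _ => hf.intervalIntegrable _ _) 0)).mp
    (fun r _ => ?_) t ⟨ht, le_rfl⟩).symm
  have h := intervalIntegral.integral_eq_sub_of_hasDerivAt (a := 0) (b := r)
    (fun s _ => hasDerivAt_duhamel μ hf s) (Continuous.intervalIntegrable (by fun_prop) _ _)
  rw [intervalIntegral.integral_sub (hf.intervalIntegrable _ _)
    (Continuous.intervalIntegrable (by fun_prop) _ _), intervalIntegral.integral_const_mul,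
    duhamel_zero] at h
  linarith

namespace PositiveOperator

open Scale PathSpace

variable {H : Type*} [NormedAddCommGroup H] [InnerProductSpace ℝ H] [CompleteSpace H]
  {S : PositiveOperator H} {α β ν : ℝ} {B : H →ₗ[ℝ] H →ₗ[ℝ] S.Scale (-1)}

/-- The integrated equation is equivalent to the mild equation forced by the stochastic
convolution. -/
theorem isMildOn_iff_integral (hB : S.BasicBound B) (hα : 0 ≤ α) {x : S.Scale α}
    {z u : C(ℝ≥0, S.Scale α)} {p : ℕ → C(ℝ≥0, ℝ)}
    (hz : ∀ t n, coeff (z t) n = S.noiseCoeff ν β p t n) {T : ℝ≥0} :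
    IsMildOn B ν x z T u ↔ ∀ t ≤ T, ∀ n, coeff (u t) n
        + ∫ r in (0 : ℝ)..t, (ν * (S.lam n * coeff (u r.toNNReal) n)
            + coeff (B (u r.toNNReal).toH (u r.toNNReal).toH) n)
      = coeff x n + √(2 * S.lam n ^ (1 - β)) * p n t := by
  have key : ∀ n, (∀ t ≤ T, coeff (u t) n = Real.exp (-(ν * S.lam n) * t) * coeff x n
      + coeff (z t) n - duhamel (ν * S.lam n)
        (fun s => coeff (B (u s.toNNReal).toH (u s.toNNReal).toH) n) t) ↔
      ∀ t ≤ T, coeff (u t) n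
        + ∫ r in (0 : ℝ)..t, (ν * (S.lam n * coeff (u r.toNNReal) n)
            + coeff (B (u r.toNNReal).toH (u r.toNNReal).toH) n)
      = coeff x n + √(2 * S.lam n ^ (1 - β)) * p n t := by
    intro n
    set μ : ℝ := ν * S.lam n with hμ
    set σ : ℝ := √(2 * S.lam n ^ (1 - β)) with hσ
    set a : ℝ → ℝ := fun t => coeff (u t.toNNReal) n with ha_def
    set f : ℝ → ℝ := fun s => coeff (B (u s.toNNReal).toH (u s.toNNReal).toH) n with hf_def
    set q : ℝ → ℝ := fun s => p n s.toNNReal with hq_def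
    have ha : Continuous a := (Scale.continuous_coeff n).comp (by fun_prop)
    have hf : Continuous f := (hB.continuous_coeff hα n).comp (f := fun s : ℝ => u s.toNNReal)
      (by fun_prop)
    have hq : Continuous q := by fun_prop
    have hF : Continuous fun t => ∫ s in (0 : ℝ)..t, f s :=
      intervalIntegral.continuous_primitive (fun _ _ => hf.intervalIntegrable _ _) 0
    -- With datum, noise and nonlinearity collected in g, the coordinate equation is a + μ ∫ a = g,
    -- and variation of constants acts on the three terms separately.
    set g : ℝ → ℝ := fun t => (coeff x n + σ * q t) - ∫ s in (0 : ℝ)..t, f s with hg_def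
    have hg : Continuous g := by fun_prop
    have hv := volterra_iff (μ := μ) (T := T) ha hg
    have hR : (∀ t ∈ Set.Icc (0 : ℝ) T, a t + μ * ∫ s in (0 : ℝ)..t, a s = g t) ↔
        ∀ t ≤ T, coeff (u t) n
        + ∫ r in (0 : ℝ)..t, (ν * (S.lam n * coeff (u r.toNNReal) n)
            + coeff (B (u r.toNNReal).toH (u r.toNNReal).toH) n)
      = coeff x n + σ * p n t := by
      have e : ∀ t : ℝ, ∫ r in (0 : ℝ)..t, (ν * (S.lam n * coeff (u r.toNNReal) n)
            + coeff (B (u r.toNNReal).toH (u r.toNNReal).toH) n)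
          = (μ * ∫ s in (0 : ℝ)..t, a s) + ∫ s in (0 : ℝ)..t, f s := by
        intro t
        rw [← intervalIntegral.integral_const_mul, ← intervalIntegral.integral_add
          (Continuous.intervalIntegrable (by fun_prop) _ _) (hf.intervalIntegrable _ _)]
        refine intervalIntegral.integral_congr fun s _ => ?_
        simp only [hμ, ha_def, hf_def]
        ring
      simp only [e]
      constructor
      · intro h t ht
        have := h t ⟨t.coe_nonneg, by exact_mod_cast ht⟩
        simp only [hg_def, ha_def, hq_def, Real.toNNReal_coe] at this ⊢
        linarith
      · intro h t ht
        have := h t.toNNReal (Real.toNNReal_le_iff_le_coe.mpr ht.2)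
        rw [Real.coe_toNNReal t ht.1] at this
        simp only [hg_def, ha_def, hq_def] at this ⊢
        linarith
    have hL : (∀ t ∈ Set.Icc (0 : ℝ) T, a t = g t - μ * duhamel μ g t) ↔
        ∀ t ≤ T, coeff (u t) n = Real.exp (-μ * t) * coeff x n
          + coeff (z t) n - duhamel μ f t := by
      have e : ∀ t : ℝ≥0, g t - μ * duhamel μ g t
          = Real.exp (-μ * t) * coeff x n + coeff (z t) n - duhamel μ f t := by
        intro t
        have h1 : duhamel μ g t = (duhamel μ (fun _ => coeff x n) t + σ * duhamel μ q t)
            - duhamel μ (fun t => ∫ s in (0 : ℝ)..t, f s) t := by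
          rw [← duhamel_const_mul, ← duhamel_add continuous_const (by fun_prop),
            ← duhamel_sub (by fun_prop) hF]
        have h2 := integral_sub_mul_duhamel_integral μ hf t.coe_nonneg
        have h3 := mul_duhamel_const μ (coeff x n) t
        rw [h1, hz, noiseCoeff, ou_apply]
        simp only [hg_def, hq_def, Real.toNNReal_coe]
        linear_combination -h3 - h2
      constructor
      · intro h t ht
        have := h t ⟨t.coe_nonneg, by exact_mod_cast ht⟩
        rw [e] at this
        simpa only [ha_def, Real.toNNReal_coe] using this
      · intro h t ht
        have := h t.toNNReal (Real.toNNReal_le_iff_le_coe.mpr ht.2)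
        rw [← e, Real.coe_toNNReal t ht.1] at this
        exact this
    exact hL.symm.trans (hv.symm.trans hR)
  constructor
  · exact fun h t ht n => (key n).mp (fun s hs => h s hs n) t ht
  · exact fun h t ht n => (key n).mpr (fun s hs => h s hs n) t ht

theorem noiseCoeff_add_time (p : ℕ → C(ℝ≥0, ℝ)) (s t : ℝ≥0) (n : ℕ) :
    S.noiseCoeff ν β p (s + t) n = Real.exp (-(ν * S.lam n) * t) * S.noiseCoeff ν β p s n
      + S.noiseCoeff ν β (fun m => shift s (p m)) t n := by
  simp only [noiseCoeff]
  rw [ou_add_time]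
  ring

/-- Restarting the solution at time `s`. -/
theorem IsMildOn.restart (hB : S.BasicBound B) (hα : 0 ≤ α) {x : S.Scale α}
    {z z' u : C(ℝ≥0, S.Scale α)} {p : ℕ → C(ℝ≥0, ℝ)} {s : ℝ≥0}
    (hz : ∀ t n, coeff (z t) n = S.noiseCoeff ν β p t n)
    (hz' : ∀ t n, coeff (z' t) n = S.noiseCoeff ν β (fun m => shift s (p m)) t n)
    (h : ∀ T, IsMildOn B ν x z T u) (T : ℝ≥0) :
    IsMildOn B ν (u s) z' T ⟨fun t => u (s + t), by fun_prop⟩ := by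
  intro t _ n
  have hc : Continuous fun r : ℝ => coeff (B (u r.toNNReal).toH (u r.toNNReal).toH) n :=
    (hB.continuous_coeff hα n).comp (f := fun s : ℝ => u s.toNNReal) (by fun_prop)
  have h1 := h (s + t) (s + t) le_rfl n
  have h2 := h s s le_rfl n
  have h3 := duhamel_add_time (ν * S.lam n) hc s t
  have h4 : duhamel (ν * S.lam n) (fun r => coeff (B (u (s + r.toNNReal)).toH
      (u (s + r.toNNReal)).toH) n) t = duhamel (ν * S.lam n) (fun r =>
        coeff (B (u ((s + r : ℝ)).toNNReal).toH (u ((s + r : ℝ)).toNNReal).toH) n) t :=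
    duhamel_congr t.coe_nonneg fun r hr => by
      rw [Real.toNNReal_add s.coe_nonneg hr.1, Real.toNNReal_coe]
  have h5 : Real.exp (-(ν * S.lam n) * ((s + t : ℝ≥0) : ℝ))
      = Real.exp (-(ν * S.lam n) * t) * Real.exp (-(ν * S.lam n) * s) := by
    rw [← Real.exp_add, NNReal.coe_add]
    congr 1
    ring
  simp only [ContinuousMap.coe_mk]
  rw [h4, h1, h2, hz, hz, hz', noiseCoeff_add_time, h5, NNReal.coe_add, h3]
  ring

/-- The flow property of the solution map. -/
theorem solution_add_time (hν : 0 < ν) (hα : 0 ≤ α) (hB : S.BasicBound B) (hC4 : CondC4 S B α β)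
    {Sol : S.Scale α × C(ℝ≥0, S.Scale α) → C(ℝ≥0, S.Scale α)}
    (hSol : ∀ x z T, IsMildOn B ν x z T (Sol (x, z))) (x : S.Scale α)
    {z z' : C(ℝ≥0, S.Scale α)} {p : ℕ → C(ℝ≥0, ℝ)} {s : ℝ≥0}
    (hz : ∀ t n, coeff (z t) n = S.noiseCoeff ν β p t n)
    (hz' : ∀ t n, coeff (z' t) n = S.noiseCoeff ν β (fun m => shift s (p m)) t n) (t : ℝ≥0) :
    Sol (x, z) (s + t) = Sol (Sol (x, z) s, z') t :=
  IsMildOn.unique hν hα hB hC4 (fun _ _ => rfl)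
    (IsMildOn.restart hB hα hz hz' (hSol x z) t) (hSol (Sol (x, z) s) z' t) le_rfl

/-- Uniqueness compares the forcings only up to t, so freezing the forcing there is harmless;
adaptedness of the solution follows from that of the frozen forcing. -/
theorem solution_stopAt (hν : 0 < ν) (hα : 0 ≤ α) (hB : S.BasicBound B) (hC4 : CondC4 S B α β)
    {Sol : S.Scale α × C(ℝ≥0, S.Scale α) → C(ℝ≥0, S.Scale α)}
    (hSol : ∀ x z T, IsMildOn B ν x z T (Sol (x, z))) (x : S.Scale α) (z : C(ℝ≥0, S.Scale α))
    (t : ℝ≥0) : Sol (x, z) t = Sol (x, stopAt t z) t :=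
  IsMildOn.unique (z := z) (z' := stopAt t z) hν hα hB hC4
    (fun _ hs => congrArg z (min_eq_left hs).symm)
    (hSol x z t) (hSol x (stopAt t z) t) le_rfl

end PositiveOperator

/-! ### Null events and independence of generated σ-algebras. -/

section

variable {Ω : Type*} {m mΩ : MeasurableSpace Ω} {P : Measure Ω}

/-- Preimages under f and g differ by measurable null sets, which belong to m. The ambient
measurability of f is needed because m holds the measurable null sets, not all their subsets. -/
theorem measurable_of_ae_eq {E : Type*} [MeasurableSpace E] {f g : Ω → E}
    (hm : ∀ N : Set Ω, MeasurableSet N → P N = 0 → MeasurableSet[m] N) (hle : m ≤ mΩ)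
    (hf : Measurable f) (hg : Measurable[m] g) (h : f =ᵐ[P] g) : Measurable[m] f := by
  intro s hs
  have hfs : MeasurableSet (f ⁻¹' s) := hf hs
  have hgs : MeasurableSet (g ⁻¹' s) := hle _ (hg hs)
  have hd : f ⁻¹' s =ᵐ[P] g ⁻¹' s := by
    filter_upwards [h] with ω hω
    change s (f ω) = s (g ω)
    rw [hω]
  obtain ⟨h1, h2⟩ := ae_eq_set.mp hd
  have h1' := hm _ (hfs.diff hgs) h1
  have h2' := hm _ (hgs.diff hfs) h2
  have e : f ⁻¹' s = (g ⁻¹' s \ (g ⁻¹' s \ f ⁻¹' s)) ∪ (f ⁻¹' s \ g ⁻¹' s) := by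
    ext ω
    simp only [Set.mem_union, Set.mem_sdiff]
    tauto
  rw [e]
  exact ((hg hs).diff h2').union h1'

/-- The sets a ∩ d form a π-system generating the join, and on them the product formula follows by
splitting off d first. This is the induction step that collects successive increments. -/
theorem ProbabilityTheory.Indep.sup_left {𝓐 𝓓 𝓗 : MeasurableSpace Ω} [IsProbabilityMeasure P]
    (hA : 𝓐 ≤ mΩ) (hD : 𝓓 ≤ mΩ) (hH : 𝓗 ≤ mΩ) (h1 : Indep 𝓐 𝓗 P) (h2 : Indep 𝓓 (𝓐 ⊔ 𝓗) P) :
    Indep (𝓐 ⊔ 𝓓) 𝓗 P := by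
  rw [Indep_iff] at h1 h2
  set π : Set (Set Ω) := Set.image2 (· ∩ ·) {s | MeasurableSet[𝓐] s} {s | MeasurableSet[𝓓] s}
    with hπ
  have hgen : 𝓐 ⊔ 𝓓 = MeasurableSpace.generateFrom π := by
    refine le_antisymm (sup_le (fun s hs => ?_) (fun s hs => ?_)) ?_
    · exact MeasurableSpace.measurableSet_generateFrom
        ⟨s, hs, Set.univ, MeasurableSet.univ, Set.inter_univ s⟩
    · exact MeasurableSpace.measurableSet_generateFrom
        ⟨Set.univ, MeasurableSet.univ, s, hs, Set.univ_inter s⟩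
    · refine MeasurableSpace.generateFrom_le ?_
      rintro _ ⟨a, ha, d, hd, rfl⟩
      exact MeasurableSet.inter ((le_sup_left : 𝓐 ≤ 𝓐 ⊔ 𝓓) _ ha) ((le_sup_right : 𝓓 ≤ 𝓐 ⊔ 𝓓) _ hd)
  have hpi : IsPiSystem π := by
    rintro _ ⟨a, ha, d, hd, rfl⟩ _ ⟨a', ha', d', hd', rfl⟩ _
    exact ⟨a ∩ a', MeasurableSet.inter ha ha', d ∩ d', MeasurableSet.inter hd hd',
      Set.inter_inter_inter_comm _ _ _ _⟩
  refine IndepSets.indep (sup_le hA hD) hH hpi (@MeasurableSpace.isPiSystem_measurableSet Ω 𝓗)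
    hgen (@MeasurableSpace.generateFrom_measurableSet Ω 𝓗).symm ?_
  rw [IndepSets_iff]
  rintro _ t ⟨a, ha, d, hd, rfl⟩ ht
  have ha' : MeasurableSet[𝓐 ⊔ 𝓗] a := (le_sup_left : 𝓐 ≤ 𝓐 ⊔ 𝓗) _ ha
  have ht' : MeasurableSet[𝓐 ⊔ 𝓗] t := (le_sup_right : 𝓗 ≤ 𝓐 ⊔ 𝓗) _ ht
  have e : a ∩ d ∩ t = d ∩ (a ∩ t) := by
    ext
    simp only [Set.mem_inter_iff]
    tauto
  have e' : a ∩ d = d ∩ a := Set.inter_comm _ _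
  change P (a ∩ d ∩ t) = P (a ∩ d) * P t
  rw [e, h2 d _ hd (MeasurableSet.inter ha' ht'), h1 a t ha ht, e', h2 d a hd ha', mul_assoc]

end

/-! ### Brownian laws and independence on path space. -/

namespace PathSpace

/-- By `measurable_of_eval` the identity is measurable from the cylinder σ-algebra to the Borel one.
Laws and independence can then be transferred between path space and the product of all times. -/
theorem borel_eq_comap :
    (inferInstance : MeasurableSpace C(ℝ≥0, ℝ)) =
      MeasurableSpace.comap (fun (f : C(ℝ≥0, ℝ)) (t : ℝ≥0) => f t) inferInstance := by
  refine le_antisymm ?_ (Measurable.comap_le (measurable_pi_lambda _ measurable_eval))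
  have h : @Measurable _ _ (MeasurableSpace.comap (fun (f : C(ℝ≥0, ℝ)) (t : ℝ≥0) => f t)
      inferInstance) _ (id : C(ℝ≥0, ℝ) → C(ℝ≥0, ℝ)) :=
    @measurable_of_eval ℝ _ _ _ _ _
      (MeasurableSpace.comap (fun (f : C(ℝ≥0, ℝ)) (t : ℝ≥0) => f t) inferInstance) _
      fun t => (measurable_pi_apply t).comp (comap_measurable _)
  intro s hs
  exact h hs

variable {Ω : Type*} [mΩ : MeasurableSpace Ω] {P : Measure Ω}

theorem isProjectiveLimit_map_path {X : Ω → C(ℝ≥0, ℝ)} (hX : Measurable X)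
    (h : IsPreBrownianReal (fun t ω => X ω t) P) :
    IsProjectiveLimit ((P.map X).map fun (f : C(ℝ≥0, ℝ)) (t : ℝ≥0) => f t)
      BrownianReal.projectiveFamily := by
  intro I
  have hc : Measurable fun (f : C(ℝ≥0, ℝ)) (t : ℝ≥0) => f t :=
    measurable_pi_lambda _ measurable_eval
  rw [Measure.map_map (Finset.measurable_restrict I) hc,
    Measure.map_map ((Finset.measurable_restrict I).comp hc) hX]
  exact (h.hasLaw I).map_eq

/-- All continuous pre-Brownian motions have the same law on path space. -/
theorem map_eq_of_isPreBrownianReal {Ω' : Type*} [MeasurableSpace Ω'] {P' : Measure Ω'}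
    {X : Ω → C(ℝ≥0, ℝ)} {X' : Ω' → C(ℝ≥0, ℝ)} (hX : Measurable X) (hX' : Measurable X')
    (h : IsPreBrownianReal (fun t ω => X ω t) P) (h' : IsPreBrownianReal (fun t ω => X' ω t) P') :
    P.map X = P'.map X' := by
  have hc : Measurable fun (f : C(ℝ≥0, ℝ)) (t : ℝ≥0) => f t :=
    measurable_pi_lambda _ measurable_eval
  have e : (P.map X).map (fun (f : C(ℝ≥0, ℝ)) (t : ℝ≥0) => f t)
      = (P'.map X').map fun (f : C(ℝ≥0, ℝ)) (t : ℝ≥0) => f t :=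
    (isProjectiveLimit_map_path hX h).unique (isProjectiveLimit_map_path hX' h')
  ext s hs
  have hs' : MeasurableSet[MeasurableSpace.comap (fun (f : C(ℝ≥0, ℝ)) (t : ℝ≥0) => f t)
      inferInstance] s := by
    rw [← borel_eq_comap]
    exact hs
  obtain ⟨s', hs', rfl⟩ := hs'
  rw [← Measure.map_apply hc hs', e, Measure.map_apply hc hs']

theorem iIndepFun_path {X : ℕ → Ω → C(ℝ≥0, ℝ)}
    (h : iIndepFun (fun (n : ℕ) (ω : Ω) (t : ℝ≥0) => X n ω t) P) : iIndepFun X P := by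
  rw [iIndepFun_iff_iIndep] at h ⊢
  have e : (fun n => MeasurableSpace.comap (X n) inferInstance)
      = fun n => MeasurableSpace.comap (fun (ω : Ω) (t : ℝ≥0) => X n ω t) inferInstance := by
    funext n
    rw [borel_eq_comap, MeasurableSpace.comap_comp]
    rfl
  rw [e]
  exact h

end PathSpace

/-! ### Continuous Wiener paths and independence of the future from the past. -/

/-- A cylindrical Wiener process all of whose paths are continuous. -/
structure IsContinuousWiener {Ω : Type*} [mΩ : MeasurableSpace Ω] (P : Measure Ω)
    (𝓕 : Filtration ℝ≥0 mΩ) (W : Ω → ℕ → C(ℝ≥0, ℝ)) : Prop where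
  brownian : ∀ n, IsPreBrownianReal (fun t ω => W ω n t) P
  indep : iIndepFun (fun n ω => W ω n) P
  adapted : ∀ n t, Measurable[𝓕 t] fun ω => W ω n t
  indep_increments : ∀ s t, s ≤ t →
    Indep (MeasurableSpace.comap (fun (ω : Ω) (n : ℕ) => W ω n t - W ω n s) inferInstance)
      (𝓕 s) P
  zero : ∀ ω n, W ω n 0 = 0

namespace IsContinuousWiener

open PathSpace

variable {Ω : Type*} [mΩ : MeasurableSpace Ω] {P : Measure Ω}
  {𝓕 : Filtration ℝ≥0 mΩ} {W : Ω → ℕ → C(ℝ≥0, ℝ)}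

theorem measurable (hW : IsContinuousWiener P 𝓕 W) : Measurable W :=
  measurable_pi_lambda _ fun n => measurable_of_eval fun t => (hW.adapted n t).mono (𝓕.le t) le_rfl

/-- The increments after time `s` have the law of the whole path. -/
theorem map_shift (hW : IsContinuousWiener P 𝓕 W) (s : ℝ≥0) :
    P.map (fun ω n => shift s (W ω n)) = P.map W := by
  have hm : ∀ n, Measurable fun ω => W ω n := fun n => (measurable_pi_apply n).comp hW.measurable
  have hm' : ∀ n, Measurable fun ω => shift s (W ω n) := fun n => (measurable_shift s).comp (hm n)
  have h1 := hW.indep.map_fun_eq_infinitePi_map hm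
  have h2 := (hW.indep.comp (fun _ => shift s) fun _ => measurable_shift s).map_fun_eq_infinitePi_map
    hm'
  refine h2.trans (Eq.trans ?_ h1.symm)
  congr 1
  funext n
  exact map_eq_of_isPreBrownianReal (hm' n) (hm n) ((hW.brownian n).shift s) (hW.brownian n)

variable [IsProbabilityMeasure P]

/-- The hypothesis treats one increment at a time. Induction over finite sets of times, adding the
largest last, treats finitely many; their σ-algebras are directed, and together they make the
shifted path measurable. -/
theorem indep_shift (hW : IsContinuousWiener P 𝓕 W) (s : ℝ≥0) :
    Indep (MeasurableSpace.comap (fun ω n => shift s (W ω n)) inferInstance) (𝓕 s) P := by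
  let D : ℝ≥0 → MeasurableSpace Ω := fun t =>
    MeasurableSpace.comap (fun (ω : Ω) (n : ℕ) => W ω n (s + t) - W ω n s) inferInstance
  let G : Finset ℝ≥0 → MeasurableSpace Ω := fun I => ⨆ t ∈ I, D t
  have hDmeas : ∀ r t : ℝ≥0, r ≤ t →
      Measurable[𝓕 t] fun (ω : Ω) (n : ℕ) => W ω n t - W ω n r := fun r t hrt =>
    @measurable_pi_lambda _ _ _ (𝓕 t) _ _ fun n =>
      (hW.adapted n t).sub ((hW.adapted n r).mono (𝓕.mono hrt) le_rfl)
  have hD𝓕 : ∀ t, D t ≤ 𝓕 (s + t) := fun t => (hDmeas s (s + t) le_self_add).comap_le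
  have hGD : ∀ {t : ℝ≥0} {I : Finset ℝ≥0}, t ∈ I → D t ≤ G I := fun {t I} ht =>
    le_iSup₂ (f := fun t (_ : t ∈ I) => D t) t ht
  have hG𝓕 : ∀ {I : Finset ℝ≥0} {b : ℝ≥0}, (∀ t ∈ I, t ≤ b) → G I ≤ 𝓕 (s + b) := fun h =>
    iSup₂_le fun t ht => (hD𝓕 t).trans (𝓕.mono (add_le_add_right (h t ht) s))
  have hinc := hW.indep_increments
  have hind : ∀ I : Finset ℝ≥0, Indep (G I) (𝓕 s) P := by
    intro I
    induction I using Finset.induction_on_max with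
    | empty =>
      have : G ∅ = ⊥ := by simp [G]
      rw [this]
      exact indep_bot_left _
    | insert a I hI ih =>
      -- The last time before a, or 0 if there is none. The new information is the increment from s
      -- + b to s + a, independent of 𝓕 (s + b), which contains both the earlier increments and 𝓕 s.
      set b : ℝ≥0 := I.sup id with hb
      have hba : b ≤ a := Finset.sup_le fun t ht => (hI t ht).le
      have hIb : ∀ t ∈ I, t ≤ b := fun t ht => Finset.le_sup (f := id) ht
      let E : MeasurableSpace Ω := MeasurableSpace.comap
        (fun (ω : Ω) (n : ℕ) => W ω n (s + a) - W ω n (s + b)) inferInstance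
      have hbm : Measurable[G I] fun (ω : Ω) (n : ℕ) => W ω n (s + b) - W ω n s := by
        rcases I.eq_empty_or_nonempty with hI0 | hI0
        · have hb0 : b = 0 := by simp [hb, hI0]
          simp only [hb0, add_zero, sub_self]
          exact measurable_const
        · obtain ⟨t, ht, hbt⟩ := Finset.exists_mem_eq_sup I hI0 id
          have hbI : b ∈ I := by
            rw [hb, hbt]
            exact ht
          exact (comap_measurable _).mono (hGD hbI) le_rfl
      have hle : G (insert a I) ≤ G I ⊔ E := by
        refine iSup₂_le fun t ht => ?_
        rcases Finset.mem_insert.mp ht with rfl | ht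
        · refine Measurable.comap_le ?_
          have h1 : Measurable[G I ⊔ E] fun (ω : Ω) (n : ℕ) => W ω n (s + b) - W ω n s :=
            hbm.mono le_sup_left le_rfl
          have h2 : Measurable[G I ⊔ E] fun (ω : Ω) (n : ℕ) => W ω n (s + t) - W ω n (s + b) :=
            (comap_measurable _).mono le_sup_right le_rfl
          have h3 := h2.add h1
          have e : (fun (ω : Ω) (n : ℕ) => W ω n (s + t) - W ω n s)
              = (fun ω n => W ω n (s + t) - W ω n (s + b))
                + fun ω n => W ω n (s + b) - W ω n s := by
            funext ω n
            simp
          rw [e]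
          exact h3
        · exact (hGD ht).trans le_sup_left
      have hEind : Indep E (𝓕 (s + b)) P :=
        hinc (s + b) (s + a) (add_le_add_right hba s)
      have hEle : E ≤ mΩ :=
        (hDmeas (s + b) (s + a) (add_le_add_right hba s)).comap_le.trans (𝓕.le (s + a))
      have := @Indep.sup_left Ω mΩ P (G I) E (𝓕 s) _ ((hG𝓕 hIb).trans (𝓕.le _)) hEle (𝓕.le s) ih
        (indep_of_indep_of_le_right hEind (sup_le (hG𝓕 hIb) (𝓕.mono le_self_add)))
      exact indep_of_indep_of_le_left this hle
  have hdir : Directed (· ≤ ·) G := Monotone.directed_le fun I J hIJ =>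
    iSup₂_le fun t ht => hGD (Finset.mem_of_subset hIJ ht)
  have h := indep_iSup_of_directed_le hind
    (fun I => (hG𝓕 (b := I.sup id) fun t ht => Finset.le_sup (f := id) ht).trans (𝓕.le _))
    (𝓕.le s) hdir
  refine indep_of_indep_of_le_left h (Measurable.comap_le ?_)
  refine @measurable_pi_lambda _ _ _ (⨆ I, G I) _ _ fun n => ?_
  refine @measurable_of_eval ℝ _ _ _ _ _ (⨆ I, G I) _ fun t => ?_
  have h1 : Measurable[D t] fun (ω : Ω) (n : ℕ) => W ω n (s + t) - W ω n s := comap_measurable _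
  exact ((measurable_pi_apply n).comp h1).mono
    ((hGD (Finset.mem_singleton_self t)).trans (le_iSup G {t})) le_rfl

/-- The increments after time `s`, jointly with the past. -/
theorem map_prod_shift (hW : IsContinuousWiener P 𝓕 W) (s : ℝ≥0) {E : Type*} [MeasurableSpace E]
    {U : Ω → E} (hU : Measurable[𝓕 s] U) :
    P.map (fun ω => (U ω, fun n => shift s (W ω n))) = (P.map U).prod (P.map W) := by
  have hm : Measurable fun ω n => shift s (W ω n) := measurable_pi_lambda _ fun n =>
    (measurable_shift s).comp ((measurable_pi_apply n).comp hW.measurable)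
  have hind : IndepFun U (fun ω n => shift s (W ω n)) P := by
    rw [IndepFun_iff_Indep]
    exact (indep_of_indep_of_le_right (hW.indep_shift s) hU.comap_le).symm
  rw [(indepFun_iff_map_prod_eq_prod_map_map (hU.mono (𝓕.le s) le_rfl).aemeasurable
    hm.aemeasurable).mp hind, hW.map_shift]

end IsContinuousWiener

/-- A cylindrical Wiener process has a modification with continuous paths. -/
theorem IsCylindricalWiener.exists_continuous {Ω : Type*} [mΩ : MeasurableSpace Ω] {P : Measure Ω}
    [IsProbabilityMeasure P] {𝓕 : Filtration ℝ≥0 mΩ}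
    (h𝓕 : ∀ N : Set Ω, MeasurableSet N → P N = 0 → MeasurableSet[𝓕 0] N)
    {w : ℕ → ℝ≥0 → Ω → ℝ} (hw : IsCylindricalWiener P 𝓕 w) :
    ∃ W : Ω → ℕ → C(ℝ≥0, ℝ), IsContinuousWiener P 𝓕 W ∧ ∀ᵐ ω ∂P, ∀ n t, W ω n t = w n t ω := by
  have hgood : ∀ᵐ ω ∂P, ∀ n, Continuous (fun t => w n t ω) ∧ w n 0 ω = 0 := by
    rw [ae_all_iff]
    intro n
    filter_upwards [(hw.brownian n).cont, (hw.brownian n).eval_zero_ae_eq_zero] with ω h1 h2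
    exact ⟨h1, h2⟩
  classical
  -- The exceptional set is enlarged to a measurable null set; it then lies in 𝓕 0, and setting the
  -- paths to zero on it keeps them adapted.
  let N : Set Ω := toMeasurable P {ω | ¬ ∀ n, Continuous (fun t => w n t ω) ∧ w n 0 ω = 0}
  have hN : P N = 0 := by
    rw [measure_toMeasurable]
    exact hgood
  have hNm : MeasurableSet N := measurableSet_toMeasurable _ _
  have hNgood : ∀ ω ∉ N, ∀ n, Continuous (fun t => w n t ω) ∧ w n 0 ω = 0 := by
    intro ω hω
    by_contra h
    exact hω (subset_toMeasurable _ _ h)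
  let W : Ω → ℕ → C(ℝ≥0, ℝ) := fun ω n =>
    if h : ω ∈ N then 0 else ⟨fun t => w n t ω, (hNgood ω h n).1⟩
  have hWN : ∀ ω ∈ N, ∀ n t, W ω n t = 0 := fun ω h n t => by simp only [W, dif_pos h]; rfl
  have hWN' : ∀ ω ∉ N, ∀ n t, W ω n t = w n t ω := fun ω h n t => by
    simp only [W, dif_neg h]; rfl
  have hae : ∀ᵐ ω ∂P, ∀ n t, W ω n t = w n t ω := by
    filter_upwards [measure_eq_zero_iff_ae_notMem.mp hN] with ω hω
    exact hWN' ω hω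
  refine ⟨W, ⟨fun n => ?_, PathSpace.iIndepFun_path ?_, fun n t => ?_, fun s t hst => ?_,
    fun ω n => ?_⟩, hae⟩
  · refine (hw.brownian n).toIsPreBrownianReal.congr fun t => ?_
    filter_upwards [hae] with ω h
    exact (h n t).symm
  · refine hw.indep.congr fun n => ?_
    filter_upwards [hae] with ω h
    funext t
    exact (h n t).symm
  · have e : (fun ω => W ω n t) = fun ω => if ω ∈ N then 0 else w n t ω := by
      funext ω
      split_ifs with h
      · exact hWN ω h n t
      · exact hWN' ω h n t
    rw [e]
    exact Measurable.ite (𝓕.mono zero_le _ (h𝓕 N hNm hN)) measurable_const (hw.adapted n t)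
  · have h := hw.indep_increments s t hst
    rw [Indep_iff] at h ⊢
    rintro _ B ⟨C, hC, rfl⟩ hB
    have e : (fun (ω : Ω) (n : ℕ) => W ω n t - W ω n s) ⁻¹' C
        =ᵐ[P] (fun (ω : Ω) (n : ℕ) => w n t ω - w n s ω) ⁻¹' C := by
      filter_upwards [hae] with ω hω
      change C _ = C _
      simp only [hω]
    rw [measure_congr e, measure_congr (e.inter (ae_eq_refl B))]
    exact h _ B ⟨C, hC, rfl⟩ hB
  · by_cases h : ω ∈ N
    · exact hWN ω h n 0
    · rw [hWN' ω h]
      exact (hNgood ω h n).2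

/-! ### The noise as a measurable functional, strong solutions and adaptedness. -/

namespace PositiveOperator

open Scale PathSpace

variable {H : Type*} [NormedAddCommGroup H] [InnerProductSpace ℝ H] [CompleteSpace H]
  {S : PositiveOperator H} {α β ν : ℝ} {B : H →ₗ[ℝ] H →ₗ[ℝ] S.Scale (-1)}

theorem Scale.tendsto_ofFinset_range (v : S.Scale α) :
    Tendsto (fun N => (ofFinset (Finset.range N) (coeff v) : S.Scale α)) atTop (𝓝 v) := by
  have h := exists_tendsto_ofFinset (S := S) (α := α) (a := fun _ => coeff v)
    (fun _ => continuous_const) fun _ ε hε => by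
      obtain ⟨N, hN⟩ := (v.summable_sq.hasSum.tendsto_sum_nat.eventually
        (lt_mem_nhds (sub_lt_self _ hε))).exists
      refine ⟨N, fun _ _ M => ?_⟩
      rcases le_total N M with hNM | hNM
      · have h1 := v.summable_sq.sum_le_tsum (Finset.range M)
          fun n _ => lam_rpow_mul_sq_nonneg S α n _
        have h2 := Finset.sum_range_add_sum_Ico (fun n => S.lam n ^ α * coeff v n ^ 2) hNM
        linarith
      · rw [Finset.Ico_eq_empty_of_le hNM, Finset.sum_empty]
        exact hε.le
  obtain ⟨l, hl⟩ := h
  have h1 : Tendsto (fun N => (ofFinset (Finset.range N) (coeff v) : S.Scale α)) atTop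
      (𝓝 (l 0)) := ((continuous_eval_const (0 : ℝ≥0)).tendsto l).comp hl
  have h2 : l 0 = v := by
    refine ext_coeff fun n => ?_
    have h3 := ((Scale.continuous_coeff n).tendsto (l 0)).comp h1
    refine tendsto_nhds_unique h3 (tendsto_const_nhds.congr' ?_)
    filter_upwards [eventually_gt_atTop n] with N hN
    simp [coeff_ofFinset, hN]
  rwa [h2] at h1

theorem Scale.measurable_of_coeff {Ω : Type*} [MeasurableSpace Ω] {f : Ω → S.Scale α}
    (h : ∀ n, Measurable fun ω => coeff (f ω) n) : Measurable f := by
  refine measurable_of_tendsto_metrizable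
    (f := fun N ω => (ofFinset (Finset.range N) (coeff (f ω)) : S.Scale α)) (fun N => ?_)
    (tendsto_pi_nhds.mpr fun ω => tendsto_ofFinset_range (f ω))
  simp only [ofFinset]
  exact Finset.measurable_sum _ fun n _ => (h n).smul_const _

theorem measurable_noiseCoeff (t : ℝ≥0) (n : ℕ) :
    Measurable fun p : ℕ → C(ℝ≥0, ℝ) => S.noiseCoeff ν β p t n := by
  have h : Measurable fun p : ℕ → C(ℝ≥0, ℝ) => ou (ν * S.lam n) (p n) t :=
    (measurable_eval t).comp ((continuous_ou _).measurable.comp (measurable_pi_apply n))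
  exact h.const_mul _

variable {Ω : Type*} [mΩ : MeasurableSpace Ω] {P : Measure Ω} {𝓕 : Filtration ℝ≥0 mΩ}
  {W : Ω → ℕ → C(ℝ≥0, ℝ)}

/-- The stochastic convolution, as a measurable function of the driving paths. -/
theorem exists_noise_map [IsProbabilityMeasure P] (hν : 0 < ν) (hC3 : S.CondC3 α β)
    (hW : IsContinuousWiener P 𝓕 W) :
    ∃ Z : (ℕ → C(ℝ≥0, ℝ)) → C(ℝ≥0, S.Scale α), Measurable Z ∧
      ∀ᵐ p ∂(P.map W), ∀ t n, coeff (Z p t) n = S.noiseCoeff ν β p t n := by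
  let ZN : ℕ → (ℕ → C(ℝ≥0, ℝ)) → C(ℝ≥0, S.Scale α) := fun N p =>
    ⟨fun t => ofFinset (Finset.range N) (S.noiseCoeff ν β p t),
      continuous_ofFinset _ (continuous_noiseCoeff p)⟩
  have hZN : ∀ N, Measurable (ZN N) := fun N => measurable_of_eval fun t => by
    refine measurable_of_coeff fun n => ?_
    simp only [ZN, ContinuousMap.coe_mk, coeff_ofFinset]
    split_ifs
    · exact measurable_noiseCoeff t n
    · exact measurable_const
  have hbound := ae_block_increments_bound (P := P) (w := fun n t ω => W ω n t) hW.brownian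
    (hW.indep.comp (fun _ (f : C(ℝ≥0, ℝ)) (t : ℝ≥0) => f t)
      fun _ => measurable_pi_lambda _ measurable_eval)
    (fun n t => (hW.adapted n t).mono (𝓕.le t) le_rfl) S.block (h := S.step)
    fun k => (S.step_pos k).ne'
  have hlim : ∀ᵐ p ∂(P.map W), ∃ l, Tendsto (fun N => ZN N p) atTop (𝓝 l) := by
    -- Measurability of the convergence set lets the almost sure statement on Ω be read under the
    -- law of W. The limit is then a functional of the path, applicable to shifted paths as well.
    rw [ae_map_iff hW.measurable.aemeasurable (measurableSet_exists_tendsto hZN)]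
    filter_upwards [hbound] with ω hω
    obtain ⟨X, hX, h⟩ := hω
    exact exists_tendsto_noise hν hC3 (hW.zero ω) hX h
  obtain ⟨Z, hZ, hZlim⟩ := measurable_limit_of_tendsto_metrizable_ae
    (fun N => (hZN N).aemeasurable) hlim
  refine ⟨Z, hZ, ?_⟩
  filter_upwards [hZlim] with p hp t n
  have h1 : Tendsto (fun N => coeff (ZN N p t) n) atTop (𝓝 (coeff (Z p t) n)) :=
    ((Scale.continuous_coeff n).tendsto _).comp (((continuous_eval_const t).tendsto _).comp hp)
  refine tendsto_nhds_unique h1 (tendsto_const_nhds.congr' ?_)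
  filter_upwards [eventually_gt_atTop n] with N hN
  simp [ZN, coeff_ofFinset, hN]

variable {w : ℕ → ℝ≥0 → Ω → ℝ} {Sol : S.Scale α × C(ℝ≥0, S.Scale α) → C(ℝ≥0, S.Scale α)}
  {Z : (ℕ → C(ℝ≥0, ℝ)) → C(ℝ≥0, S.Scale α)}

/-- Every solution is given by the solution map. -/
theorem _root_.IsSolutionOn.ae_eq (hν : 0 < ν) (hα : 0 ≤ α) (hB : S.BasicBound B)
    (hC4 : CondC4 S B α β) (hSol : ∀ x z T, IsMildOn B ν x z T (Sol (x, z)))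
    (hZ : ∀ᵐ ω ∂P, ∀ t n, coeff (Z (W ω) t) n = S.noiseCoeff ν β (W ω) t n)
    (hWw : ∀ᵐ ω ∂P, ∀ n t, W ω n t = w n t ω) {𝓖 : ℝ≥0 → MeasurableSpace Ω} {x : S.Scale α}
    {T : ℝ≥0} {u : ℝ≥0 → Ω → S.Scale α} (hu : IsSolutionOn S B ν α β P 𝓖 w x T u) :
    ∀ᵐ ω ∂P, ∀ t ≤ T, u t ω = Sol (x, Z (W ω)) t := by
  filter_upwards [hZ, hWw, hu.continuousOn, hu.equation] with ω hZω hWω hc he t ht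
  -- The solution is continuous on [0,T] only; freezing it at T makes it a point of path space,
  -- where deterministic uniqueness applies.
  let v : C(ℝ≥0, S.Scale α) := ⟨fun t => u (min t T) ω,
    hc.comp_continuous (by fun_prop) fun t => ⟨zero_le, min_le_right t T⟩⟩
  have hv : ∀ t ≤ T, v t = u t ω := fun t ht => by
    change u (min t T) ω = _
    rw [min_eq_left ht]
  have hm : IsMildOn B ν x (Z (W ω)) T v := by
    refine (isMildOn_iff_integral hB hα hZω).mpr fun t ht n => ?_
    rw [hv t ht, hWω, ← he t ht n]
    congr 1
    refine intervalIntegral.integral_congr fun r hr => ?_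
    rw [Set.uIcc_of_le t.coe_nonneg] at hr
    simp only [hv _ ((Real.toNNReal_le_iff_le_coe.mpr hr.2).trans ht)]
  rw [← hv t ht]
  exact IsMildOn.unique hν hα hB hC4 (fun _ _ => rfl) hm (hSol x (Z (W ω)) T) ht

theorem isSolutionOn_flow (hα : 0 ≤ α) (hB : S.BasicBound B)
    (hSol : ∀ x z T, IsMildOn B ν x z T (Sol (x, z)))
    (hZ : ∀ᵐ ω ∂P, ∀ t n, coeff (Z (W ω) t) n = S.noiseCoeff ν β (W ω) t n)
    (hW0 : ∀ ω n, W ω n 0 = 0) (hWw : ∀ᵐ ω ∂P, ∀ n t, W ω n t = w n t ω)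
    {𝓖 : ℝ≥0 → MeasurableSpace Ω} {x : S.Scale α}
    (hadapted : ∀ t, Measurable[𝓖 t] fun ω => Sol (x, Z (W ω)) t) (T : ℝ≥0) :
    IsSolutionOn S B ν α β P 𝓖 w x T fun t ω => Sol (x, Z (W ω)) t where
  adapted t _ := hadapted t
  initial := by
    filter_upwards [hZ] with ω hω
    refine ext_coeff fun n => ?_
    have := (isMildOn_iff_integral hB hα hω).mp (hSol x (Z (W ω)) 0) 0 le_rfl n
    simpa [hW0] using this
  continuousOn := Eventually.of_forall fun ω => (Sol (x, Z (W ω))).continuous.continuousOn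
  equation := by
    filter_upwards [hZ, hWw] with ω hω hω' t ht n
    rw [← hω']
    exact (isMildOn_iff_integral hB hα hω).mp (hSol x (Z (W ω)) T) t ht n

/-- The solution at t depends continuously on the forcing frozen at t, and the coordinates of that
forcing are filters of the driving paths up to t. The σ-algebra m is kept general so that the
augmented natural filtration can be inserted. -/
theorem measurable_flow {m : MeasurableSpace Ω} (hν : 0 < ν) (hα : 0 ≤ α) (hB : S.BasicBound B)
    (hC4 : CondC4 S B α β) (hSolc : Continuous Sol)
    (hSol : ∀ x z T, IsMildOn B ν x z T (Sol (x, z))) (hZm : Measurable Z) (hWm : Measurable[mΩ] W)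
    (hZ : ∀ᵐ ω ∂P, ∀ t n, coeff (Z (W ω) t) n = S.noiseCoeff ν β (W ω) t n)
    (hm : ∀ N : Set Ω, MeasurableSet[mΩ] N → P N = 0 → MeasurableSet[m] N) (hle : m ≤ mΩ)
    {t : ℝ≥0} (hWt : ∀ n, ∀ s ≤ t, Measurable[m] fun ω => W ω n s) (x : S.Scale α) :
    Measurable[m] fun ω => Sol (x, Z (W ω)) t := by
  have hpast : ∀ n, ∀ s ≤ t, Measurable[m] fun ω => S.noiseCoeff ν β (W ω) s n := by
    intro n s hs
    have h1 : Measurable[m] fun ω => stopAt t (W ω n) :=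
      @measurable_of_eval ℝ _ _ _ _ _ m _ fun r => hWt n (min r t) (min_le_right r t)
    have h2 : Measurable[m] fun ω => ou (ν * S.lam n) (stopAt t (W ω n)) s :=
      (measurable_eval s).comp ((continuous_ou _).measurable.comp h1)
    have e : (fun ω => S.noiseCoeff ν β (W ω) s n)
        = fun ω => √(2 * S.lam n ^ (1 - β)) * ou (ν * S.lam n) (stopAt t (W ω n)) s := by
      funext ω
      rw [noiseCoeff]
      congr 1
      refine ou_congr fun r hr => ?_
      change _ = W ω n (min r t)
      rw [min_eq_left (hr.trans hs)]
    rw [e]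
    exact h2.const_mul _
  have hZt : Measurable[m] fun ω => stopAt t (Z (W ω)) := by
    refine @measurable_of_eval (S.Scale α) _ _ _ _ _ m _ fun s => ?_
    refine @Scale.measurable_of_coeff H _ _ _ S α Ω m _ fun n => ?_
    -- Z is a limit determined only almost surely, so its coordinates match the filters off a null
    -- set; this is where m must contain the null events.
    refine measurable_of_ae_eq (P := P) hm hle ?_ (hpast n (min s t) (min_le_right s t)) ?_
    · exact (Scale.continuous_coeff n).measurable.comp
        ((measurable_eval (min s t)).comp (hZm.comp hWm))
    · filter_upwards [hZ] with ω hω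
      exact hω (min s t) n
  have e : (fun ω => Sol (x, Z (W ω)) t) = fun ω => Sol (x, stopAt t (Z (W ω))) t :=
    funext fun ω => solution_stopAt hν hα hB hC4 hSol x (Z (W ω)) t
  have hc : Continuous fun z => Sol (x, z) t := by fun_prop
  rw [e]
  exact hc.measurable.comp hZt

theorem measurable_flow_uncurry (hSolc : Continuous Sol) (hZm : Measurable Z) (t : ℝ≥0) :
    Measurable fun q : S.Scale α × (ℕ → C(ℝ≥0, ℝ)) => Sol (q.1, Z q.2) t :=
  (measurable_eval t).comp (hSolc.measurable.comp
    (measurable_fst.prodMk (hZm.comp measurable_snd)))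

/-- The transition kernels of the flow. -/
noncomputable def transition (μ : Measure (ℕ → C(ℝ≥0, ℝ)))
    (Sol : S.Scale α × C(ℝ≥0, S.Scale α) → C(ℝ≥0, S.Scale α))
    (Z : (ℕ → C(ℝ≥0, ℝ)) → C(ℝ≥0, S.Scale α)) (t : ℝ≥0) : Kernel (S.Scale α) (S.Scale α) :=
  (Kernel.id ×ₖ Kernel.const _ μ).map fun q => Sol (q.1, Z q.2) t

theorem transition_apply {μ : Measure (ℕ → C(ℝ≥0, ℝ))} [IsProbabilityMeasure μ]
    (hSolc : Continuous Sol) (hZm : Measurable Z) (t : ℝ≥0) (x : S.Scale α) :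
    transition μ Sol Z t x = μ.map fun p => Sol (x, Z p) t := by
  have hm := measurable_flow_uncurry hSolc hZm t
  rw [transition, Kernel.map_apply _ hm, Kernel.prod_apply, Kernel.id_apply, Kernel.const_apply,
    Measure.dirac_prod, Measure.map_map hm (by fun_prop)]
  rfl

end PositiveOperator

/-- Freezing the past in the conditional expectation. -/
theorem IsContinuousWiener.condExp_eq {Ω : Type*} [mΩ : MeasurableSpace Ω] {P : Measure Ω}
    [IsProbabilityMeasure P] {𝓕 : Filtration ℝ≥0 mΩ} {W : Ω → ℕ → C(ℝ≥0, ℝ)}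
    (hW : IsContinuousWiener P 𝓕 W) {s : ℝ≥0} {E : Type*} [MeasurableSpace E]
    {F : E × (ℕ → C(ℝ≥0, ℝ)) → ℝ} (hF : Measurable F) {C : ℝ} (hC : ∀ q, |F q| ≤ C) {U : Ω → E}
    (hU : Measurable[𝓕 s] U) :
    P[fun ω => F (U ω, fun n => PathSpace.shift s (W ω n)) | 𝓕 s]
      =ᵐ[P] fun ω => ∫ p, F (U ω, p) ∂(P.map W) := by
  have : IsProbabilityMeasure (P.map W) :=
    Measure.isProbabilityMeasure_map hW.measurable.aemeasurable
  have hY : Measurable fun ω n => PathSpace.shift s (W ω n) := measurable_pi_lambda _ fun n =>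
    (PathSpace.measurable_shift s).comp ((measurable_pi_apply n).comp hW.measurable)
  have hUm : Measurable U := hU.mono (𝓕.le s) le_rfl
  have hG : StronglyMeasurable fun y => ∫ p, F (y, p) ∂(P.map W) :=
    hF.stronglyMeasurable.integral_prod_right'
  have hGC : ∀ y, ‖∫ p, F (y, p) ∂(P.map W)‖ ≤ C := fun y => by
    have := norm_integral_le_of_norm_le_const (μ := P.map W) (f := fun p => F (y, p))
      (Eventually.of_forall fun p => hC (y, p))
    simpa using this
  have hint : Integrable (fun ω => F (U ω, fun n => PathSpace.shift s (W ω n))) P :=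
    Integrable.of_bound (hF.comp (hUm.prodMk hY)).aestronglyMeasurable C
      (Eventually.of_forall fun ω => hC _)
  have hint' : Integrable (fun ω => ∫ p, F (U ω, p) ∂(P.map W)) P :=
    Integrable.of_bound (hG.measurable.comp hUm).aestronglyMeasurable C
      (Eventually.of_forall fun ω => hGC _)
  refine (ae_eq_condExp_of_forall_setIntegral_eq (𝓕.le s) hint (fun A _ _ => hint'.integrableOn)
    (fun A hA _ => ?_) (hG.measurable.comp hU).stronglyMeasurable.aestronglyMeasurable).symm
  have hA' : MeasurableSet A := 𝓕.le s A hA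
  have hI : Measurable[𝓕 s] (A.indicator fun _ => (1 : ℝ)) :=
    (measurable_const (a := (1 : ℝ))).indicator hA
  -- The test event A is bundled with U into one variable of the past, so a single product law with
  -- the shifted noise and Fubini give the defining identity of the conditional expectation.
  have hUI : Measurable[𝓕 s] fun ω => (A.indicator (fun _ => (1 : ℝ)) ω, U ω) := hI.prodMk hU
  have hUIm : Measurable fun ω => (A.indicator (fun _ => (1 : ℝ)) ω, U ω) :=
    hUI.mono (𝓕.le s) le_rfl
  have hlaw := hW.map_prod_shift s hUI
  have hK : Measurable fun q : (ℝ × E) × (ℕ → C(ℝ≥0, ℝ)) => q.1.1 * F (q.1.2, q.2) :=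
    (measurable_fst.comp measurable_fst).mul
      (hF.comp ((measurable_snd.comp measurable_fst).prodMk measurable_snd))
  have hKmap : Integrable (fun q : (ℝ × E) × (ℕ → C(ℝ≥0, ℝ)) => q.1.1 * F (q.1.2, q.2))
      ((P.map fun ω => (A.indicator (fun _ => (1 : ℝ)) ω, U ω)).prod (P.map W)) := by
    rw [← hlaw, integrable_map_measure hK.aestronglyMeasurable (hUIm.prodMk hY).aemeasurable]
    refine Integrable.of_bound (hK.comp (hUIm.prodMk hY)).aestronglyMeasurable C
      (Eventually.of_forall fun ω => ?_)
    simp only [Function.comp_apply, Real.norm_eq_abs]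
    by_cases hω : ω ∈ A
    · rw [Set.indicator_of_mem hω, one_mul]
      exact hC _
    · rw [Set.indicator_of_notMem hω, zero_mul, abs_zero]
      exact (abs_nonneg _).trans (hC (U ω, fun n => PathSpace.shift s (W ω n)))
  have e1 : ∫ ω in A, F (U ω, fun n => PathSpace.shift s (W ω n)) ∂P
      = ∫ ω, A.indicator (fun _ => (1 : ℝ)) ω
        * F (U ω, fun n => PathSpace.shift s (W ω n)) ∂P := by
    rw [← integral_indicator hA']
    refine integral_congr_ae (Eventually.of_forall fun ω => ?_)
    by_cases h : ω ∈ A <;> simp [h]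
  have e2 : ∫ ω in A, ∫ p, F (U ω, p) ∂(P.map W) ∂P
      = ∫ ω, A.indicator (fun _ => (1 : ℝ)) ω * ∫ p, F (U ω, p) ∂(P.map W) ∂P := by
    rw [← integral_indicator hA']
    refine integral_congr_ae (Eventually.of_forall fun ω => ?_)
    by_cases h : ω ∈ A <;> simp [h]
  have e3 := integral_map (hUIm.prodMk hY).aemeasurable
    (hK.aestronglyMeasurable (μ := P.map fun ω =>
      ((A.indicator (fun _ => (1 : ℝ)) ω, U ω), fun n => PathSpace.shift s (W ω n))))
  have e4 := integral_map (μ := P) hUIm.aemeasurable (f := fun y : ℝ × E => y.1 * ∫ p, F (y.2, p) ∂(P.map W))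
    (measurable_fst.mul (hG.measurable.comp measurable_snd)).aestronglyMeasurable
  rw [e1, e2, ← e4, ← e3, hlaw, integral_prod _ hKmap]
  simp only [integral_const_mul]

/-! ### Flow property, transition semigroup and Feller property. -/

namespace PositiveOperator

open Scale PathSpace

variable {H : Type*} [NormedAddCommGroup H] [InnerProductSpace ℝ H] [CompleteSpace H]
  {S : PositiveOperator H} {α β ν : ℝ} {B : H →ₗ[ℝ] H →ₗ[ℝ] S.Scale (-1)}
  {Ω : Type*} [mΩ : MeasurableSpace Ω] {P : Measure Ω} {𝓕 : Filtration ℝ≥0 mΩ}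
  {W : Ω → ℕ → C(ℝ≥0, ℝ)} {Sol : S.Scale α × C(ℝ≥0, S.Scale α) → C(ℝ≥0, S.Scale α)}
  {Z : (ℕ → C(ℝ≥0, ℝ)) → C(ℝ≥0, S.Scale α)}

/-- Almost surely, the flow restarts at time `s` with the increments of the noise. -/
theorem ae_flow_add_time [IsProbabilityMeasure P] (hν : 0 < ν) (hα : 0 ≤ α) (hB : S.BasicBound B)
    (hC4 : CondC4 S B α β) (hSol : ∀ x z T, IsMildOn B ν x z T (Sol (x, z)))
    (hW : IsContinuousWiener P 𝓕 W)
    (hZ : ∀ᵐ p ∂(P.map W), ∀ t n, coeff (Z p t) n = S.noiseCoeff ν β p t n) (x : S.Scale α)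
    (s t : ℝ≥0) : ∀ᵐ ω ∂P, Sol (x, Z (W ω)) (s + t)
      = Sol (Sol (x, Z (W ω)) s, Z fun n => shift s (W ω n)) t := by
  have h1 := ae_of_ae_map hW.measurable.aemeasurable hZ
  have hY : Measurable fun ω n => shift s (W ω n) := measurable_pi_lambda _ fun n =>
    (measurable_shift s).comp ((measurable_pi_apply n).comp hW.measurable)
  -- The identification of Z holds almost everywhere for the law of W; as the shifted path has the
  -- same law, it holds for that path too.
  rw [← hW.map_shift s] at hZ
  have h2 := ae_of_ae_map hY.aemeasurable hZ
  filter_upwards [h1, h2] with ω hω hω'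
  exact solution_add_time hν hα hB hC4 hSol x hω hω' t

theorem transition_zero {μ : Measure (ℕ → C(ℝ≥0, ℝ))} [IsProbabilityMeasure μ]
    (hSolc : Continuous Sol) (hZm : Measurable Z) (h0 : ∀ x, ∀ᵐ p ∂μ, Sol (x, Z p) 0 = x) :
    transition μ Sol Z 0 = Kernel.id := by
  ext1 x
  rw [transition_apply hSolc hZm, Measure.map_congr (h0 x), Measure.map_const, measure_univ,
    one_smul, Kernel.id_apply]

/-- Chapman–Kolmogorov: the state at s and the shifted noise have a product law, so the law at s + t
is obtained by integrating the flow first over fresh noise and then over the state at s. -/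
theorem transition_add [IsProbabilityMeasure P] (hSolc : Continuous Sol) (hZm : Measurable Z)
    (hW : IsContinuousWiener P 𝓕 W) {s t : ℝ≥0}
    (hadapted : ∀ x, Measurable[𝓕 s] fun ω => Sol (x, Z (W ω)) s)
    (hflow : ∀ x, ∀ᵐ ω ∂P, Sol (x, Z (W ω)) (s + t)
      = Sol (Sol (x, Z (W ω)) s, Z fun n => shift s (W ω n)) t) :
    transition (P.map W) Sol Z (s + t)
      = transition (P.map W) Sol Z t ∘ₖ transition (P.map W) Sol Z s := by
  have : IsProbabilityMeasure (P.map W) :=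
    Measure.isProbabilityMeasure_map hW.measurable.aemeasurable
  have hY : Measurable fun ω n => shift s (W ω n) := measurable_pi_lambda _ fun n =>
    (measurable_shift s).comp ((measurable_pi_apply n).comp hW.measurable)
  have hm := measurable_flow_uncurry hSolc hZm
  have hmx : ∀ r x, Measurable fun p => Sol (x, Z p) r := fun r x =>
    (hm r).comp (measurable_const.prodMk measurable_id)
  ext x A hA
  rw [Kernel.comp_apply' _ _ _ hA]
  simp only [transition_apply hSolc hZm]
  rw [Measure.map_map (hmx _ x) hW.measurable, Measure.map_map (hmx _ x) hW.measurable]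
  have e1 : P.map ((fun p => Sol (x, Z p) (s + t)) ∘ W)
      = ((P.map ((fun p => Sol (x, Z p) s) ∘ W)).prod (P.map W)).map
        fun q => Sol (q.1, Z q.2) t := by
    have h := hW.map_prod_shift s (hadapted x)
    have hp : P.map ((fun p => Sol (x, Z p) s) ∘ W) = P.map fun ω => Sol (x, Z (W ω)) s := rfl
    rw [hp, ← h, Measure.map_map (hm t) (((hadapted x).mono (𝓕.le s) le_rfl).prodMk hY)]
    exact Measure.map_congr (hflow x)
  rw [e1, Measure.map_apply (hm t) hA, Measure.prod_apply (hm t hA)]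
  refine lintegral_congr fun y => ?_
  rw [Measure.map_apply (hmx t y) hA]
  rfl

/-- For each fixed noise path the solution is continuous in x; boundedness of φ allows dominated
convergence. -/
theorem continuous_integral_transition {μ : Measure (ℕ → C(ℝ≥0, ℝ))} [IsProbabilityMeasure μ]
    (hSolc : Continuous Sol) (hZm : Measurable Z) (t : ℝ≥0) {φ : S.Scale α → ℝ}
    (hφ : Continuous φ) {C : ℝ} (hC : ∀ y, |φ y| ≤ C) :
    Continuous fun x => ∫ y, φ y ∂(transition μ Sol Z t x) := by
  have hmx : ∀ x, Measurable fun p => Sol (x, Z p) t := fun x =>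
    (measurable_flow_uncurry hSolc hZm t).comp (measurable_const.prodMk measurable_id)
  have e : ∀ x, ∫ y, φ y ∂(transition μ Sol Z t x) = ∫ p, φ (Sol (x, Z p) t) ∂μ := fun x => by
    rw [transition_apply hSolc hZm, integral_map (hmx x).aemeasurable
      hφ.measurable.aestronglyMeasurable]
  simp only [e]
  refine continuous_of_dominated (bound := fun _ => C)
    (fun x => (hφ.measurable.comp (hmx x)).aestronglyMeasurable)
    (fun x => Eventually.of_forall fun p => hC _) (integrable_const C)
    (Eventually.of_forall fun p => ?_)
  fun_prop

end PositiveOperator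

/-! ### The augmented natural filtration and the main theorem. -/

theorem le_augmentedNatural {Ω : Type*} [mΩ : MeasurableSpace Ω] {P : Measure Ω}
    {w : ℕ → ℝ≥0 → Ω → ℝ} {s t : ℝ≥0} (hst : s ≤ t) (n : ℕ) :
    Measurable[augmentedNatural P w t] (w n s) := by
  have h : MeasurableSpace.comap (w n s) inferInstance ≤ augmentedNatural P w t :=
    le_sup_of_le_left (le_iSup_of_le n
      (le_iSup₂ (f := fun s (_ : s ≤ t) => MeasurableSpace.comap (w n s) inferInstance) s hst))
  exact (comap_measurable _).mono h le_rfl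

theorem measurableSet_augmentedNatural_of_null {Ω : Type*} [mΩ : MeasurableSpace Ω]
    {P : Measure Ω} {w : ℕ → ℝ≥0 → Ω → ℝ} {t : ℝ≥0} {N : Set Ω} (hN : MeasurableSet N)
    (hP : P N = 0) : MeasurableSet[augmentedNatural P w t] N :=
  (le_sup_right : _ ≤ augmentedNatural P w t) N
    (MeasurableSpace.measurableSet_generateFrom ⟨hN, hP⟩)

theorem IsCylindricalWiener.augmentedNatural_le {Ω : Type*} [mΩ : MeasurableSpace Ω]
    {P : Measure Ω} {𝓕 : Filtration ℝ≥0 mΩ}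
    (h𝓕 : ∀ N : Set Ω, MeasurableSet N → P N = 0 → MeasurableSet[𝓕 0] N)
    {w : ℕ → ℝ≥0 → Ω → ℝ} (hw : IsCylindricalWiener P 𝓕 w) (t : ℝ≥0) :
    augmentedNatural P w t ≤ 𝓕 t := by
  refine sup_le (iSup_le fun n => iSup₂_le fun s hs => ?_)
    (MeasurableSpace.generateFrom_le fun N hN => 𝓕.mono zero_le _ (h𝓕 N hN.1 hN.2))
  exact ((hw.adapted n s).mono (𝓕.mono hs) le_rfl).comap_le

theorem mainTheorem3 {H : Type*} [NormedAddCommGroup H] [InnerProductSpace ℝ H] [CompleteSpace H]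
    (S : PositiveOperator H) (B : H →ₗ[ℝ] H →ₗ[ℝ] S.Scale (-1)) (hB : S.BasicBound B)
    (ν α β : ℝ) (hν : 0 < ν)
    (hC2 : S.CondC2 B β) (hC3 : S.CondC3 α β) (hC4 : S.CondC4 B α β)
    {Ω : Type*} [mΩ : MeasurableSpace Ω] (P : Measure Ω) [IsProbabilityMeasure P]
    (𝓕 : Filtration ℝ≥0 mΩ)
    (h𝓕 : ∀ N : Set Ω, MeasurableSet N → P N = 0 → MeasurableSet[𝓕 0] N)
    (w : ℕ → ℝ≥0 → Ω → ℝ) (hw : IsCylindricalWiener P 𝓕 w) :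
    -- `u x` is the solution with initial datum `x`; `κ t x` is the law of its value at time `t`
    ∃ (u : S.Scale α → ℝ≥0 → Ω → S.Scale α) (κ : ℝ≥0 → Kernel (S.Scale α) (S.Scale α)),
      -- existence of a strong solution, on every interval `[0,T]`
      (∀ (x : S.Scale α) (T : ℝ≥0),
        IsSolutionOn S B ν α β P (augmentedNatural P w) w x T (u x)) ∧
      -- pathwise uniqueness, on every interval `[0,T]`
      (∀ (x : S.Scale α) (T : ℝ≥0) (u₁ u₂ : ℝ≥0 → Ω → S.Scale α),
        IsSolutionOn S B ν α β P 𝓕 w x T u₁ → IsSolutionOn S B ν α β P 𝓕 w x T u₂ →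
          ∀ᵐ ω ∂P, ∀ t ≤ T, u₁ t ω = u₂ t ω) ∧
      -- the transition semigroup
      (∀ t x, κ t x = P.map (u x t)) ∧
      κ 0 = Kernel.id ∧
      (∀ s t, κ (s + t) = κ t ∘ₖ κ s) ∧
      -- the Markov property
      (∀ (x : S.Scale α) (s t : ℝ≥0) (φ : S.Scale α → ℝ), Measurable φ → (∃ C, ∀ y, |φ y| ≤ C) →
        P[fun ω => φ (u x (s + t) ω) | 𝓕 s] =ᵐ[P] fun ω => ∫ y, φ y ∂(κ t (u x s ω))) ∧
      -- the Feller property: `P_t` maps `C_b(H^α)` to `C_b(H^α)`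
      (∀ (t : ℝ≥0) (φ : S.Scale α → ℝ), Continuous φ → (∃ C, ∀ y, |φ y| ≤ C) →
        Continuous (fun x => ∫ y, φ y ∂(κ t x)) ∧ ∃ C, ∀ x, |∫ y, φ y ∂(κ t x)| ≤ C) := by
  have hα := hC3.nonneg
  obtain ⟨W, hW, hWw⟩ := hw.exists_continuous h𝓕
  obtain ⟨Sol, hSolc, hSol⟩ := PositiveOperator.exists_solution_map hν hα hB hC2 hC4
  obtain ⟨Z, hZm, hZ⟩ := PositiveOperator.exists_noise_map (β := β) hν hC3 hW
  have hZW := ae_of_ae_map hW.measurable.aemeasurable hZ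
  have : IsProbabilityMeasure (P.map W) :=
    Measure.isProbabilityMeasure_map hW.measurable.aemeasurable
  have hadapted : ∀ x t, Measurable[augmentedNatural P w t] fun ω => Sol (x, Z (W ω)) t := by
    intro x t
    have hle := (hw.augmentedNatural_le h𝓕 t).trans (𝓕.le t)
    refine PositiveOperator.measurable_flow (P := P) hν hα hB hC4 hSolc hSol hZm hW.measurable hZW
      (fun N hN hP => measurableSet_augmentedNatural_of_null hN hP) hle (fun n s hs => ?_) x
    -- The continuous modification W agrees with w only almost surely, but the augmented σ-algebra
    -- contains the null events, so W is adapted to it.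
    refine measurable_of_ae_eq (P := P)
      (fun N hN hP => measurableSet_augmentedNatural_of_null hN hP) hle
      ((hW.adapted n s).mono (𝓕.le s) le_rfl) (le_augmentedNatural hs n) ?_
    filter_upwards [hWw] with ω hω using hω n s
  have hadapted' : ∀ x t, Measurable[𝓕 t] fun ω => Sol (x, Z (W ω)) t := fun x t =>
    (hadapted x t).mono (hw.augmentedNatural_le h𝓕 t) le_rfl
  have hflow := PositiveOperator.ae_flow_add_time hν hα hB hC4 hSol hW hZ
  have hsol : ∀ x T, IsSolutionOn S B ν α β P (augmentedNatural P w) w x T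
      fun t ω => Sol (x, Z (W ω)) t := fun x =>
    PositiveOperator.isSolutionOn_flow hα hB hSol hZW hW.zero hWw (hadapted x)
  have hmx : ∀ t x, Measurable fun p => Sol (x, Z p) t := fun t x =>
    (PositiveOperator.measurable_flow_uncurry hSolc hZm t).comp (measurable_const.prodMk measurable_id)
  refine ⟨fun x t ω => Sol (x, Z (W ω)) t, PositiveOperator.transition (P.map W) Sol Z, hsol,
    ?_, ?_, ?_, ?_, ?_, ?_⟩
  · intro x T u₁ u₂ h₁ h₂
    filter_upwards [h₁.ae_eq hν hα hB hC4 hSol hZW hWw, h₂.ae_eq hν hα hB hC4 hSol hZW hWw]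
      with ω e₁ e₂ t ht
    rw [e₁ t ht, e₂ t ht]
  · intro t x
    rw [PositiveOperator.transition_apply hSolc hZm, Measure.map_map (hmx t x) hW.measurable]
    rfl
  · refine PositiveOperator.transition_zero hSolc hZm fun x => ?_
    exact (ae_map_iff hW.measurable.aemeasurable ((hmx 0 x) (measurableSet_singleton x))).mpr
      (hsol x 0).initial
  · intro s t
    exact PositiveOperator.transition_add hSolc hZm hW (fun x => hadapted' x s) fun x => hflow x s t
  · rintro x s t φ hφ ⟨C, hC⟩
    have h1 := hW.condExp_eq (F := fun q => φ (Sol (q.1, Z q.2) t))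
      (hφ.comp (PositiveOperator.measurable_flow_uncurry hSolc hZm t)) (fun q => hC _) (hadapted' x s)
    have h2 : (fun ω => φ (Sol (x, Z (W ω)) (s + t))) =ᵐ[P] fun ω =>
        φ (Sol (Sol (x, Z (W ω)) s, Z fun n => PathSpace.shift s (W ω n)) t) := by
      filter_upwards [hflow x s t] with ω hω
      rw [hω]
    refine (condExp_congr_ae h2).trans (h1.trans (Eventually.of_forall fun ω => ?_))
    simp only [PositiveOperator.transition_apply hSolc hZm]
    rw [integral_map (hmx t _).aemeasurable hφ.aestronglyMeasurable]
  · rintro t φ hφ ⟨C, hC⟩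
    refine ⟨PositiveOperator.continuous_integral_transition hSolc hZm t hφ hC, C, fun x => ?_⟩
    have : IsProbabilityMeasure (PositiveOperator.transition (P.map W) Sol Z t x) := by
      rw [PositiveOperator.transition_apply hSolc hZm]
      exact Measure.isProbabilityMeasure_map (hmx t x).aemeasurable
    have h := norm_integral_le_of_norm_le_const
      (μ := PositiveOperator.transition (P.map W) Sol Z t x)
      (f := φ) (Eventually.of_forall hC)
    simpa using h
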